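/- Let $K$ be an algebraically closed field. Let $X=E_1\cup\cdots\cup E_g$ be a chain of elliptic curves over $K$, each $E_j$ marked in two points $p_j,q_j$ such that $p_j-q_j$ is not a torsion point of $E_j$, and with $q_j$ glued to $p_{j+1}$ for $1\le j<g$. A *limit linear series* $g^r_m$ on $X$ consists, for each $j$, of a line bundle $L_j$ of degree $m$ on $E_j$ and an $(r+1)$-dimensional space $V_j\subset H^0(E_j,L_j)$, such that at each node the vanishing sequences $a_0(V_{j+1},p_{j+1})<\cdots<a_r(V_{j+1},p_{j+1})$ and $a_0(V_j,q_j)<\cdots<a_r(V_j,q_j)$ satisfy $a_i(V_{j+1},p_{j+1})+a_{r-i}(V_j,q_j)\ge m$ for all $i$. It has *word type* $w_1w_2\cdots w_g$, with letters in $\{1,\dots,r+1\}$, if for every $j$ and $0\le i\le r$ one has $m-a_{r-i}(V_j,q_j)=a_i(V_j,p_j)$ when $i+1=w_j$, and $m-a_{r-i}(V_j,q_j)=a_i(V_j,p_j)+1$ otherwise. For an effective divisor $x=x_1+\cdots+x_n$ of points of $X$ let $x|_j$ be the effective divisor of degree $n$ on $E_j$ in which every $x_k\in E_j$ is kept, every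 $x_k$ on an earlier component is replaced by $p_j$, and every $x_k$ on a later component is replaced by $q_j$. An *inclusion* $g^{r'}_{m-n}+x_1+\cdots+x_n\hookrightarrow g^r_m$ into a fixed limit linear series $(L_j,V_j)_j$ is an effective divisor $x=x_1+\cdots+x_n$ on $X$ together with subspaces $W_j\subset V_j\cap H^0(E_j,L_j(-x|_j))$ such that $(L_j(-x|_j),W_j)_j$ is a limit linear series $g^{r'}_{m-n}$ on $X$. Let $t,u\ge 1$, $d,s\ge 0$ and $m$ be integers, let $g=(s+1)u$, and suppose that $r:=d-s+t=1$ and that $$\rho=g-(s+1)(s+g-m)=0,\qquad \mu=d-r(t+1)=0 .$$ **Theorem.** Then $d=t+1$, $s=2t$ and $m=2t(u+1)$, and for every limit linear series $g^{2t}_{2t(u+1)}$ on $X$ of word type $(12\cdots(s+1))^u$ the number of inclusions $$g^{t}_{2t(u+1)-(t+1)}+x_1+\cdots+x_{t+1}\hookrightarrow g^{2t}_{2t(u+1)}$$ into it is finite and equal to $$N_1(t,u)=\sum_{k=0}^{d-2}N^s_k(d)\binom{d+u-2-k}{d}.$$ Here $\Gamma^s(d)$ is the directed graph with vertices $(i,j)$,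 $1\le i\le d$, $i\le j\le s+i-1$, and an edge from $(i,j)$ to $(i+1,j')$ for all such pairs of vertices; a top-to-bottom path has exactly one vertex in each row $i=1,\dots,d$; an edge from $(i,j)$ to $(i+1,j')$ is *backwards* if $j'<j$; and $N^s_k(d)$ is the number of top-to-bottom paths in $\Gamma^s(d)$ with exactly $k$ backwards edges. -/

import Mathlib

open scoped Polynomial

noncomputable section

/-! ### Orders of vanishing and linear series on an elliptic curve -/

/-- The order of vanishing at a point `P` of an elliptic curve `W` of a nonzero element `a` of the
affine coordinate ring `K[W]`. At an affine point it is the largest `n` such that `a` lies in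
the `n`-th power of the maximal ideal of the point. At the point at infinity it is minus the pole
order, which is the degree of the norm of `a` from `K[W]` to `K[X]` (for instance `X` has norm
`X ^ 2` and a double pole at infinity, and `Y` has a triple pole there). -/
def pointOrdInt {K : Type*} [Field K] (W : WeierstrassCurve.Affine K) :
    W.Point → W.CoordinateRing → ℤ
  | .zero, a => -((Algebra.norm K[X] a).natDegree : ℤ)
  | .some x y _, a =>
      ((sSup {n : ℕ |
        a ∈ WeierstrassCurve.Affine.CoordinateRing.XYIdeal W x (Polynomial.C y) ^ n} : ℕ) : ℤ)

/-- The order of vanishing at `P` of a nonzero rational function `f = a / b`, with `a` and `b`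
in the affine coordinate ring: the order of `a` minus the order of `b`. -/
def pointOrd {K : Type*} [Field K] (W : WeierstrassCurve.Affine K) (P : W.Point)
    (f : W.FunctionField) : ℤ :=
  pointOrdInt W P (IsLocalization.sec (nonZeroDivisors W.CoordinateRing) f).1 -
    pointOrdInt W P ((IsLocalization.sec (nonZeroDivisors W.CoordinateRing) f).2 :
      W.CoordinateRing)

/-- The rational function `f` is a global section of the line bundle `𝒪(D)`. -/
def IsSectionOf {K : Type*} [Field K] {W : WeierstrassCurve.Affine K} (D : W.Point →₀ ℤ)
    (f : W.FunctionField) : Prop :=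
  f = 0 ∨ ∀ P : W.Point, 0 ≤ pointOrd W P f + D P

/-- The vanishing sequence at `P` of a space `V` of sections of `𝒪(D)`: the `i`-th smallest
(starting with `i = 0`) order of vanishing at `P` of a nonzero section in `V`. A rational function
`f`, as a section of `𝒪(D)`, vanishes at `P` to order `ord_P f + D P`. -/
def vanishingSeq {K : Type*} [Field K] {W : WeierstrassCurve.Affine K} (D : W.Point →₀ ℤ)
    (V : Submodule K W.FunctionField) (P : W.Point) (i : ℕ) : ℕ :=
  Nat.nth (fun n => ∃ f ∈ V, f ≠ 0 ∧ pointOrd W P f + D P = (n : ℤ)) i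

/-! ### Chains of elliptic curves -/

/-- A chain of `g` elliptic curves `E_j`, each marked in two points `p j` and `q j` whose
difference is not a torsion point; `q j` is glued to `p (j + 1)`. -/
structure EllipticChain (K : Type*) [Field K] [DecidableEq K] (g : ℕ) where
  curve : Fin g → WeierstrassCurve.Affine K
  elliptic : ∀ j, (curve j).IsElliptic
  p : ∀ j, (curve j).Point
  q : ∀ j, (curve j).Point
  nontorsion : ∀ j, ¬ IsOfFinAddOrder (p j - q j)

namespace EllipticChain

variable {K : Type*} [Field K] [DecidableEq K] {g : ℕ}

/-- The gluing of `q j` to `p (j + 1)`. -/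
def Glue (X : EllipticChain K g) (a b : Σ j : Fin g, (X.curve j).Point) : Prop :=
  (a.1 : ℕ) + 1 = b.1 ∧ a.2 = X.q a.1 ∧ b.2 = X.p b.1

/-- The points of the nodal curve `X`. -/
def Pt (X : EllipticChain K g) : Type _ := Quot X.Glue

/-- The retraction of the chain onto its component `E_j` on the disjoint union of the components:
the components before `E_j` go to `p j` and those after `E_j` go to `q j`. -/
def retractAux (X : EllipticChain K g) (j : Fin g) (a : Σ j : Fin g, (X.curve j).Point) :
    (X.curve j).Point :=
  if h : a.1 = j then h ▸ a.2 else if a.1 < j then X.p j else X.q j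

theorem retractAux_glue (X : EllipticChain K g) (j : Fin g)
    (a b : Σ j : Fin g, (X.curve j).Point) (h : X.Glue a b) :
    X.retractAux j a = X.retractAux j b := by
  obtain ⟨i, x⟩ := a
  obtain ⟨k, y⟩ := b
  obtain ⟨h1, h2, h3⟩ := h
  simp only at h1 h2 h3
  subst h2 h3
  unfold retractAux
  by_cases hi : i = j
  · subst hi
    have hk : k ≠ i := by rintro rfl; omega
    have hk' : ¬ k < i := by rw [Fin.lt_def]; omega
    simp [hk, hk']
  · by_cases hk : k = j
    · subst hk
      have hi' : i < k := by rw [Fin.lt_def]; omega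
      simp [hi, hi']
    · have hik : i < j ↔ k < j := by
        rw [Fin.lt_def, Fin.lt_def]
        have : (k : ℕ) ≠ j := fun h => hk (Fin.ext h)
        omega
      simp [hi, hk, hik]

/-- The retraction of the chain `X` onto its component `E_j`. -/
def retract (X : EllipticChain K g) (j : Fin g) : X.Pt → (X.curve j).Point :=
  Quot.lift (X.retractAux j) (X.retractAux_glue j)

/-- The divisor on `E_j` induced by an effective divisor `x_1 + ⋯ + x_n` on `X`: points on `E_j`
are kept, points before `E_j` count at `p j`, and points after `E_j` count at `q j`. Thus if `L_j`
is the line bundle on `E_j` that carries the `j`-th aspect of a limit linear series of degree `m`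
(all of the degree being concentrated on `E_j`), then `L_j(-(x_1 + ⋯ + x_n)|_j)` is the one that
carries the `j`-th aspect after twisting down by `x_1 + ⋯ + x_n`. -/
def inducedDivisor (X : EllipticChain K g) {n : ℕ} (x : Sym X.Pt n) (j : Fin g) :
    (X.curve j).Point →₀ ℤ :=
  ((x : Multiset X.Pt).map fun y => Finsupp.single (X.retract j y) (1 : ℤ)).sum

end EllipticChain

/-! ### Limit linear series and their inclusions -/

/-- An (Eisenbud–Harris) limit linear series `g^r_m` on a chain `X` of elliptic curves: on each
component `E_j` a line bundle `𝒪(div j)` of degree `m` with an `(r + 1)`-dimensional space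
`space j` of sections, such that at the node `q j = p (j + 1)` the vanishing sequence of the
`j`-th aspect, in decreasing order, and that of the `(j + 1)`-st aspect, in increasing order,
have sum at least `(m, …, m)`. -/
@[ext]
structure LimitLinearSeries {K : Type*} [Field K] [DecidableEq K] {g : ℕ} (X : EllipticChain K g)
    (r : ℕ) (m : ℤ) where
  div : ∀ j, (X.curve j).Point →₀ ℤ
  space : ∀ j, Submodule K (X.curve j).FunctionField
  degree_eq : ∀ j, ((div j).sum fun _ n => n) = m
  finrank_eq : ∀ j, Module.finrank K (space j) = r + 1
  isSection : ∀ j, ∀ f ∈ space j, IsSectionOf (div j) f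
  compatible : ∀ j k : Fin g, (j : ℕ) + 1 = k → ∀ i : ℕ, i ≤ r →
    m ≤ (vanishingSeq (div j) (space j) (X.q j) (r - i) : ℤ) +
      vanishingSeq (div k) (space k) (X.p k) i

/-- The limit linear series has word type `w` (letters are numbered from `0`): along the component
`E_j` the `i`-th vanishing order stays fixed for `i = w j` and increases by one for `i ≠ w j`.
Here the vanishing orders before `E_j` are those at `p j`, and the vanishing orders after `E_j`
are the complements `m - b` of the orders `b` at `q j` (for a refined series these are the
orders at `p (j + 1)`). -/
def LimitLinearSeries.HasWordType {K : Type*} [Field K] [DecidableEq K] {g : ℕ}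
    {X : EllipticChain K g} {r : ℕ} {m : ℤ} (V : LimitLinearSeries X r m)
    (w : Fin g → Fin (r + 1)) : Prop :=
  ∀ (j : Fin g) (i : Fin (r + 1)),
    m - (vanishingSeq (V.div j) (V.space j) (X.q j) (r - i) : ℤ) =
      vanishingSeq (V.div j) (V.space j) (X.p j) i + if i = w j then 0 else 1

/-- An inclusion `g^{r'}_{m-n} + x_1 + ⋯ + x_n ↪ g^r_m` into the fixed limit linear series `V`:
an unordered tuple of `n` points of `X`, and a limit linear series of degree `m - n` whose aspects
consist of sections in the aspects of `V` and are carried by the line bundles of `V` twisted down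
by `x_1 + ⋯ + x_n`. -/
structure Inclusion {K : Type*} [Field K] [DecidableEq K] {g : ℕ} {X : EllipticChain K g}
    {r : ℕ} {m : ℤ} (V : LimitLinearSeries X r m) (r' n : ℕ) where
  base : Sym X.Pt n
  series : LimitLinearSeries X r' (m - n)
  div_eq : ∀ j, series.div j = V.div j - X.inducedDivisor base j
  space_le : ∀ j, series.space j ≤ V.space j

/-- The expected dimension of the space of linear series `g^r_m` on a curve of genus `g`. -/
def brillNoetherRho (g r m : ℤ) : ℤ := g - (r + 1) * (r + g - m)

/-- The expected dimension of the space of inclusions of series of dimension `r₂` with `d` base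
points into a fixed series of dimension `r₁`. -/
def secantMu (d r₂ r₁ : ℤ) : ℤ := d - (d - r₁ + r₂) * (r₂ + 1)

/-! ### The graph `Γ^s(d)` -/

/-- Vertices `(i, j)` with `1 ≤ i ≤ d` and `i ≤ j ≤ s + i - 1`; rows are numbered from top to
bottom. -/
structure GammaVertex (s d : ℕ) where
  row : ℕ
  col : ℕ
  one_le_row : 1 ≤ row
  row_le : row ≤ d
  row_le_col : row ≤ col
  col_lt : col < s + row

/-- The directed graph `Γ^s(d)`: all edges downward between adjacent rows. -/
def gammaGraph (s d : ℕ) : Digraph (GammaVertex s d) where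
  Adj v w := w.row = v.row + 1

/-- A top-to-bottom path in `Γ^s(d)`: one vertex in each row, joined by edges. -/
structure GammaPath (s d : ℕ) where
  vertex : Fin d → GammaVertex s d
  row_eq : ∀ i, (vertex i).row = (i : ℕ) + 1
  adj : ∀ i j : Fin d, (i : ℕ) + 1 = j → (gammaGraph s d).Adj (vertex i) (vertex j)

/-- The number of backwards edges of a path: those that go down and to the left. -/
def GammaPath.backwardsEdges {s d : ℕ} (c : GammaPath s d) : ℕ :=
  (Finset.univ.filter fun e : Fin d × Fin d =>
    (e.1 : ℕ) + 1 = e.2 ∧ (c.vertex e.2).col < (c.vertex e.1).col).card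

/-- `N_k^s(d)`, the number of top-to-bottom paths in `Γ^s(d)` with precisely `k` backwards
edges. -/
def gammaPathCount (s d k : ℕ) : ℕ :=
  Nat.card {c : GammaPath s d // c.backwardsEdges = k}

end

/-! ### Noetherian domains with invertible maximal ideals -/

noncomputable section

open WeierstrassCurve.Affine nonZeroDivisors

/-! Letters and vanishing indices are numbered from 0. Since `ρ = 0`, the word type and the node
inequalities leave no slack, so the vanishing orders of `V_j` at `p_j` and `q_j` are explicit
(`hasChainAspects`). For each index `i` there is a section of `V_j` with the `i`-th order at `p_j`
and the complementary order at `q_j`. These orders add up to `m` if `i` is the letter of `E_j`, and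
to `m - 1` otherwise. In the second case the section has precisely one further zero, and its place
is known because divisors of functions have degree zero and sum zero in the group of the curve
(`exists_divisor_pointOrd`). As `p_j - q_j` is not torsion, different indices have different extra
zeros.

An included series selects indices `S_j(0) < ⋯ < S_j(t)` at `p_j` and `T_j(0) < ⋯ < T_j(t)` at `q_j`
from those of `V_j`. Base points cost index: `k` of them on `E_j` away from the marked points force
`∑ (T_j - S_j) ≥ k t`, strictly if `k ≥ 2`, and `N ≥ 1` of them at a node force a total jump of more
than `N t` there. The `e`-th index starts at `e` or higher and ends at `t + e` or lower, so the
budget is `t (t + 1)`, which is just what `t + 1` base points cost. Hence every inequality is an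
equality (`IndexChain.equalities`): the base points lie on distinct components, away from the marked
points, and each of them raises all but one of the `t + 1` indices by one.

Each index has to rise `t` times in `t + 1` steps, so it pauses once, and strict monotonicity forces
the pauses to happen in the order `0, 1, …, t`. The `n`-th index has the value `2 n` when it pauses.
So the base point number `n` is the extra zero of the section of index `2 n`, which exists precisely
on components with letter other than `2 n`. The base points determine the aspects
(`Inclusion.eq_of_base_eq`), and all admissible positions occur (`exists_inclusion_of_placement`).

It remains to count the sequences `P_0 < ⋯ < P_t` below `(2t+1)u` with `P_i ≢ 2i` modulo `2t+1`.
Write `P_i = 2i + a_i + (2t+1) x_i` with `1 ≤ a_i ≤ 2t`. The numbers `a_i + i` are the columns of a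
path in the graph, and `P_i < P_{i+1}` means that `x` does not decrease and grows by at least one
along a backwards edge. Subtracting from `x_i` the number of backwards edges above row `i` and
adding `i` gives an arbitrary strictly increasing sequence of natural numbers below `t + u - 1 - k`,
where `k` is the number of backwards edges. This yields the binomial coefficient
(`card_placements`). -/

theorem FractionalIdeal.isUnit_coeIdeal_of_isMaximal {R : Type*} [CommRing R] [IsDomain R]
    [IsNoetherianRing R]
    (hM : ∀ M : Ideal R, M.IsMaximal → IsUnit (M : FractionalIdeal R⁰ (FractionRing R)))
    (I : Ideal R) (hI : I ≠ ⊥) : IsUnit (I : FractionalIdeal R⁰ (FractionRing R)) := by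
  induction I using WellFoundedGT.induction with
  | ind I ih =>
    by_cases htop : I = ⊤
    · subst htop; simp
    obtain ⟨M, hmax, hle⟩ := Ideal.exists_le_maximal I htop
    obtain ⟨v, hv⟩ := hM M hmax
    have h1 : (↑v⁻¹ : FractionalIdeal R⁰ (FractionRing R)) * I ≤ 1 := by
      calc (↑v⁻¹ : FractionalIdeal R⁰ (FractionRing R)) * I
          ≤ (↑v⁻¹ : FractionalIdeal R⁰ (FractionRing R)) * M :=
            mul_le_mul_right ((FractionalIdeal.coeIdeal_le_coeIdeal _).2 hle) _
        _ = 1 := by rw [← hv, Units.inv_mul]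
    obtain ⟨J, hJ⟩ := FractionalIdeal.le_one_iff_exists_coeIdeal.1 h1
    have hIJ : (I : FractionalIdeal R⁰ (FractionRing R)) = M * J := by
      rw [hJ, ← hv, Units.mul_inv_cancel_left]
    have hIJ' : I = M * J := by
      rw [← FractionalIdeal.coeIdeal_mul] at hIJ
      exact FractionalIdeal.coeIdeal_injective hIJ
    have hJ0 : J ≠ ⊥ := by rintro rfl; apply hI; simpa using hIJ'
    -- If `I = J`, then `I = M * I`, and Nakayama gives an element congruent to 1 modulo `M` that
    -- kills `I`, which is impossible in a domain.
    have hlt : I < J := by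
      refine lt_of_le_of_ne (hIJ'.trans_le Ideal.mul_le_right) ?_
      rintro rfl
      obtain ⟨r, hr, hr0⟩ := Submodule.exists_sub_one_mem_and_smul_eq_zero_of_fg_of_le_smul M I
        (IsNoetherian.noetherian I) hIJ'.le
      obtain ⟨a, ha, ha0⟩ := Submodule.exists_mem_ne_zero_of_ne_bot hI
      have : r = 0 := by simpa [ha0] using hr0 a ha
      subst this
      exact hmax.ne_top ((Ideal.eq_top_iff_one M).2 (by simpa using M.neg_mem hr))
    rw [hIJ, ← hv]
    exact v.isUnit.mul (ih J hlt hJ0)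

theorem IsDedekindDomain.of_isUnit_isMaximal {R : Type*} [CommRing R] [IsDomain R]
    [IsNoetherianRing R]
    (hM : ∀ M : Ideal R, M.IsMaximal → IsUnit (M : FractionalIdeal R⁰ (FractionRing R))) :
    IsDedekindDomain R := by
  refine (isDedekindDomain_iff_mul_inv_cancel (K := FractionRing R)).2 ?_
  intro I hI
  obtain ⟨a, J, ha, rfl⟩ := FractionalIdeal.exists_eq_spanSingleton_mul I
  rw [FractionalIdeal.mul_inv_cancel_iff_isUnit]
  have hJ : J ≠ ⊥ := by rintro rfl; apply hI; simp
  refine IsUnit.mul ?_ (FractionalIdeal.isUnit_coeIdeal_of_isMaximal hM J hJ)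
  refine IsUnit.of_mul_eq_one (FractionalIdeal.spanSingleton _ (algebraMap R _ a)) ?_
  rw [FractionalIdeal.spanSingleton_mul_spanSingleton, inv_mul_cancel₀ (by simpa using ha)]
  simp

/-! ### The affine coordinate ring of an elliptic curve is Dedekind -/

namespace WeierstrassCurve.Affine

variable {K : Type*} [Field K] {W : WeierstrassCurve.Affine K}

/-- The ideal of the opposite point is an inverse up to a principal ideal. -/
theorem isUnit_XYIdeal {x y : K} (h : W.Nonsingular x y) :
    IsUnit (CoordinateRing.XYIdeal W x (Polynomial.C y) :
      FractionalIdeal W.CoordinateRing⁰ W.FunctionField) :=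
  ⟨CoordinateRing.XYIdeal' (W := W) h, rfl⟩

def evalPoint {x y : K} (h : W.Equation x y) : W.CoordinateRing →ₐ[K] K :=
  (CoordinateRing.quotientXYIdealEquiv (W' := W) (x := x) (y := Polynomial.C y) h).toAlgHom.comp
    (Ideal.Quotient.mkₐ K _)

theorem evalPoint_eq_zero_iff {x y : K} (h : W.Equation x y) (a : W.CoordinateRing) :
    evalPoint h a = 0 ↔ a ∈ CoordinateRing.XYIdeal W x (Polynomial.C y) := by
  rw [← Ideal.Quotient.eq_zero_iff_mem]
  exact map_eq_zero_iff (CoordinateRing.quotientXYIdealEquiv (W' := W) (x := x)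
    (y := Polynomial.C y) h) (AlgEquiv.injective _)

theorem XYIdeal_isMaximal {x y : K} (h : W.Equation x y) :
    (CoordinateRing.XYIdeal W x (Polynomial.C y)).IsMaximal := by
  have : CoordinateRing.XYIdeal W x (Polynomial.C y) = RingHom.ker (evalPoint h) := by
    ext a; rw [RingHom.mem_ker, evalPoint_eq_zero_iff]
  rw [this]
  exact RingHom.ker_isMaximal_of_surjective _ fun c => ⟨algebraMap K _ c, by simp⟩

instance : Module.Finite K[X] W.CoordinateRing := .of_basis (CoordinateRing.basis W)

instance : IsNoetherianRing W.CoordinateRing := IsNoetherianRing.of_finite K[X] _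

instance : Algebra.FiniteType K W.CoordinateRing :=
  Algebra.FiniteType.trans (S := K[X]) inferInstance inferInstance

/-- Nullstellensatz: the residue field is finite over `K`, hence equal to `K`, and the residues of
the two coordinate functions are the coordinates of the point. -/
theorem exists_eq_XYIdeal_of_isMaximal [IsAlgClosed K] [W.IsElliptic] (M : Ideal W.CoordinateRing)
    (hM : M.IsMaximal) :
    ∃ x y, ∃ _ : W.Nonsingular x y, M = CoordinateRing.XYIdeal W x (Polynomial.C y) := by
  let := Ideal.Quotient.field M
  have := finite_of_finite_type_of_isJacobsonRing K (W.CoordinateRing ⧸ M)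
  have hb := IsAlgClosed.algebraMap_bijective_of_isIntegral (k := K) (K := W.CoordinateRing ⧸ M)
  have key : ∀ a : W.CoordinateRing, ∃ c : K, a - algebraMap K _ c ∈ M := by
    intro a
    obtain ⟨c, hc⟩ := hb.2 (Ideal.Quotient.mk M a)
    refine ⟨c, ?_⟩
    rw [← Ideal.Quotient.eq_zero_iff_mem, map_sub, ← hc, sub_eq_zero]
    rfl
  obtain ⟨x, hx⟩ := key (CoordinateRing.mk W (Polynomial.C Polynomial.X))
  obtain ⟨y, hy⟩ := key (CoordinateRing.mk W Polynomial.X)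
  have hle : CoordinateRing.XYIdeal W x (Polynomial.C y) ≤ M := by
    rw [CoordinateRing.XYIdeal, Ideal.span_le]
    rintro a (rfl | rfl)
    · convert hx using 1
      simp [CoordinateRing.XClass]
      rfl
    · convert hy using 1
      simp [CoordinateRing.YClass]
      rfl
  have heq : W.Equation x y := by
    let ψ : K[X][X] →+* W.CoordinateRing ⧸ M := (Ideal.Quotient.mk M).comp (CoordinateRing.mk W)
    have hψ : ψ = (algebraMap K (W.CoordinateRing ⧸ M)).comp (Polynomial.evalEvalRingHom x y) := by
      refine Polynomial.ringHom_ext' (Polynomial.ringHom_ext' ?_ ?_) ?_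
      · ext c
        simp [ψ]
        rfl
      · rw [← Ideal.Quotient.eq_zero_iff_mem, map_sub, sub_eq_zero] at hx
        simpa [ψ] using hx
      · rw [← Ideal.Quotient.eq_zero_iff_mem, map_sub, sub_eq_zero] at hy
        simpa [ψ] using hy
    have h0 : ψ W.polynomial = 0 := by simp [ψ]
    rw [hψ, RingHom.comp_apply, map_eq_zero_iff _ hb.1] at h0
    exact h0
  exact ⟨x, y, (equation_iff_nonsingular).1 heq,
    ((XYIdeal_isMaximal heq).eq_of_le hM.ne_top hle).symm⟩

instance [IsAlgClosed K] [W.IsElliptic] : IsDedekindDomain W.CoordinateRing :=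
  IsDedekindDomain.of_isUnit_isMaximal fun M hM => by
    obtain ⟨x, y, h, rfl⟩ := exists_eq_XYIdeal_of_isMaximal M hM
    exact isUnit_XYIdeal h

end WeierstrassCurve.Affine

namespace WeierstrassCurve.Affine

variable {K : Type*} [Field K] {W : WeierstrassCurve.Affine K}

/-! ### Orders of vanishing at affine points -/

theorem XYIdeal_ne_bot (x y : K) : CoordinateRing.XYIdeal W x (Polynomial.C y) ≠ ⊥ := by
  intro h
  refine CoordinateRing.XClass_ne_zero (W' := W) x ?_
  rw [← Ideal.mem_bot, ← h]
  exact Ideal.subset_span (by simp)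

variable [IsAlgClosed K] [W.IsElliptic]

theorem XYIdeal_prime {x y : K} (h : W.Nonsingular x y) :
    Prime (CoordinateRing.XYIdeal W x (Polynomial.C y)) :=
  Ideal.prime_of_isPrime (XYIdeal_ne_bot x y) (XYIdeal_isMaximal h.1).isPrime

theorem finiteMultiplicity_XYIdeal {x y : K} (h : W.Nonsingular x y) {a : W.CoordinateRing}
    (ha : a ≠ 0) :
    FiniteMultiplicity (CoordinateRing.XYIdeal W x (Polynomial.C y)) (Ideal.span {a}) :=
  FiniteMultiplicity.of_prime_left (XYIdeal_prime h) (by simpa using ha)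

theorem mem_XYIdeal_pow_iff {x y : K} (h : W.Nonsingular x y) {a : W.CoordinateRing}
    (ha : a ≠ 0) (n : ℕ) : a ∈ CoordinateRing.XYIdeal W x (Polynomial.C y) ^ n ↔
      n ≤ multiplicity (CoordinateRing.XYIdeal W x (Polynomial.C y)) (Ideal.span {a}) := by
  rw [← (finiteMultiplicity_XYIdeal h ha).pow_dvd_iff_le_multiplicity, Ideal.dvd_span_singleton]

theorem pointOrdInt_some {x y : K} (h : W.Nonsingular x y) {a : W.CoordinateRing}
    (ha : a ≠ 0) : pointOrdInt W (.some x y h) a =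
      multiplicity (CoordinateRing.XYIdeal W x (Polynomial.C y)) (Ideal.span {a}) := by
  simp only [pointOrdInt, mem_XYIdeal_pow_iff h ha]
  exact congrArg _ (csSup_Iic (a := multiplicity _ _))

theorem mem_XYIdeal_pow_iff_le_pointOrdInt {x y : K} (h : W.Nonsingular x y)
    {a : W.CoordinateRing} (ha : a ≠ 0) (n : ℕ) :
    a ∈ CoordinateRing.XYIdeal W x (Polynomial.C y) ^ n ↔ n ≤ pointOrdInt W (.some x y h) a := by
  rw [mem_XYIdeal_pow_iff h ha, pointOrdInt_some h ha, Nat.cast_le]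

omit [IsAlgClosed K] [W.IsElliptic] in
theorem pointOrdInt_some_nonneg {x y : K} (h : W.Nonsingular x y) (a : W.CoordinateRing) :
    0 ≤ pointOrdInt W (.some x y h) a := by
  simp [pointOrdInt]

omit [IsAlgClosed K] [W.IsElliptic] in
theorem norm_ne_zero_coordinateRing {a : W.CoordinateRing} (ha : a ≠ 0) :
    Algebra.norm K[X] a ≠ 0 :=
  Algebra.norm_ne_zero_iff.2 ha

theorem pointOrdInt_mul (P : W.Point) {a b : W.CoordinateRing} (ha : a ≠ 0) (hb : b ≠ 0) :
    pointOrdInt W P (a * b) = pointOrdInt W P a + pointOrdInt W P b := by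
  rcases P with _ | ⟨x, y, h⟩
  · simp only [pointOrdInt, map_mul]
    rw [Polynomial.natDegree_mul (norm_ne_zero_coordinateRing ha) (norm_ne_zero_coordinateRing hb)]
    push_cast; ring
  · rw [pointOrdInt_some h ha, pointOrdInt_some h hb, pointOrdInt_some h (mul_ne_zero ha hb),
      ← Ideal.span_singleton_mul_span_singleton, multiplicity_mul (XYIdeal_prime h)]
    · push_cast; rfl
    · rw [Ideal.span_singleton_mul_span_singleton]
      exact finiteMultiplicity_XYIdeal h (mul_ne_zero ha hb)

omit [IsAlgClosed K] [W.IsElliptic] in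
-- The norm of `p + q Y` has degree `max (2 deg p) (2 deg q + 3)`. Bounding the pole order at
-- infinity thus becomes the vanishing of coefficients, a condition that is visibly linear.
theorem degree_norm_lt_iff (p q : K[X]) (n : ℕ) :
    (Algebra.norm K[X] (p • (1 : W.CoordinateRing) +
      q • CoordinateRing.mk W Polynomial.X)).degree < n ↔
      (∀ i, n ≤ 2 * i → p.coeff i = 0) ∧ ∀ i, n ≤ 2 * i + 3 → q.coeff i = 0 := by
  rw [CoordinateRing.degree_norm_smul_basis, max_lt_iff]
  have h1 : ∀ (r : K[X]) (k : ℕ), 2 • r.degree + (k : WithBot ℕ) < n ↔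
      ∀ i, n ≤ 2 * i + k → r.coeff i = 0 := by
    intro r k
    rcases eq_or_ne r 0 with rfl | hr
    · simp
    · rw [Polynomial.degree_eq_natDegree hr]
      have : 2 • (r.natDegree : WithBot ℕ) + (k : WithBot ℕ) = ((2 * r.natDegree + k : ℕ) :
        WithBot ℕ) := by push_cast; simp
      rw [this, Nat.cast_lt]
      constructor
      · intro h i hi
        exact Polynomial.coeff_eq_zero_of_natDegree_lt (by omega)
      · intro h
        by_contra hc
        exact hr (Polynomial.leadingCoeff_eq_zero.1 (h _ (not_lt.1 hc)))
  exact and_congr (by simpa using h1 p 0) (by simpa using h1 q 3)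

omit [IsAlgClosed K] [W.IsElliptic] in
theorem natDegree_norm_lt_iff {a : W.CoordinateRing} (ha : a ≠ 0) (n : ℕ) :
    (Algebra.norm K[X] a).natDegree < n ↔ (Algebra.norm K[X] a).degree < n :=
  Polynomial.natDegree_lt_iff_degree_lt (norm_ne_zero_coordinateRing ha)

theorem min_le_pointOrdInt_add (P : W.Point) {a b : W.CoordinateRing} (ha : a ≠ 0) (hb : b ≠ 0)
    (hab : a + b ≠ 0) :
    min (pointOrdInt W P a) (pointOrdInt W P b) ≤ pointOrdInt W P (a + b) := by
  rcases P with _ | ⟨x, y, h⟩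
  · simp only [pointOrdInt]
    rw [min_neg_neg, neg_le_neg_iff, ← Nat.cast_max, Nat.cast_le, ← Nat.lt_succ_iff,
      natDegree_norm_lt_iff hab]
    have h1 := (natDegree_norm_lt_iff ha _).1 (Nat.lt_succ_of_le
      (le_max_left (Algebra.norm K[X] a).natDegree (Algebra.norm K[X] b).natDegree))
    have h2 := (natDegree_norm_lt_iff hb _).1 (Nat.lt_succ_of_le
      (le_max_right (Algebra.norm K[X] a).natDegree (Algebra.norm K[X] b).natDegree))
    generalize (max (Algebra.norm K[X] a).natDegree (Algebra.norm K[X] b).natDegree).succ = n at *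
    obtain ⟨p, q, rfl⟩ := CoordinateRing.exists_smul_basis_eq a
    obtain ⟨p', q', rfl⟩ := CoordinateRing.exists_smul_basis_eq b
    rw [degree_norm_lt_iff] at h1 h2
    rw [add_add_add_comm, ← add_smul, ← add_smul, degree_norm_lt_iff]
    exact ⟨fun i hi => by rw [Polynomial.coeff_add, h1.1 i hi, h2.1 i hi, add_zero],
      fun i hi => by rw [Polynomial.coeff_add, h1.2 i hi, h2.2 i hi, add_zero]⟩
  · obtain ⟨n, hn⟩ := Int.eq_ofNat_of_zero_le (le_min (pointOrdInt_some_nonneg h a)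
      (pointOrdInt_some_nonneg h b))
    rw [hn]
    refine (mem_XYIdeal_pow_iff_le_pointOrdInt h hab n).1 (Ideal.add_mem _ ?_ ?_)
    · exact (mem_XYIdeal_pow_iff_le_pointOrdInt h ha n).2 (hn ▸ min_le_left _ _)
    · exact (mem_XYIdeal_pow_iff_le_pointOrdInt h hb n).2 (hn ▸ min_le_right _ _)

theorem pointOrdInt_algebraMap (P : W.Point) {c : K} (hc : c ≠ 0) :
    pointOrdInt W P (algebraMap K W.CoordinateRing c) = 0 := by
  have hc' : algebraMap K W.CoordinateRing c ≠ 0 := by simpa using hc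
  rcases P with _ | ⟨x, y, h⟩
  · simp only [pointOrdInt]
    rw [IsScalarTower.algebraMap_apply K K[X] W.CoordinateRing, Algebra.norm_algebraMap]
    simp
  · refine le_antisymm (not_lt.1 fun hlt => ?_) (pointOrdInt_some_nonneg h _)
    have h1 := (mem_XYIdeal_pow_iff_le_pointOrdInt h hc' 1).2 (by exact_mod_cast hlt)
    rw [pow_one, ← evalPoint_eq_zero_iff h.1] at h1
    simp [hc] at h1

/-- The residue field at every point is `K`, so leading terms of equal order are proportional over
`K`. At infinity the parity of the pole order, `2 i` or `2 i + 3`, tells which of the two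
polynomials carries the leading term. -/
theorem exists_lt_pointOrdInt_sub (P : W.Point) {a b : W.CoordinateRing} (ha : a ≠ 0)
    (hb : b ≠ 0) (hab : pointOrdInt W P a = pointOrdInt W P b) :
    ∃ c : K, b - c • a = 0 ∨ pointOrdInt W P a < pointOrdInt W P (b - c • a) := by
  rcases P with _ | ⟨x, y, h⟩
  · simp only [pointOrdInt] at hab ⊢
    rw [neg_inj, Nat.cast_inj] at hab
    set n := (Algebra.norm K[X] a).natDegree with hn
    have h1 := (natDegree_norm_lt_iff ha _).1 (hn ▸ Nat.lt_succ_self n)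
    have h2 := (natDegree_norm_lt_iff hb _).1 (hab ▸ Nat.lt_succ_self n)
    have h3 := mt (natDegree_norm_lt_iff ha n).2 (hn ▸ lt_irrefl _)
    suffices ∃ c : K, (Algebra.norm K[X] (b - c • a)).degree < n by
      obtain ⟨c, hc⟩ := this
      refine ⟨c, or_iff_not_imp_left.2 fun h0 => ?_⟩
      rw [neg_lt_neg_iff, Nat.cast_lt, natDegree_norm_lt_iff h0]
      exact hc
    clear_value n
    obtain ⟨p, q, rfl⟩ := CoordinateRing.exists_smul_basis_eq a
    obtain ⟨p', q', rfl⟩ := CoordinateRing.exists_smul_basis_eq b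
    have hsub : ∀ c : K, p' • (1 : W.CoordinateRing) + q' • CoordinateRing.mk W Polynomial.X -
        c • (p • (1 : W.CoordinateRing) + q • CoordinateRing.mk W Polynomial.X) =
        (p' - c • p) • (1 : W.CoordinateRing) +
          (q' - c • q) • CoordinateRing.mk W Polynomial.X := by
      intro c; rw [smul_add, sub_smul, sub_smul, smul_assoc, smul_assoc]; abel
    simp only [hsub]
    simp only [degree_norm_lt_iff] at h1 h2 h3 ⊢
    simp only [Polynomial.coeff_sub, Polynomial.coeff_smul, smul_eq_mul]
    rcases Nat.even_or_odd' n with ⟨k, rfl | rfl⟩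
    · have hp : p.coeff k ≠ 0 := by
        intro h0
        refine h3 ⟨fun i hi => ?_, fun i hi => h1.2 i (by omega)⟩
        rcases (show k = i ∨ k < i by omega) with rfl | hi
        · exact h0
        · exact h1.1 i (by omega)
      refine ⟨p'.coeff k / p.coeff k, fun i hi => ?_, fun i hi => ?_⟩
      · rcases (show k = i ∨ k < i by omega) with rfl | hi
        · field_simp; ring
        · rw [h1.1 i (by omega), h2.1 i (by omega)]; ring
      · rw [h1.2 i (by omega), h2.2 i (by omega)]; ring
    · have hq : q.coeff (k - 1) ≠ 0 := by
        intro h0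
        refine h3 ⟨fun i hi => h1.1 i (by omega), fun i hi => ?_⟩
        rcases (show k - 1 = i ∨ k - 1 < i by omega) with rfl | hi
        · exact h0
        · exact h1.2 i (by omega)
      refine ⟨q'.coeff (k - 1) / q.coeff (k - 1), fun i hi => ?_, fun i hi => ?_⟩
      · rw [h1.1 i (by omega), h2.1 i (by omega)]; ring
      · rcases (show k - 1 = i ∨ k - 1 < i by omega) with rfl | hi
        · field_simp; ring
        · rw [h1.2 i (by omega), h2.2 i (by omega)]; ring
  · obtain ⟨n, hn⟩ := Int.eq_ofNat_of_zero_le (pointOrdInt_some_nonneg h a)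
    have h1 := (mem_XYIdeal_pow_iff_le_pointOrdInt h ha n).2 hn.ge
    have h2 := mt (mem_XYIdeal_pow_iff_le_pointOrdInt h ha (n + 1)).1 (by push_cast; omega)
    have h3 := (mem_XYIdeal_pow_iff_le_pointOrdInt h hb n).2 (by omega)
    have := (XYIdeal_isMaximal h.1).isPrime
    obtain ⟨d, e, he, hd⟩ := Ideal.exists_mul_add_mem_pow_succ (XYIdeal_ne_bot x y) a b h1 h2 h3
    refine ⟨evalPoint h.1 d, or_iff_not_imp_left.2 fun h0 => ?_⟩
    rw [hn, Int.lt_iff_add_one_le]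
    refine (mem_XYIdeal_pow_iff_le_pointOrdInt h h0 (n + 1)).1 ?_
    have : b - evalPoint h.1 d • a = a * (d - algebraMap K _ (evalPoint h.1 d)) + e := by
      rw [← hd, Algebra.smul_def]; ring
    rw [this, pow_succ]
    refine Ideal.add_mem _ (Ideal.mul_mem_mul h1 ?_) (by rwa [← pow_succ])
    rw [← evalPoint_eq_zero_iff h.1, map_sub, AlgHom.commutes]
    simp

end WeierstrassCurve.Affine

namespace WeierstrassCurve.Affine

variable {K : Type*} [Field K] {W : WeierstrassCurve.Affine K}

/-! ### Principal divisors -/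

/-- The ideal of functions vanishing at a point, in the coordinate ring. -/
def pointIdeal : W.Point → Ideal W.CoordinateRing
  | .zero => ⊤
  | .some x y _ => CoordinateRing.XYIdeal W x (Polynomial.C y)

theorem pointIdeal_injOn : Set.InjOn (pointIdeal (W := W)) {P | P ≠ 0} := by
  rintro (_ | ⟨x, y, h⟩) hP (_ | ⟨x', y', h'⟩) hP' heq
  · rfl
  · exact absurd rfl hP
  · exact absurd rfl hP'
  · simp only [pointIdeal] at heq
    have hX : CoordinateRing.XClass W x' ∈ CoordinateRing.XYIdeal W x (Polynomial.C y) := by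
      rw [heq]; exact Ideal.subset_span (by simp)
    have hY : CoordinateRing.YClass W (Polynomial.C y') ∈
        CoordinateRing.XYIdeal W x (Polynomial.C y) := by
      rw [heq]; exact Ideal.subset_span (by simp)
    have hX0 : CoordinateRing.XClass W x ∈ CoordinateRing.XYIdeal W x (Polynomial.C y) :=
      Ideal.subset_span (by simp)
    have hY0 : CoordinateRing.YClass W (Polynomial.C y) ∈
        CoordinateRing.XYIdeal W x (Polynomial.C y) := Ideal.subset_span (by simp)
    have h1 : algebraMap K W.CoordinateRing (x' - x) =
        CoordinateRing.XClass W x - CoordinateRing.XClass W x' := by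
      simp only [CoordinateRing.XClass, map_sub]
      rw [sub_sub_sub_cancel_left]
      rfl
    have h2 : algebraMap K W.CoordinateRing (y' - y) = CoordinateRing.YClass W (Polynomial.C y) -
        CoordinateRing.YClass W (Polynomial.C y') := by
      simp only [CoordinateRing.YClass, map_sub]
      rw [sub_sub_sub_cancel_left]
      rfl
    have h3 := (evalPoint_eq_zero_iff h.1 _).2 (h1 ▸ Ideal.sub_mem _ hX0 hX)
    have h4 := (evalPoint_eq_zero_iff h.1 _).2 (h2 ▸ Ideal.sub_mem _ hY0 hY)
    rw [AlgHom.commutes, Algebra.algebraMap_self_apply, sub_eq_zero] at h3 h4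
    subst h3 h4
    rfl

/-- The class map of the group law is additive; the point at infinity contributes the unit ideal. -/
theorem exists_units_prod_pointIdeal [DecidableEq K] (S : Multiset W.Point) :
    ∃ U : (FractionalIdeal W.CoordinateRing⁰ W.FunctionField)ˣ,
      (U : FractionalIdeal W.CoordinateRing⁰ W.FunctionField) =
        ((S.map pointIdeal).prod : Ideal W.CoordinateRing) ∧
      Additive.ofMul (ClassGroup.mk W.FunctionField U) = Point.toClass S.sum := by
  induction S using Multiset.induction with
  | empty => exact ⟨1, by simp, by simp⟩
  | cons P S ih =>
    obtain ⟨U, hU, hU'⟩ := ih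
    rcases P with _ | ⟨x, y, h⟩
    · refine ⟨U, by simpa [pointIdeal, Ideal.mul_top] using hU, ?_⟩
      rw [hU', Multiset.sum_cons, ← Point.zero_def, zero_add]
    · refine ⟨CoordinateRing.XYIdeal' (W := W) h * U, ?_, ?_⟩
      · rw [Units.val_mul, hU, CoordinateRing.XYIdeal'_eq, Multiset.map_cons, Multiset.prod_cons,
          FractionalIdeal.coeIdeal_mul]
        rfl
      · rw [Multiset.sum_cons, map_add, map_mul, ofMul_mul, hU', Point.toClass_some]
        rfl

/-- A principal ideal has trivial class, and a point with trivial class is zero. -/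
theorem sum_eq_zero_of_span_eq [DecidableEq K] {a : W.CoordinateRing} (ha : a ≠ 0)
    (S : Multiset W.Point) (h : Ideal.span {a} = (S.map pointIdeal).prod) : S.sum = 0 := by
  obtain ⟨U, hU, hU'⟩ := exists_units_prod_pointIdeal S
  rw [← Point.toClass_eq_zero, ← hU', ← ofMul_one]
  congr 1
  exact (ClassGroup.mk_eq_one_of_coe_ideal hU).2 ⟨a, ha, h.symm⟩

variable [IsAlgClosed K] [W.IsElliptic]

theorem relNorm_XYIdeal_mul {x y : K} (h : W.Nonsingular x y) :
    Ideal.relNorm K[X] (CoordinateRing.XYIdeal W x (Polynomial.C (W.negY x y))) *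
      Ideal.relNorm K[X] (CoordinateRing.XYIdeal W x (Polynomial.C y)) =
    Ideal.span {Polynomial.X - Polynomial.C x} * Ideal.span {Polynomial.X - Polynomial.C x} := by
  rw [← map_mul, CoordinateRing.XYIdeal_neg_mul h, CoordinateRing.XIdeal, Ideal.relNorm_singleton,
    Algebra.intNorm_eq_norm, Ideal.span_singleton_mul_span_singleton]
  have : CoordinateRing.XClass W x = algebraMap K[X] _ (Polynomial.X - Polynomial.C x) := rfl
  rw [this, Algebra.norm_algebraMap, Module.finrank_eq_card_basis (CoordinateRing.basis W),
    Fintype.card_fin, sq]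

theorem relNorm_XYIdeal_le {x y : K} (h : W.Nonsingular x y) :
    Ideal.relNorm K[X] (CoordinateRing.XYIdeal W x (Polynomial.C y)) ≤
      Ideal.span {Polynomial.X - Polynomial.C x} := by
  refine (Ideal.relNorm_le_comap _ _).trans fun p hp => ?_
  rw [Ideal.mem_comap, ← evalPoint_eq_zero_iff h.1] at hp
  rw [Ideal.mem_span_singleton, Polynomial.dvd_iff_isRoot]
  have : (evalPoint h.1).toRingHom.comp (algebraMap K[X] W.CoordinateRing) =
      Polynomial.evalRingHom x := by
    refine Polynomial.ringHom_ext' ?_ ?_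
    · ext c
      simp only [RingHom.comp_apply, ← Polynomial.algebraMap_eq,
        ← IsScalarTower.algebraMap_apply K K[X] W.CoordinateRing]
      simp
    · have h1 : CoordinateRing.XClass W x ∈ CoordinateRing.XYIdeal W x (Polynomial.C y) :=
        Ideal.subset_span (by simp)
      have h2 : CoordinateRing.XClass W x = algebraMap K[X] _ Polynomial.X -
          algebraMap K[X] _ (Polynomial.C x) := by rw [← map_sub]; rfl
      rw [← evalPoint_eq_zero_iff h.1, h2, map_sub, ← Polynomial.algebraMap_eq,
        ← IsScalarTower.algebraMap_apply K K[X] W.CoordinateRing, AlgHom.commutes,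
        sub_eq_zero] at h1
      simpa using h1
  rw [Polynomial.IsRoot, ← Polynomial.coe_evalRingHom, ← this]
  exact hp

/-- The norms of the ideals of a point and of its opposite both lie in `(X - x)`, and their product
is `(X - x)²`, so neither can be smaller. -/
theorem relNorm_XYIdeal {x y : K} (h : W.Nonsingular x y) :
    Ideal.relNorm K[X] (CoordinateRing.XYIdeal W x (Polynomial.C y)) =
      Ideal.span {Polynomial.X - Polynomial.C x} := by
  have h' := (nonsingular_neg ..).2 h
  obtain ⟨A, hA⟩ := Ideal.dvd_iff_le.2 (relNorm_XYIdeal_le h)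
  obtain ⟨B, hB⟩ := Ideal.dvd_iff_le.2 (relNorm_XYIdeal_le h')
  have hne : Ideal.span {Polynomial.X - Polynomial.C x} ≠ 0 := by
    simpa using Polynomial.X_sub_C_ne_zero x
  have h1 := relNorm_XYIdeal_mul h
  rw [hA, hB, mul_mul_mul_comm] at h1
  have h2 := mul_left_cancel₀ (mul_ne_zero hne hne) (h1.trans (mul_one _).symm)
  rw [hA, (Ideal.isUnit_iff.1 (IsUnit.of_mul_eq_one _ ((mul_comm _ _).trans h2))), Ideal.mul_top]

/-- The ideal norm has one linear factor for each affine zero. Since the degree of the norm is the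
pole order at infinity, this says that principal divisors have degree zero. -/
theorem natDegree_norm_eq_card {a : W.CoordinateRing}
    (S : Multiset W.Point) (hS : 0 ∉ S) (h : Ideal.span {a} = (S.map pointIdeal).prod) :
    (Algebra.norm K[X] a).natDegree = S.card := by
  have key : ∀ S : Multiset W.Point, 0 ∉ S → ∃ p : K[X], p.Monic ∧ p.natDegree = S.card ∧
      Ideal.relNorm K[X] (S.map pointIdeal).prod = Ideal.span {p} := by
    intro S hS
    induction S using Multiset.induction with
    | empty => exact ⟨1, Polynomial.monic_one, by simp, by simp⟩
    | cons P S ih =>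
      obtain ⟨p, hp, hd, hs⟩ := ih fun h => hS (Multiset.mem_cons_of_mem h)
      rcases P with _ | ⟨x, y, h⟩
      · exact absurd (Multiset.mem_cons_self _ _) hS
      · refine ⟨(Polynomial.X - Polynomial.C x) * p, (Polynomial.monic_X_sub_C x).mul hp, ?_, ?_⟩
        · rw [(Polynomial.monic_X_sub_C x).natDegree_mul hp, hd, Polynomial.natDegree_X_sub_C,
            Multiset.card_cons, add_comm]
        · rw [Multiset.map_cons, Multiset.prod_cons, map_mul, hs]
          change Ideal.relNorm K[X] (CoordinateRing.XYIdeal W x (Polynomial.C y)) * _ = _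
          rw [relNorm_XYIdeal h, Ideal.span_singleton_mul_span_singleton]
  obtain ⟨p, hp, hd, hs⟩ := key S hS
  rw [← h, Ideal.relNorm_singleton, Algebra.intNorm_eq_norm,
    Ideal.span_singleton_eq_span_singleton] at hs
  rw [← hd]
  exact Polynomial.natDegree_eq_of_degree_eq (Polynomial.degree_eq_degree_of_associated hs)

theorem exists_span_eq_prod_pointIdeal {a : W.CoordinateRing} (ha : a ≠ 0) :
    ∃ S : Multiset W.Point, 0 ∉ S ∧
      UniqueFactorizationMonoid.normalizedFactors (Ideal.span {a}) = S.map pointIdeal ∧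
      Ideal.span {a} = (S.map pointIdeal).prod := by
  have h0 : Ideal.span {a} ≠ 0 := by simpa using ha
  have key : ∀ s : Multiset (Ideal W.CoordinateRing), (∀ M ∈ s, Prime M) →
      ∃ S : Multiset W.Point, 0 ∉ S ∧ s = S.map pointIdeal := by
    intro s
    induction s using Multiset.induction with
    | empty => exact fun _ => ⟨0, by simp, rfl⟩
    | cons M s ih =>
      intro hs
      obtain ⟨S, hS, rfl⟩ := ih fun N hN => hs N (Multiset.mem_cons_of_mem hN)
      have hM := hs M (Multiset.mem_cons_self _ _)
      obtain ⟨x, y, h, rfl⟩ := exists_eq_XYIdeal_of_isMaximal M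
        ((Ideal.isPrime_of_prime hM).isMaximal hM.ne_zero)
      refine ⟨.some x y h ::ₘ S, ?_, by rw [Multiset.map_cons]; rfl⟩
      rw [Multiset.mem_cons, not_or]
      exact ⟨(Point.some_ne_zero h).symm, hS⟩
  obtain ⟨S, hS, hs⟩ := key _ fun M hM =>
    UniqueFactorizationMonoid.prime_of_normalized_factor M hM
  refine ⟨S, hS, hs, ?_⟩
  rw [← hs, Ideal.prod_normalizedFactors_eq_self h0]

/-- The sum of the points of a divisor, in the group of the curve. -/
def divisorSum [DecidableEq K] : (W.Point →₀ ℤ) →+ W.Point :=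
  Finsupp.liftAddHom fun P => (zmultiplesHom W.Point P)

/-- The degree of a divisor. -/
def divisorDegree : (W.Point →₀ ℤ) →+ ℤ :=
  Finsupp.liftAddHom fun _ => AddMonoidHom.id ℤ

omit [IsAlgClosed K] [W.IsElliptic] in
@[simp] theorem divisorSum_single [DecidableEq K] (P : W.Point) (n : ℤ) :
    divisorSum (Finsupp.single P n) = n • P := by
  simp [divisorSum]

omit [IsAlgClosed K] [W.IsElliptic] in
@[simp] theorem divisorDegree_single (P : W.Point) (n : ℤ) :
    divisorDegree (Finsupp.single P n) = n := by
  simp [divisorDegree]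

omit [IsAlgClosed K] [W.IsElliptic] in
theorem divisorDegree_apply (D : W.Point →₀ ℤ) : divisorDegree D = D.sum fun _ n => n := rfl

/-- The effective divisor with a given multiset of points. -/
def multisetDivisor (S : Multiset W.Point) : W.Point →₀ ℤ :=
  (S.map fun P => Finsupp.single P (1 : ℤ)).sum

omit [IsAlgClosed K] [W.IsElliptic] in
theorem multisetDivisor_apply [DecidableEq W.Point] (S : Multiset W.Point) (P : W.Point) :
    multisetDivisor S P = S.count P := by
  induction S using Multiset.induction with
  | empty => simp [multisetDivisor]
  | cons Q S ih =>
    rw [multisetDivisor] at ih ⊢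
    rw [Multiset.map_cons, Multiset.sum_cons, Finsupp.add_apply, ih, Multiset.count_cons,
      Finsupp.single_apply]
    simp only [eq_comm (a := P)]
    push_cast
    ring

omit [IsAlgClosed K] [W.IsElliptic] in
theorem divisorDegree_multisetDivisor (S : Multiset W.Point) :
    divisorDegree (multisetDivisor S) = S.card := by
  rw [multisetDivisor, map_multiset_sum, Multiset.map_map]
  simp

omit [IsAlgClosed K] [W.IsElliptic] in
theorem divisorSum_multisetDivisor [DecidableEq K] (S : Multiset W.Point) :
    divisorSum (multisetDivisor S) = S.sum := by
  rw [multisetDivisor, map_multiset_sum, Multiset.map_map]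
  simp

theorem exists_divisor_pointOrdInt [DecidableEq K] {a : W.CoordinateRing} (ha : a ≠ 0) :
    ∃ D : W.Point →₀ ℤ, (∀ P, D P = pointOrdInt W P a) ∧ divisorDegree D = 0 ∧
      divisorSum D = 0 := by
  classical
  obtain ⟨S, hS, hs, hprod⟩ := exists_span_eq_prod_pointIdeal ha
  have hcard := natDegree_norm_eq_card S hS hprod
  -- Infinity is the zero of the group: it balances the degree without contributing to the sum.
  refine ⟨multisetDivisor S - Finsupp.single 0 (S.card : ℤ), ?_, ?_, ?_⟩
  · rintro (_ | ⟨x, y, h⟩)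
    · rw [Finsupp.sub_apply, multisetDivisor_apply, ← Point.zero_def, Multiset.count_eq_zero.2 hS,
        Finsupp.single_eq_same]
      change _ = -((Algebra.norm K[X] a).natDegree : ℤ)
      rw [hcard]; simp
    · rw [Finsupp.sub_apply, multisetDivisor_apply, Finsupp.single_eq_of_ne (by simp),
        sub_zero, pointOrdInt_some h ha,
        UniqueFactorizationMonoid.multiplicity_eq_count_normalizedFactors
          (XYIdeal_prime h).irreducible (by simpa using ha), hs, normalize_eq]
      have : CoordinateRing.XYIdeal W x (Polynomial.C y) = pointIdeal (.some x y h) := rfl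
      by_cases hmem : Point.some x y h ∈ S
      · rw [this, Multiset.count_map_eq_count pointIdeal S ?_ _ hmem]
        exact pointIdeal_injOn.mono fun P hP => ne_of_mem_of_not_mem hP hS
      · rw [Multiset.count_eq_zero.2 hmem, this, Multiset.count_eq_zero.2]
        rw [Multiset.mem_map]
        rintro ⟨Q, hQ, hQ'⟩
        have := pointIdeal_injOn (ne_of_mem_of_not_mem hQ hS) (Point.some_ne_zero h) hQ'
        exact hmem (this ▸ hQ)
  · rw [map_sub, divisorDegree_multisetDivisor, divisorDegree_single, sub_self]
  · rw [map_sub, divisorSum_multisetDivisor, divisorSum_single, sum_eq_zero_of_span_eq ha S hprod]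
    simp

end WeierstrassCurve.Affine

/-! ### Order functions on vector spaces -/

/-- A function on a vector space that behaves like the order of vanishing of sections at a rational
point. Its value at `0` is irrelevant. -/
structure IsOrderFunction (K : Type*) {F : Type*} [Field K] [AddCommGroup F] [Module K F]
    (v : F → ℤ) : Prop where
  min_le_add : ∀ f g, f ≠ 0 → g ≠ 0 → f + g ≠ 0 → min (v f) (v g) ≤ v (f + g)
  smul : ∀ (c : K) f, c ≠ 0 → f ≠ 0 → v (c • f) = v f
  exists_lt_sub : ∀ f g, f ≠ 0 → g ≠ 0 → v f = v g → ∃ c : K, g - c • f = 0 ∨ v f < v (g - c • f)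

/-- The set of orders of the nonzero elements of a subspace. -/
def orderSet {K F : Type*} [Field K] [AddCommGroup F] [Module K F] (v : F → ℤ)
    (V : Submodule K F) : Set ℤ :=
  {n | ∃ f ∈ V, f ≠ 0 ∧ v f = n}

namespace IsOrderFunction

variable {K F : Type*} [Field K] [AddCommGroup F] [Module K F] {v v' : F → ℤ}

theorem add_const (hv : IsOrderFunction K v) (n : ℤ) : IsOrderFunction K fun f => v f + n where
  min_le_add f g hf hg hfg := by
    have := hv.min_le_add f g hf hg hfg
    omega
  smul c f hc hf := by rw [hv.smul c f hc hf]
  exists_lt_sub f g hf hg h := by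
    obtain ⟨c, hc⟩ := hv.exists_lt_sub f g hf hg (by omega)
    exact ⟨c, hc.imp_right fun h => by omega⟩

/-- The subspace of elements of order at least `n`. -/
def geSubmodule (hv : IsOrderFunction K v) (n : ℤ) : Submodule K F where
  carrier := {f | f = 0 ∨ n ≤ v f}
  zero_mem' := Or.inl rfl
  add_mem' := by
    intro f g hf hg
    by_cases hf0 : f = 0
    · simpa [hf0] using hg
    by_cases hg0 : g = 0
    · simpa [hg0] using hf
    by_cases hfg : f + g = 0
    · exact Or.inl hfg
    · have := hv.min_le_add f g hf0 hg0 hfg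
      have h1 := hf.resolve_left hf0
      have h2 := hg.resolve_left hg0
      exact Or.inr (by omega)
  smul_mem' := by
    intro c f hf
    by_cases hc : c = 0
    · simp [hc]
    by_cases hf0 : f = 0
    · simp [hf0]
    · exact Or.inr ((hv.smul c f hc hf0).symm ▸ hf.resolve_left hf0)

theorem mem_geSubmodule (hv : IsOrderFunction K v) {n : ℤ} {f : F} :
    f ∈ hv.geSubmodule n ↔ f = 0 ∨ n ≤ v f := Iff.rfl

/-- In a linear relation the nonzero term of least order cannot be cancelled by the others. -/
theorem linearIndependent (hv : IsOrderFunction K v) {ι : Type*} {f : ι → F} (hf : ∀ i, f i ≠ 0)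
    (hinj : Function.Injective fun i => v (f i)) : LinearIndependent K f := by
  classical
  rw [linearIndependent_iff']
  intro s
  induction s using Finset.strongInduction with
  | H s ih =>
    intro c hc i hi
    by_contra hne
    obtain ⟨j, hj, hmin⟩ := Finset.exists_min_image (s.filter fun i => c i ≠ 0)
      (fun i => v (f i)) ⟨i, Finset.mem_filter.2 ⟨hi, hne⟩⟩
    rw [Finset.mem_filter] at hj
    have hsum : ∀ t : Finset ι, (∀ k ∈ t, k ∈ s ∧ k ≠ j) →
        ∑ k ∈ t, c k • f k ∈ hv.geSubmodule (v (f j) + 1) := by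
      intro t ht
      refine Submodule.sum_mem _ fun k hk => ?_
      by_cases hck : c k = 0
      · simp [hck]
      · refine Submodule.smul_mem _ _ (Or.inr ?_)
        have h1 := hmin k (Finset.mem_filter.2 ⟨(ht k hk).1, hck⟩)
        exact Int.add_one_le_iff.2 (lt_of_le_of_ne h1 fun h => (ht k hk).2 (hinj h).symm)
    have h1 := hsum (s.erase j) fun k hk => ⟨Finset.mem_of_mem_erase hk, Finset.ne_of_mem_erase hk⟩
    rw [← Finset.add_sum_erase s _ hj.1] at hc
    rw [eq_neg_of_add_eq_zero_right hc, Submodule.neg_mem_iff] at h1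
    rcases h1 with h1 | h1
    · exact (smul_ne_zero hj.2 (hf j)) h1
    · rw [hv.smul _ _ hj.2 (hf j)] at h1
      omega

/-- Only finitely many orders occur, so some element of `V` outside the span would have the largest
order among those outside. Subtracting a multiple of some `f i` would raise it further. -/
theorem span_eq_of_orderSet_subset (hv : IsOrderFunction K v) {V : Submodule K F}
    (hfin : (orderSet v V).Finite) {ι : Type*} {f : ι → F} (hf : ∀ i, f i ≠ 0)
    (hmem : ∀ i, f i ∈ V) (hrange : orderSet v V ⊆ Set.range fun i => v (f i)) :
    Submodule.span K (Set.range f) = V := by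
  refine le_antisymm (Submodule.span_le.2 (by rintro _ ⟨i, rfl⟩; exact hmem i)) ?_
  by_contra hle
  obtain ⟨x, hxV, hx⟩ := SetLike.not_le_iff_exists.1 hle
  have hfin' : (v '' {g | g ∈ V ∧ g ∉ Submodule.span K (Set.range f)}).Finite := by
    refine hfin.subset ?_
    rintro _ ⟨g, ⟨hg, hg'⟩, rfl⟩
    exact ⟨g, hg, by rintro rfl; exact hg' (Submodule.zero_mem _), rfl⟩
  obtain ⟨n, ⟨g, ⟨hg, hg'⟩, rfl⟩, hmax⟩ := Set.exists_max_image _ id hfin'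
    ⟨v x, x, ⟨hxV, hx⟩, rfl⟩
  have hg0 : g ≠ 0 := by rintro rfl; exact hg' (Submodule.zero_mem _)
  obtain ⟨i, hi⟩ := hrange ⟨g, hg, hg0, rfl⟩
  obtain ⟨c, hc⟩ := hv.exists_lt_sub (f i) g (hf i) hg0 hi
  have hfi : f i ∈ Submodule.span K (Set.range f) := Submodule.subset_span ⟨i, rfl⟩
  rcases hc with hc | hc
  · rw [sub_eq_zero.1 hc] at hg'
    exact hg' (Submodule.smul_mem _ _ hfi)
  · have h2 : g - c • f i ∈ V ∧ g - c • f i ∉ Submodule.span K (Set.range f) := by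
      refine ⟨V.sub_mem hg (V.smul_mem _ (hmem i)), fun h => hg' ?_⟩
      simpa using Submodule.add_mem _ h (Submodule.smul_mem _ c hfi)
    have h3 : v (g - c • f i) ≤ v g := hmax _ ⟨_, h2, rfl⟩
    have h4 : v (f i) = v g := hi
    omega

theorem exists_family (V : Submodule K F) :
    ∃ f : orderSet v V → F, ∀ i, f i ∈ V ∧ f i ≠ 0 ∧ v (f i) = i :=
  ⟨fun i => i.2.choose, fun i => i.2.choose_spec⟩

theorem finite_orderSet (hv : IsOrderFunction K v) (V : Submodule K F) [FiniteDimensional K V] :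
    (orderSet v V).Finite := by
  obtain ⟨f, hf⟩ := exists_family (v := v) V
  have hli : LinearIndependent K fun i => (⟨f i, (hf i).1⟩ : V) := by
    refine LinearIndependent.of_comp V.subtype ?_
    refine hv.linearIndependent (fun i => (hf i).2.1) fun i j hij => ?_
    simpa [(hf _).2.2, Subtype.ext_iff] using hij
  have := hli.finite
  exact Set.toFinite _

/-- One element for each order that occurs gives a basis. -/
theorem ncard_orderSet (hv : IsOrderFunction K v) (V : Submodule K F) [FiniteDimensional K V] :
    (orderSet v V).ncard = Module.finrank K V := by
  obtain ⟨f, hf⟩ := exists_family (v := v) V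
  have hfin := hv.finite_orderSet V
  have := hfin.fintype
  have hli : LinearIndependent K f := by
    refine hv.linearIndependent (fun i => (hf i).2.1) fun i j hij => ?_
    simpa [(hf _).2.2, Subtype.ext_iff] using hij
  have hspan := hv.span_eq_of_orderSet_subset hfin (fun i => (hf i).2.1) (fun i => (hf i).1)
    fun n hn => ⟨⟨n, hn⟩, (hf _).2.2⟩
  have hcard := finrank_span_eq_card hli
  rw [hspan] at hcard
  rw [hcard, Set.ncard_eq_toFinset_card', Set.toFinset_card]

theorem finrank_inf_geSubmodule (hv : IsOrderFunction K v) (V : Submodule K F)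
    [FiniteDimensional K V] {r : ℕ} {a : Fin r → ℤ} (ha : StrictMono a)
    (hrange : Set.range a = orderSet v V) (i : Fin r) :
    Module.finrank K ↥(V ⊓ hv.geSubmodule (a i)) = r - i := by
  rw [← hv.ncard_orderSet]
  have : orderSet v (V ⊓ hv.geSubmodule (a i)) = a '' Set.Ici i := by
    ext n
    constructor
    · rintro ⟨f, ⟨hf, hf'⟩, hf0, rfl⟩
      have hmem : v f ∈ orderSet v V := ⟨f, hf, hf0, rfl⟩
      rw [← hrange] at hmem
      obtain ⟨j, hj⟩ := hmem
      exact ⟨j, ha.le_iff_le.1 (hj ▸ hf'.resolve_left hf0), hj⟩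
    · rintro ⟨j, hj, rfl⟩
      have hmem : a j ∈ Set.range a := Set.mem_range_self j
      rw [hrange] at hmem
      obtain ⟨f, hf, hf0, hfj⟩ := hmem
      exact ⟨f, ⟨hf, Or.inr (hfj ▸ ha.monotone hj)⟩, hf0, hfj⟩
  rw [this, Set.ncard_image_of_injective _ ha.injective, ← Finset.coe_Ici, Set.ncard_coe_finset,
    Fin.card_Ici]

/-- Filtrations of a subspace by two order functions meet in expected dimension. -/
theorem exists_mem_of_two (hv : IsOrderFunction K v) (hv' : IsOrderFunction K v')
    (V : Submodule K F) [FiniteDimensional K V] {r : ℕ} {a b : Fin r → ℤ} (ha : StrictMono a)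
    (hb : StrictMono b) (hra : Set.range a = orderSet v V) (hrb : Set.range b = orderSet v' V)
    (i : Fin r) : ∃ f ∈ V, f ≠ 0 ∧ a i ≤ v f ∧ b i.rev ≤ v' f := by
  have h1 := hv.finrank_inf_geSubmodule V ha hra i
  have h2 := hv'.finrank_inf_geSubmodule V hb hrb i.rev
  have hr : Module.finrank K V = r := by
    rw [← hv.ncard_orderSet, ← hra, ← Set.image_univ, Set.ncard_image_of_injective _ ha.injective,
      Set.ncard_univ, Nat.card_fin]
  have h3 := Submodule.finrank_sup_add_finrank_inf_eq (V ⊓ hv.geSubmodule (a i))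
    (V ⊓ hv'.geSubmodule (b i.rev))
  have h4 : Module.finrank K ↥(V ⊓ hv.geSubmodule (a i) ⊔ V ⊓ hv'.geSubmodule (b i.rev)) ≤ r :=
    (Submodule.finrank_mono (sup_le inf_le_left inf_le_left)).trans hr.le
  rw [Fin.val_rev] at h2
  -- The two dimensions `r - i` and `i + 1` add up to more than `r`.
  have h5 : 0 < Module.finrank K
      ↥(V ⊓ hv.geSubmodule (a i) ⊓ (V ⊓ hv'.geSubmodule (b i.rev))) := by omega
  have h6 : V ⊓ hv.geSubmodule (a i) ⊓ (V ⊓ hv'.geSubmodule (b i.rev)) ≠ ⊥ := by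
    intro h; rw [h, finrank_bot] at h5; omega
  obtain ⟨f, ⟨⟨hf, hf1⟩, ⟨-, hf2⟩⟩, hf0⟩ := Submodule.exists_mem_ne_zero_of_ne_bot h6
  exact ⟨f, hf, hf0, hf1.resolve_left hf0, hf2.resolve_left hf0⟩

/-- The orders on the span of a family of elements with distinct orders. -/
theorem finrank_span_and_orderSet (hv : IsOrderFunction K v) {r : ℕ} {f : Fin r → F}
    (hf : ∀ i, f i ≠ 0) (hinj : Function.Injective fun i => v (f i)) :
    Module.finrank K (Submodule.span K (Set.range f)) = r ∧
      orderSet v (Submodule.span K (Set.range f)) = Set.range fun i => v (f i) := by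
  have hli := hv.linearIndependent hf hinj
  have hr : Module.finrank K (Submodule.span K (Set.range f)) = r := by
    rw [finrank_span_eq_card hli, Fintype.card_fin]
  have hfd : FiniteDimensional K (Submodule.span K (Set.range f)) :=
    FiniteDimensional.span_of_finite K (Set.finite_range f)
  refine ⟨hr, (Set.eq_of_subset_of_ncard_le ?_ ?_ (hv.finite_orderSet _)).symm⟩
  · rintro _ ⟨i, rfl⟩
    exact ⟨f i, Submodule.subset_span ⟨i, rfl⟩, hf i, rfl⟩
  · rw [hv.ncard_orderSet, hr, ← Set.image_univ, Set.ncard_image_of_injective _ hinj,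
      Set.ncard_univ, Nat.card_fin]

end IsOrderFunction

/-! ### Order functions on the function field of an elliptic curve -/

namespace WeierstrassCurve.Affine

variable {K : Type*} [Field K] {W : WeierstrassCurve.Affine K} [IsAlgClosed K] [W.IsElliptic]

/-- Independence of the fraction chosen by `IsLocalization.sec`, by multiplicativity of the order.
-/
theorem pointOrd_eq_sub (P : W.Point) {f : W.FunctionField} {a b : W.CoordinateRing} (ha : a ≠ 0)
    (hb : b ≠ 0) (h : f * algebraMap _ _ b = algebraMap _ _ a) :
    pointOrd W P f = pointOrdInt W P a - pointOrdInt W P b := by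
  have hs := IsLocalization.sec_spec (nonZeroDivisors W.CoordinateRing) f
  set s := IsLocalization.sec (nonZeroDivisors W.CoordinateRing) f with hsdef
  have hs2 : (s.2 : W.CoordinateRing) ≠ 0 := nonZeroDivisors.ne_zero s.2.2
  have hinj := IsFractionRing.injective W.CoordinateRing W.FunctionField
  have h1 : s.1 * b = a * s.2 := by
    apply hinj
    rw [map_mul, map_mul, ← hs, ← h]; ring
  have hs1 : s.1 ≠ 0 := by
    intro h0
    rw [h0, zero_mul] at h1
    exact mul_ne_zero ha hs2 h1.symm
  have h2 := congrArg (pointOrdInt W P) h1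
  rw [pointOrdInt_mul P hs1 hb, pointOrdInt_mul P ha hs2] at h2
  rw [pointOrd, ← hsdef]
  omega

omit [IsAlgClosed K] [W.IsElliptic] in
theorem exists_mul_eq_mul (f g : W.FunctionField) (hf : f ≠ 0) (hg : g ≠ 0) :
    ∃ a b c : W.CoordinateRing, a ≠ 0 ∧ b ≠ 0 ∧ c ≠ 0 ∧ f * algebraMap _ _ c = algebraMap _ _ a ∧
      g * algebraMap _ _ c = algebraMap _ _ b := by
  obtain ⟨⟨c, hc⟩, h⟩ := IsLocalization.exist_integer_multiples_of_finset
    (nonZeroDivisors W.CoordinateRing) ({f, g} : Finset W.FunctionField)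
  obtain ⟨a, ha⟩ := h f (by simp)
  obtain ⟨b, hb⟩ := h g (by simp)
  have hc0 := nonZeroDivisors.ne_zero hc
  have hc' : algebraMap W.CoordinateRing W.FunctionField c ≠ 0 := by simpa using hc0
  rw [Algebra.smul_def, mul_comm] at ha hb
  refine ⟨a, b, c, ?_, ?_, hc0, ha.symm, hb.symm⟩
  · rintro rfl; simp [hf, hc0] at ha
  · rintro rfl; simp [hg, hc0] at hb

theorem isOrderFunction_pointOrd (P : W.Point) : IsOrderFunction K (pointOrd W P) where
  min_le_add f g hf hg hfg := by
    obtain ⟨a, b, c, ha, hb, hc, h1, h2⟩ := exists_mul_eq_mul f g hf hg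
    have h3 : (f + g) * algebraMap _ _ c = algebraMap _ _ (a + b) := by
      rw [add_mul, h1, h2, map_add]
    have hab : a + b ≠ 0 := by
      intro h; rw [h, map_zero] at h3; simp [hfg, hc] at h3
    rw [pointOrd_eq_sub P ha hc h1, pointOrd_eq_sub P hb hc h2, pointOrd_eq_sub P hab hc h3]
    have := min_le_pointOrdInt_add P ha hb hab
    omega
  smul k f hk hf := by
    obtain ⟨a, -, c, ha, -, hc, h1, -⟩ := exists_mul_eq_mul f f hf hf
    have hk' : algebraMap K W.CoordinateRing k ≠ 0 := by simpa using hk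
    have h2 : (k • f) * algebraMap _ _ c = algebraMap _ _ (algebraMap K W.CoordinateRing k * a) := by
      rw [smul_mul_assoc, h1, ← Algebra.smul_def, algebraMap.smul]
    rw [pointOrd_eq_sub P ha hc h1, pointOrd_eq_sub P (mul_ne_zero hk' ha) hc h2,
      pointOrdInt_mul P hk' ha, pointOrdInt_algebraMap P hk, zero_add]
  exists_lt_sub f g hf hg h := by
    obtain ⟨a, b, c, ha, hb, hc, h1, h2⟩ := exists_mul_eq_mul f g hf hg
    rw [pointOrd_eq_sub P ha hc h1, pointOrd_eq_sub P hb hc h2] at h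
    obtain ⟨k, hk⟩ := exists_lt_pointOrdInt_sub P ha hb (by omega)
    have h3 : (g - k • f) * algebraMap _ _ c = algebraMap _ _ (b - k • a) := by
      rw [sub_mul, h2, smul_mul_assoc, h1, map_sub, algebraMap.smul]
    refine ⟨k, or_iff_not_imp_left.2 fun h0 => ?_⟩
    have hab : b - k • a ≠ 0 := by
      intro h; rw [h, map_zero] at h3; simp [h0, hc] at h3
    rw [pointOrd_eq_sub P ha hc h1, pointOrd_eq_sub P hab hc h3]
    have := hk.resolve_left hab
    omega

theorem exists_divisor_pointOrd [DecidableEq K] {f : W.FunctionField} (hf : f ≠ 0) :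
    ∃ D : W.Point →₀ ℤ, (∀ P, D P = pointOrd W P f) ∧ divisorDegree D = 0 ∧
      divisorSum D = 0 := by
  obtain ⟨a, -, c, ha, -, hc, h1, -⟩ := exists_mul_eq_mul f f hf hf
  obtain ⟨D, hD, hD1, hD2⟩ := exists_divisor_pointOrdInt ha
  obtain ⟨E, hE, hE1, hE2⟩ := exists_divisor_pointOrdInt hc
  refine ⟨D - E, fun P => ?_, by rw [map_sub, hD1, hE1, sub_zero],
    by rw [map_sub, hD2, hE2, sub_zero]⟩
  rw [pointOrd_eq_sub P ha hc h1, Finsupp.sub_apply, hD, hE]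

/-- An effective divisor bounded by that of a section of `𝒪(D)` has degree at most `deg D`; in case
of equality the section vanishes exactly there. -/
theorem divisorDegree_le_of_le_pointOrd [DecidableEq K] {f : W.FunctionField} (hf : f ≠ 0)
    {D E : W.Point →₀ ℤ} (h : ∀ P, E P ≤ pointOrd W P f + D P) :
    divisorDegree E ≤ divisorDegree D ∧ (divisorDegree E = divisorDegree D →
      (∀ P, E P = pointOrd W P f + D P) ∧ divisorSum E = divisorSum D) := by
  obtain ⟨G, hG, hG1, hG2⟩ := exists_divisor_pointOrd hf
  have hle : E ≤ G + D := fun P => by rw [Finsupp.add_apply, hG]; exact h P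
  have hnn : 0 ≤ G + D - E := sub_nonneg.2 hle
  have hdeg : divisorDegree (G + D - E) = divisorDegree D - divisorDegree E := by
    rw [map_sub, map_add, hG1, zero_add]
  have hsum : 0 ≤ divisorDegree (G + D - E) := by
    rw [divisorDegree_apply]
    exact Finset.sum_nonneg fun P _ => hnn P
  refine ⟨by omega, fun heq => ?_⟩
  -- An effective divisor of degree zero is zero.
  have h0 : G + D - E = 0 := by
    have h1 : ∑ P ∈ (G + D - E).support, (G + D - E) P = 0 := by
      have := divisorDegree_apply (G + D - E)
      rw [hdeg, heq, sub_self] at this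
      exact this.symm
    rw [Finset.sum_eq_zero_iff_of_nonneg fun P _ => hnn P] at h1
    ext P
    by_cases hP : P ∈ (G + D - E).support
    · exact h1 P hP
    · exact Finsupp.notMem_support_iff.1 hP
  rw [sub_eq_zero] at h0
  refine ⟨fun P => by rw [← h0, Finsupp.add_apply, hG], by rw [← h0, map_add, hG2, zero_add]⟩

end WeierstrassCurve.Affine

/-! ### Aspects with prescribed vanishing at two points -/

namespace WeierstrassCurve.Affine

variable {K : Type*} [Field K] {W : WeierstrassCurve.Affine K}

/-- The order of vanishing at `P` of `f` as a section of `𝒪(D)`. -/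
def sectionOrd (D : W.Point →₀ ℤ) (P : W.Point) (f : W.FunctionField) : ℤ :=
  pointOrd W P f + D P

theorem isOrderFunction_sectionOrd [IsAlgClosed K] [W.IsElliptic] (D : W.Point →₀ ℤ)
    (P : W.Point) : IsOrderFunction K (sectionOrd D P) :=
  (isOrderFunction_pointOrd P).add_const (D P)

/-- Sections in `V` that vanish to order `α` at `p`, to order `β` at `q`, and on the part of `E`
away from `p` and `q`. -/
def vanishingSpace [IsAlgClosed K] [W.IsElliptic] (D : W.Point →₀ ℤ)
    (V : Submodule K W.FunctionField) (p q : W.Point) (α β : ℤ) (E : W.Point →₀ ℤ) :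
    Submodule K W.FunctionField :=
  V ⊓ (isOrderFunction_sectionOrd D p).geSubmodule α ⊓
    (isOrderFunction_sectionOrd D q).geSubmodule β ⊓
    ⨅ P ∈ ({p, q}ᶜ : Set W.Point), (isOrderFunction_sectionOrd D P).geSubmodule (E P)

theorem mem_vanishingSpace [IsAlgClosed K] [W.IsElliptic] {D : W.Point →₀ ℤ}
    {V : Submodule K W.FunctionField} {p q : W.Point} {α β : ℤ} {E : W.Point →₀ ℤ}
    {f : W.FunctionField} (hf : f ≠ 0) :
    f ∈ vanishingSpace D V p q α β E ↔ f ∈ V ∧ α ≤ sectionOrd D p f ∧ β ≤ sectionOrd D q f ∧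
      ∀ P, P ≠ p → P ≠ q → E P ≤ sectionOrd D P f := by
  simp only [vanishingSpace, Submodule.mem_inf, Submodule.mem_iInf,
    IsOrderFunction.mem_geSubmodule, hf, false_or, Set.mem_compl_iff, Set.mem_insert_iff,
    Set.mem_singleton_iff, not_or, and_imp]
  tauto

/-- The `i`-th vanishing order at `p` of an aspect with letter `w`. -/
def leftOrd (A : ℤ) (w i : ℕ) : ℤ := A + i - if i < w then 1 else 0

/-- The vanishing order at `q` of an aspect with letter `w` that is complementary to the `i`-th
vanishing order at `p`. -/
def rightOrd (m A : ℤ) (w i : ℕ) : ℤ := m - A - i - if w < i then 1 else 0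

theorem leftOrd_strictMono (A : ℤ) (w : ℕ) : StrictMono (leftOrd A w) := by
  intro i j hij
  unfold leftOrd
  split_ifs <;> omega

theorem rightOrd_strictAnti (m A : ℤ) (w : ℕ) : StrictAnti (rightOrd m A w) := by
  intro i j hij
  unfold rightOrd
  split_ifs <;> omega

/-- With `a + b` fixed, changing `a` moves the point by a multiple of the non-torsion point `p - q`.
-/
theorem zsmul_left_injective {p q : W.Point} [DecidableEq K] (h : ¬ IsOfFinAddOrder (p - q))
    {a a' b b' : ℤ} {x y : W.Point} (hab : a + b = a' + b') (hxy : x = y)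
    (heq : a • p + b • q + x = a' • p + b' • q + y) : a = a' := by
  subst hxy
  have h1 : (a - a') • (p - q) = 0 := by
    have h2 : a • p + b • q = a' • p + b' • q := add_right_cancel heq
    have h3 : (a - a') • (p - q) = a • p + (a' + b' - a) • q - (a' • p + b' • q) := by module
    rw [h3, ← hab, add_sub_cancel_left, h2, sub_self]
  by_contra hne
  exact h (isOfFinAddOrder_iff_zsmul_eq_zero.2 ⟨a - a', sub_ne_zero.2 hne, h1⟩)

theorem multisetDivisor_singleton (x : W.Point) :
    multisetDivisor {x} = Finsupp.single x 1 := by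
  simp [multisetDivisor]

/-- A linear series on an elliptic curve with two marked points whose vanishing orders are those of
an aspect, with letter `w`, of a limit linear series on a chain. -/
structure IsAspect [DecidableEq K] (D : W.Point →₀ ℤ) (V : Submodule K W.FunctionField)
    (p q : W.Point) (s : ℕ) (m A : ℤ) (w : ℕ) : Prop where
  nontorsion : ¬ IsOfFinAddOrder (p - q)
  degree_eq : divisorDegree D = m
  finrank_eq : Module.finrank K V = s + 1
  isSection : ∀ f ∈ V, IsSectionOf D f
  le : w ≤ s
  orderSet_left : orderSet (sectionOrd D p) V = leftOrd A w '' Set.Iic s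
  orderSet_right : orderSet (sectionOrd D q) V = rightOrd m A w '' Set.Iic s

namespace IsAspect

variable [DecidableEq K] [IsAlgClosed K] [W.IsElliptic] {D : W.Point →₀ ℤ}
  {V : Submodule K W.FunctionField} {p q : W.Point} {s : ℕ} {m A : ℤ} {w : ℕ}

omit [IsAlgClosed K] [W.IsElliptic] in
theorem ne (h : IsAspect D V p q s m A w) : p ≠ q := by
  rintro rfl
  exact h.nontorsion (by simp)

/-- A nonzero section cannot vanish too much; if it vanishes as much as possible, then its zeros
determine the line bundle. -/
theorem add_degree_le (h : IsAspect D V p q s m A w) {f : W.FunctionField} (hf : f ≠ 0) {α β : ℤ}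
    {S : Multiset W.Point} (hp : p ∉ S) (hq : q ∉ S)
    (hfS : f ∈ vanishingSpace D V p q α β (multisetDivisor S)) :
    α + β + S.card ≤ m ∧ (α + β + S.card = m →
      α • p + β • q + S.sum = divisorSum D ∧ sectionOrd D p f = α ∧ sectionOrd D q f = β ∧
      ∀ P, P ≠ p → P ≠ q → sectionOrd D P f = multisetDivisor S P) := by
  classical
  rw [mem_vanishingSpace hf] at hfS
  obtain ⟨-, h1, h2, h3⟩ := hfS
  set E : W.Point →₀ ℤ := Finsupp.single p α + Finsupp.single q β + multisetDivisor S with hE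
  have hSp : multisetDivisor S p = 0 := by
    rw [multisetDivisor_apply, Multiset.count_eq_zero.2 hp]; rfl
  have hSq : multisetDivisor S q = 0 := by
    rw [multisetDivisor_apply, Multiset.count_eq_zero.2 hq]; rfl
  have hEp : E p = α := by simp [hE, hSp, h.ne]
  have hEq : E q = β := by simp [hE, hSq, h.ne.symm]
  have hEP : ∀ P, P ≠ p → P ≠ q → E P = multisetDivisor S P := by
    intro P hp hq; simp [hE, hp, hq]
  have hle : ∀ P, E P ≤ pointOrd W P f + D P := by
    intro P
    by_cases hPp : P = p
    · subst hPp; rw [hEp]; exact h1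
    by_cases hPq : P = q
    · subst hPq; rw [hEq]; exact h2
    · rw [hEP P hPp hPq]; exact h3 P hPp hPq
  have hdeg : divisorDegree E = α + β + S.card := by
    simp [hE, map_add, divisorDegree_multisetDivisor]
  have hsum : divisorSum E = α • p + β • q + S.sum := by
    simp [hE, map_add, divisorSum_multisetDivisor]
  obtain ⟨h4, h5⟩ := divisorDegree_le_of_le_pointOrd hf hle
  rw [hdeg, h.degree_eq] at h4 h5
  refine ⟨h4, fun heq => ?_⟩
  obtain ⟨h6, h7⟩ := h5 heq
  exact ⟨hsum ▸ h7, (hEp ▸ h6 p).symm, (hEq ▸ h6 q).symm,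
    fun P hP hP' => (hEP P hP hP' ▸ h6 P).symm⟩

omit [IsAlgClosed K] [W.IsElliptic] in
theorem finiteDimensional (h : IsAspect D V p q s m A w) : FiniteDimensional K V :=
  FiniteDimensional.of_finrank_pos (by rw [h.finrank_eq]; omega)

/-- In every aspect there is a section with given complementary vanishing orders. -/
theorem exists_mem_vanishingSpace (h : IsAspect D V p q s m A w) {i : ℕ} (hi : i ≤ s) :
    ∃ f ∈ vanishingSpace D V p q (leftOrd A w i) (rightOrd m A w i) 0, f ≠ 0 := by
  have := h.finiteDimensional
  obtain ⟨f, hf, hf0, h1, h2⟩ := IsOrderFunction.exists_mem_of_two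
    (isOrderFunction_sectionOrd D p) (isOrderFunction_sectionOrd D q) V (r := s + 1)
    (a := fun i => leftOrd A w i) (b := fun i => rightOrd m A w i.rev)
    (fun i j hij => leftOrd_strictMono A w hij)
    (fun i j hij => rightOrd_strictAnti m A w (Fin.rev_lt_rev.2 hij))
    (by
      rw [h.orderSet_left]; ext n; constructor
      · rintro ⟨i, rfl⟩; exact ⟨i, Nat.lt_succ_iff.1 i.2, rfl⟩
      · rintro ⟨i, hi, rfl⟩; exact ⟨⟨i, Nat.lt_succ_iff.2 hi⟩, rfl⟩)
    (by
      rw [h.orderSet_right]; ext n; constructor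
      · rintro ⟨i, rfl⟩; exact ⟨i.rev, Nat.lt_succ_iff.1 i.rev.2, rfl⟩
      · rintro ⟨i, hi, rfl⟩; exact ⟨Fin.rev ⟨i, Nat.lt_succ_iff.2 hi⟩, by simp⟩)
    ⟨i, Nat.lt_succ_iff.2 hi⟩
  refine ⟨f, (mem_vanishingSpace hf0).2 ⟨hf, h1, by simpa using h2, fun P _ _ => ?_⟩, hf0⟩
  exact (h.isSection f hf).resolve_left hf0 P

/-- For the index `w` the two complementary orders fill the whole degree, so the section has no
other zeros and computes the class of the line bundle. -/
theorem divisorSum_eq (h : IsAspect D V p q s m A w) :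
    leftOrd A w w • p + rightOrd m A w w • q = divisorSum D := by
  obtain ⟨f, hf, hf0⟩ := h.exists_mem_vanishingSpace h.le
  have := ((h.add_degree_le hf0 (S := 0) (by simp) (by simp) hf).2
    (by simp [leftOrd, rightOrd])).1
  simpa using this

/-- Sections vanishing on `S` between the vanishing orders with indices `l` and `k`. -/
theorem card_le (h : IsAspect D V p q s m A w) {f : W.FunctionField} (hf : f ≠ 0) {l k : ℕ}
    {S : Multiset W.Point} (hp : p ∉ S) (hq : q ∉ S)
    (hfS : f ∈ vanishingSpace D V p q (leftOrd A w l) (rightOrd m A w k) (multisetDivisor S)) :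
    (S.card : ℤ) ≤ k - l + (if l < w then 1 else 0) + (if w < k then 1 else 0) := by
  have := (h.add_degree_le hf hp hq hfS).1
  unfold leftOrd rightOrd at this
  omega

/-- If `k < l`, the two orders already fill the degree. Comparing the class with that of the section
of index `w`, non-torsion gives `l = w`; but then the two orders exceed the degree. -/
theorem le_of_mem (h : IsAspect D V p q s m A w) {f : W.FunctionField} (hf : f ≠ 0) {l k : ℕ}
    {E : W.Point →₀ ℤ}
    (hfS : f ∈ vanishingSpace D V p q (leftOrd A w l) (rightOrd m A w k) E) : l ≤ k := by
  have hfS0 : f ∈ vanishingSpace D V p q (leftOrd A w l) (rightOrd m A w k)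
      (multisetDivisor (0 : Multiset W.Point)) := by
    rw [mem_vanishingSpace hf] at hfS ⊢
    exact ⟨hfS.1, hfS.2.1, hfS.2.2.1, fun P _ _ => (h.isSection f hfS.1).resolve_left hf P⟩
  by_contra hlt
  obtain ⟨h1, h2⟩ := h.add_degree_le hf (by simp) (by simp) hfS0
  have h3 : leftOrd A w l + rightOrd m A w k + ((0 : Multiset W.Point).card : ℤ) = m := by
    unfold leftOrd rightOrd at h1 ⊢
    simp only [Multiset.card_zero] at h1 ⊢
    split_ifs at h1 ⊢ <;> push_cast at h1 ⊢ <;> omega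
  have h4 := (h2 h3).1
  rw [← h.divisorSum_eq, ← add_zero (leftOrd A w w • p + rightOrd m A w w • q)] at h4
  have h5 := (leftOrd_strictMono A w).injective (zsmul_left_injective h.nontorsion
    (by simp only [Multiset.card_zero] at h3; rw [← add_zero (leftOrd A w l + _)]; push_cast at h3
        rw [h3]; simp [leftOrd, rightOrd]) (by simp) h4)
  subst h5
  unfold leftOrd rightOrd at h3
  simp only [Multiset.card_zero] at h3
  split_ifs at h3 <;> omega

/-- The class of the points at which a section that vanishes as much as possible vanishes. -/
theorem eq_of_card_eq (h : IsAspect D V p q s m A w) {f f' : W.FunctionField} (hf : f ≠ 0)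
    (hf' : f' ≠ 0) {l k l' k' : ℕ} {S : Multiset W.Point} (hp : p ∉ S) (hq : q ∉ S)
    (hfS : f ∈ vanishingSpace D V p q (leftOrd A w l) (rightOrd m A w k) (multisetDivisor S))
    (hfS' : f' ∈ vanishingSpace D V p q (leftOrd A w l') (rightOrd m A w k') (multisetDivisor S))
    (hc : (S.card : ℤ) = k - l + (if l < w then 1 else 0) + (if w < k then 1 else 0))
    (hc' : (S.card : ℤ) = k' - l' + (if l' < w then 1 else 0) + (if w < k' then 1 else 0)) :
    l = l' := by
  have h1 : leftOrd A w l + rightOrd m A w k + S.card = m := by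
    unfold leftOrd rightOrd; omega
  have h1' : leftOrd A w l' + rightOrd m A w k' + S.card = m := by
    unfold leftOrd rightOrd; omega
  have h2 := ((h.add_degree_le hf hp hq hfS).2 h1).1
  have h2' := ((h.add_degree_le hf' hp hq hfS').2 h1').1
  exact (leftOrd_strictMono A w).injective
    (zsmul_left_injective h.nontorsion (by omega) rfl (h2.trans h2'.symm))

omit [IsAlgClosed K] [W.IsElliptic] in
theorem exists_leftOrd_eq (h : IsAspect D V p q s m A w) {f : W.FunctionField} (hf : f ≠ 0)
    (hfV : f ∈ V) : ∃ i ≤ s, leftOrd A w i = sectionOrd D p f := by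
  have : sectionOrd D p f ∈ orderSet (sectionOrd D p) V := ⟨f, hfV, hf, rfl⟩
  rw [h.orderSet_left] at this
  exact this

omit [IsAlgClosed K] [W.IsElliptic] in
theorem exists_rightOrd_eq (h : IsAspect D V p q s m A w) {f : W.FunctionField} (hf : f ≠ 0)
    (hfV : f ∈ V) : ∃ i ≤ s, rightOrd m A w i = sectionOrd D q f := by
  have : sectionOrd D q f ∈ orderSet (sectionOrd D q) V := ⟨f, hfV, hf, rfl⟩
  rw [h.orderSet_right] at this
  exact this

theorem sectionOrd_left_eq (h : IsAspect D V p q s m A w) {g : W.FunctionField} (hg0 : g ≠ 0)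
    {l k : ℕ} {E : W.Point →₀ ℤ}
    (hg : g ∈ vanishingSpace D V p q (leftOrd A w l) (rightOrd m A w k) E)
    (hbot : ∀ g ∈ vanishingSpace D V p q (leftOrd A w (l + 1)) (rightOrd m A w k) E, g = 0) :
    sectionOrd D p g = leftOrd A w l := by
  have hg1 := (mem_vanishingSpace hg0).1 hg
  obtain ⟨i, -, hi⟩ := h.exists_leftOrd_eq hg0 hg1.1
  have h2 : l ≤ i := (leftOrd_strictMono A w).le_iff_le.1 (hi ▸ hg1.2.1)
  rcases h2.eq_or_lt with rfl | h2
  · exact hi.symm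
  · refine absurd (hbot g ((mem_vanishingSpace hg0).2 ⟨hg1.1, ?_, hg1.2.2⟩)) hg0
    rw [← hi]
    exact (leftOrd_strictMono A w).monotone h2

/-- All nonzero elements of the space have the same order at `p`. A difference of higher order lies
in the space with raised left index, so it vanishes: the space is at most a line. -/
theorem exists_smul_eq (h : IsAspect D V p q s m A w) {f f' : W.FunctionField} (hf : f ≠ 0)
    {l k : ℕ} {E : W.Point →₀ ℤ}
    (hfS : f ∈ vanishingSpace D V p q (leftOrd A w l) (rightOrd m A w k) E)
    (hfS' : f' ∈ vanishingSpace D V p q (leftOrd A w l) (rightOrd m A w k) E)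
    (hbot : ∀ g ∈ vanishingSpace D V p q (leftOrd A w (l + 1)) (rightOrd m A w k) E, g = 0) :
    ∃ c : K, f' = c • f := by
  by_cases hf' : f' = 0
  · exact ⟨0, by simp [hf']⟩
  obtain ⟨c, hc⟩ := (isOrderFunction_sectionOrd D p).exists_lt_sub f f' hf hf'
    ((h.sectionOrd_left_eq hf hfS hbot).trans (h.sectionOrd_left_eq hf' hfS' hbot).symm)
  refine ⟨c, by_contra fun hne => ?_⟩
  have h0 := sub_ne_zero.2 hne
  have hmem := Submodule.sub_mem _ hfS' (Submodule.smul_mem _ c hfS)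
  have hlt := hc.resolve_left h0
  rw [h.sectionOrd_left_eq h0 hmem hbot, h.sectionOrd_left_eq hf hfS hbot] at hlt
  exact lt_irrefl _ hlt

/-- Each of the spaces is at most a line, so `U` and `U'` contain the same nonzero vectors there up
to scalars. Those in `U'` have distinct orders at `p` and hence form a basis of `U'`. -/
theorem space_le_of_families (h : IsAspect D V p q s m A w) {r : ℕ}
    {U U' : Submodule K W.FunctionField} (hU' : Module.finrank K U' = r + 1)
    {S T : Fin (r + 1) → ℕ} (hS : Function.Injective S) {E : W.Point →₀ ℤ}
    (hbot : ∀ e, ∀ g ∈ vanishingSpace D V p q (leftOrd A w (S e + 1)) (rightOrd m A w (T e)) E,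
      g = 0)
    (hf : ∀ e, ∃ f ∈ U, f ≠ 0 ∧
      f ∈ vanishingSpace D V p q (leftOrd A w (S e)) (rightOrd m A w (T e)) E)
    (hf' : ∀ e, ∃ f ∈ U', f ≠ 0 ∧
      f ∈ vanishingSpace D V p q (leftOrd A w (S e)) (rightOrd m A w (T e)) E) :
    U' ≤ U := by
  choose f hfU hf0 hfS using hf
  choose f' hfU' hf0' hfS' using hf'
  have hfd : FiniteDimensional K U' := FiniteDimensional.of_finrank_pos (by omega)
  have hspan : Submodule.span K (Set.range f') = U' := by
    refine Submodule.eq_of_le_of_finrank_eq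
      (Submodule.span_le.2 (by rintro _ ⟨e, rfl⟩; exact hfU' e)) ?_
    rw [hU']
    refine ((isOrderFunction_sectionOrd D p).finrank_span_and_orderSet hf0' fun e e' hee => ?_).1
    simp only [h.sectionOrd_left_eq (hf0' _) (hfS' _) (hbot _)] at hee
    exact hS ((leftOrd_strictMono A w).injective hee)
  rw [← hspan, Submodule.span_le]
  rintro _ ⟨e, rfl⟩
  obtain ⟨c, hc⟩ := h.exists_smul_eq (hf0 e) (hfS e) (hfS' e) (hbot e)
  rw [hc]
  exact U.smul_mem c (hfU e)

theorem exists_orders (h : IsAspect D V p q s m A w) {f : W.FunctionField} (hf : f ≠ 0)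
    {l k : ℕ} {E : W.Point →₀ ℤ}
    (hfS : f ∈ vanishingSpace D V p q (leftOrd A w l) (rightOrd m A w k) E) :
    ∃ l' k', l ≤ l' ∧ l' ≤ k' ∧ k' ≤ k ∧ sectionOrd D p f = leftOrd A w l' ∧
      sectionOrd D q f = rightOrd m A w k' := by
  have h1 := (mem_vanishingSpace hf).1 hfS
  obtain ⟨l', -, hl'⟩ := h.exists_leftOrd_eq hf h1.1
  obtain ⟨k', -, hk'⟩ := h.exists_rightOrd_eq hf h1.1
  refine ⟨l', k', (leftOrd_strictMono A w).le_iff_le.1 (hl' ▸ h1.2.1), ?_,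
    (rightOrd_strictAnti m A w).le_iff_ge.1 (hk' ▸ h1.2.2.1), hl'.symm, hk'.symm⟩
  exact h.le_of_mem (E := E) hf ((mem_vanishingSpace hf).2 ⟨h1.1, hl'.le, hk'.le, h1.2.2.2⟩)

/-- The extra zero of the section with the `i`-th vanishing orders. -/
def extraZero (D : W.Point →₀ ℤ) (p q : W.Point) (m A : ℤ) (w i : ℕ) : W.Point :=
  divisorSum D - leftOrd A w i • p - rightOrd m A w i • q

theorem eq_extraZero (h : IsAspect D V p q s m A w) {f : W.FunctionField} (hf : f ≠ 0) {i : ℕ}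
    {x : W.Point} (hp : x ≠ p) (hq : x ≠ q)
    (hfS : f ∈ vanishingSpace D V p q (leftOrd A w i) (rightOrd m A w i) (multisetDivisor {x})) :
    i ≠ w ∧ x = extraZero D p q m A w i := by
  have hp' : p ∉ ({x} : Multiset W.Point) := by simpa using hp.symm
  have hq' : q ∉ ({x} : Multiset W.Point) := by simpa using hq.symm
  have h1 := h.card_le hf hp' hq' hfS
  have hiw : i ≠ w := by rintro rfl; simp at h1
  refine ⟨hiw, ?_⟩
  have h2 := ((h.add_degree_le hf hp' hq' hfS).2 (by
    unfold leftOrd rightOrd; rw [Multiset.card_singleton]; push_cast; omega)).1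
  rw [extraZero, ← h2]
  simp only [Multiset.sum_singleton]
  abel

omit [IsAlgClosed K] [W.IsElliptic] in
theorem extraZero_injective (h : IsAspect D V p q s m A w) {i j : ℕ} (hi : i ≠ w) (hj : j ≠ w)
    (hij : extraZero D p q m A w i = extraZero D p q m A w j) : i = j := by
  refine (leftOrd_strictMono A w).injective (zsmul_left_injective h.nontorsion ?_ hij
    (b := rightOrd m A w i) (b' := rightOrd m A w j) ?_)
  · unfold leftOrd rightOrd; omega
  · simp only [extraZero]; abel

theorem mem_vanishingSpace_single (h : IsAspect D V p q s m A w) {f : W.FunctionField}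
    (hf : f ≠ 0) {α β : ℤ} {E : W.Point →₀ ℤ} {x : W.Point}
    (hfS : f ∈ vanishingSpace D V p q α β E) (hx : 1 ≤ sectionOrd D x f) :
    f ∈ vanishingSpace D V p q α β (multisetDivisor {x}) := by
  rw [mem_vanishingSpace hf] at hfS ⊢
  refine ⟨hfS.1, hfS.2.1, hfS.2.2.1, fun P _ _ => ?_⟩
  rw [multisetDivisor_singleton]
  by_cases hPx : P = x
  · subst hPx; simpa using hx
  · rw [Finsupp.single_eq_of_ne hPx]
    exact (h.isSection f hfS.1).resolve_left hf P

/-- The section with the `i`-th vanishing orders, where `i` is not the letter of the aspect, has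
precisely one more zero. -/
theorem extraZero_spec (h : IsAspect D V p q s m A w) {i : ℕ} (hi : i ≤ s) (hiw : i ≠ w) :
    extraZero D p q m A w i ≠ p ∧ extraZero D p q m A w i ≠ q ∧
    ∃ f ∈ vanishingSpace D V p q (leftOrd A w i) (rightOrd m A w i)
      (multisetDivisor {extraZero D p q m A w i}), f ≠ 0 := by
  obtain ⟨f, hf, hf0⟩ := h.exists_mem_vanishingSpace hi
  obtain ⟨l, k, h1, h2, h3, h4, h5⟩ := h.exists_orders hf0 hf
  obtain rfl : l = i := by omega
  obtain rfl : k = l := by omega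
  -- The orders at `p` and `q` add up to `m - 1` because `i` is not the letter, while the zero
  -- divisor of the section has degree `m`.
  have h6 : ∃ x, x ≠ p ∧ x ≠ q ∧ 1 ≤ sectionOrd D x f := by
    by_contra! hcon
    obtain ⟨G, hG, hG0, -⟩ := exists_divisor_pointOrd hf0
    have hle : G + D ≤ Finsupp.single p (leftOrd A w k) + Finsupp.single q (rightOrd m A w k) := by
      intro P
      have hP : (G + D) P = sectionOrd D P f := by rw [Finsupp.add_apply, hG]; rfl
      rw [hP]
      by_cases hPp : P = p
      · subst hPp; simp [h4, h.ne]
      by_cases hPq : P = q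
      · subst hPq; simp [h5, h.ne.symm]
      · have := hcon P hPp hPq
        rw [Finsupp.add_apply, Finsupp.single_eq_of_ne hPp, Finsupp.single_eq_of_ne hPq]
        omega
    have hnn := sub_nonneg.2 hle
    have hdeg : 0 ≤ divisorDegree (Finsupp.single p (leftOrd A w k) +
        Finsupp.single q (rightOrd m A w k) - (G + D)) := by
      rw [divisorDegree_apply]
      exact Finset.sum_nonneg fun P _ => hnn P
    rw [map_sub, map_add, map_add, hG0, h.degree_eq, divisorDegree_single,
      divisorDegree_single] at hdeg
    unfold leftOrd rightOrd at hdeg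
    omega
  obtain ⟨x, hxp, hxq, hx⟩ := h6
  have hfx := h.mem_vanishingSpace_single hf0 hf hx
  obtain ⟨-, rfl⟩ := h.eq_extraZero hf0 hxp hxq hfx
  exact ⟨hxp, hxq, f, hfx, hf0⟩

/-- A combination of two consecutive sections that vanishes at `x`. -/
theorem exists_pencil_section (h : IsAspect D V p q s m A w) {l : ℕ} (hl : l + 1 ≤ s)
    {x : W.Point} (hxp : x ≠ p) (hxq : x ≠ q)
    (hx : ∀ i, (i = l ∨ i = l + 1) → i ≠ w → x ≠ extraZero D p q m A w i) :
    ∃ f ∈ vanishingSpace D V p q (leftOrd A w l) (rightOrd m A w (l + 1)) (multisetDivisor {x}),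
      f ≠ 0 := by
  have key : ∀ i, (i = l ∨ i = l + 1) → ∃ f ∈ vanishingSpace D V p q (leftOrd A w i)
      (rightOrd m A w i) 0, f ≠ 0 ∧ sectionOrd D x f = 0 ∧ sectionOrd D p f = leftOrd A w i := by
    intro i hi
    obtain ⟨f, hf, hf0⟩ := h.exists_mem_vanishingSpace (show i ≤ s by omega)
    obtain ⟨l', k', h1, h2, h3, h4, h5⟩ := h.exists_orders hf0 hf
    obtain rfl : l' = i := by omega
    refine ⟨f, hf, hf0, le_antisymm (not_lt.1 fun hlt => ?_)
      (((mem_vanishingSpace hf0).1 hf).2.2.2 x hxp hxq), h4⟩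
    obtain ⟨h6, h7⟩ := h.eq_extraZero hf0 hxp hxq (h.mem_vanishingSpace_single hf0 hf hlt)
    exact hx _ hi h6 h7
  obtain ⟨f, hf, hf0, hfx, hfp⟩ := key l (Or.inl rfl)
  obtain ⟨g, hg, hg0, hgx, hgp⟩ := key (l + 1) (Or.inr rfl)
  -- Neither section vanishes at `x`, so some combination does; it is nonzero because the orders at
  -- `p` differ.
  obtain ⟨c, hc⟩ := (isOrderFunction_sectionOrd D x).exists_lt_sub f g hf0 hg0 (hfx.trans hgx.symm)
  have hne : g - c • f ≠ 0 := by
    intro h0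
    have hgc := sub_eq_zero.1 h0
    have hc0 : c ≠ 0 := by rintro rfl; exact hg0 (by simpa using hgc)
    rw [hgc, (isOrderFunction_sectionOrd D p).smul c f hc0 hf0, hfp] at hgp
    have := (leftOrd_strictMono A w).injective hgp
    omega
  have hmono : ∀ {i : ℕ}, (i = l ∨ i = l + 1) →
      vanishingSpace D V p q (leftOrd A w i) (rightOrd m A w i) 0 ≤
      vanishingSpace D V p q (leftOrd A w l) (rightOrd m A w (l + 1)) 0 := by
    intro i hi f hf
    by_cases hf0 : f = 0
    · rw [hf0]; exact Submodule.zero_mem _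
    rw [mem_vanishingSpace hf0] at hf ⊢
    exact ⟨hf.1, ((leftOrd_strictMono A w).monotone (by omega)).trans hf.2.1,
      ((rightOrd_strictAnti m A w).antitone (by omega)).trans hf.2.2.1, hf.2.2.2⟩
  refine ⟨g - c • f, h.mem_vanishingSpace_single hne (E := 0) ?_ ?_, hne⟩
  · exact Submodule.sub_mem _ (hmono (Or.inr rfl) hg)
      (Submodule.smul_mem _ c (hmono (Or.inl rfl) hf))
  · have := hc.resolve_left hne
    omega

end IsAspect

end WeierstrassCurve.Affine

/-! ### Combinatorics of index sequences -/

theorem sum_ite_le_one_of_unique {ι : Type*} [Fintype ι] (p : ι → Prop) [DecidablePred p]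
    (h : ∀ e e', p e → p e' → e = e') : ∑ e, (if p e then (1 : ℤ) else 0) ≤ 1 := by
  rw [Finset.sum_boole]
  have : (Finset.univ.filter p).card ≤ 1 := Finset.card_le_one.2 fun a ha b hb =>
    h a b (Finset.mem_filter.1 ha).2 (Finset.mem_filter.1 hb).2
  exact_mod_cast this

theorem sum_ite_mem_Ico_le {ι : Type*} [Fintype ι] {S : ι → ℕ} (hS : Function.Injective S)
    (a b : ℕ) : ∑ e, (if a ≤ S e ∧ S e < b then (1 : ℤ) else 0) ≤ (b - a : ℕ) := by
  rw [Finset.sum_boole]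
  have : (Finset.univ.filter fun e => a ≤ S e ∧ S e < b).card ≤ (Finset.Ico a b).card :=
    Finset.card_le_card_of_injOn S (fun e he => by simpa using he) hS.injOn
  rw [Nat.card_Ico] at this
  exact_mod_cast this

/-! ### The cost of base points, on a component and at a node -/

section Aspect

variable {r : ℕ} {S T : Fin (r + 1) → ℕ} {k w : ℕ}

/-- The excess is the number of zeros that a section with indices `S e ≤ T e` may have. -/
theorem mul_lt_sum_sub_of_two_le (hS : Function.Injective S)
    (hk : ∀ e, (k : ℤ) ≤ T e - S e + (if S e < w then 1 else 0) + (if w < T e then 1 else 0))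
    (htight : ∀ e e',
      (k : ℤ) = T e - S e + (if S e < w then 1 else 0) + (if w < T e then 1 else 0) →
      (k : ℤ) = T e' - S e' + (if S e' < w then 1 else 0) + (if w < T e' then 1 else 0) → e = e')
    (hle : ∀ e, S e ≤ T e) (hk2 : 2 ≤ k) : (k : ℤ) * r < ∑ e, ((T e : ℤ) - S e) := by
  -- Away from the tight index, `T e - S e` drops below `k` only if `S e < w < T e`, and then by
  -- one; the length `k - 1` confines `S e` to the `k - 2` values just below `w`. So the total loss
  -- is at most `1 + (k - 2)`, less than the `k` contributed by the extra index.
  have h1 : ∀ e, (k : ℤ) - (if (k : ℤ) = T e - S e + (if S e < w then 1 else 0) +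
      (if w < T e then 1 else 0) then 1 else 0) -
      (if w + 2 - k ≤ S e ∧ S e < w then 1 else 0) ≤ T e - S e := by
    intro e
    have := hk e
    have := hle e
    split_ifs at * <;> omega
  have h2 := Finset.sum_le_sum fun e (_ : e ∈ Finset.univ) => h1 e
  rw [Finset.sum_sub_distrib, Finset.sum_sub_distrib] at h2
  have h3 := sum_ite_le_one_of_unique _ htight
  have h4 := sum_ite_mem_Ico_le hS (w + 2 - k) w
  have h5 : ((w - (w + 2 - k) : ℕ) : ℤ) ≤ k - 2 := by omega
  simp only [Finset.sum_const, Finset.card_univ, Fintype.card_fin, nsmul_eq_mul] at h2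
  push_cast at h2
  linarith

/-- An index can stay in place only if it is tight, which happens at most once. Equality leaves
exactly one stationary index and unit steps elsewhere. -/
theorem le_sum_sub_of_one
    (hk : ∀ e, (1 : ℤ) ≤ T e - S e + (if S e < w then 1 else 0) + (if w < T e then 1 else 0))
    (htight : ∀ e e',
      (1 : ℤ) = T e - S e + (if S e < w then 1 else 0) + (if w < T e then 1 else 0) →
      (1 : ℤ) = T e' - S e' + (if S e' < w then 1 else 0) + (if w < T e' then 1 else 0) → e = e')
    (hle : ∀ e, S e ≤ T e) : (r : ℤ) ≤ ∑ e, ((T e : ℤ) - S e) ∧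
      (∑ e, ((T e : ℤ) - S e) = r → ∃ e₀, T e₀ = S e₀ ∧ ∀ e, e ≠ e₀ → T e = S e + 1) := by
  have h1 : ∀ e, (1 : ℤ) - (if (1 : ℤ) = T e - S e + (if S e < w then 1 else 0) +
      (if w < T e then 1 else 0) then 1 else 0) ≤ T e - S e := by
    intro e
    have := hk e
    have := hle e
    split_ifs at * <;> omega
  have h2 := Finset.sum_le_sum fun e (_ : e ∈ Finset.univ) => h1 e
  rw [Finset.sum_sub_distrib] at h2
  have h3 := sum_ite_le_one_of_unique _ htight
  have h4 : ∑ _e : Fin (r + 1), (1 : ℤ) = r + 1 := by simp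
  rw [h4] at h2
  refine ⟨by linarith, fun heq => ?_⟩
  have h5 : ∑ e, ((1 : ℤ) - (if (1 : ℤ) = T e - S e + (if S e < w then 1 else 0) +
      (if w < T e then 1 else 0) then 1 else 0)) = ∑ e, ((T e : ℤ) - S e) := by
    refine le_antisymm (Finset.sum_le_sum fun e _ => h1 e) ?_
    rw [Finset.sum_sub_distrib (f := fun _ => (1 : ℤ)), h4]
    linarith
  rw [Finset.sum_eq_sum_iff_of_le fun e _ => h1 e] at h5
  have h6 : ∃ e₀, (1 : ℤ) = T e₀ - S e₀ + (if S e₀ < w then 1 else 0) +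
      (if w < T e₀ then 1 else 0) := by
    by_contra! hne
    rw [Finset.sum_congr rfl fun e _ => if_neg (hne e)] at h2
    simp only [Finset.sum_const_zero] at h2
    linarith
  obtain ⟨e₀, he₀⟩ := h6
  refine ⟨e₀, ?_, fun e he => ?_⟩
  · have := h5 e₀ (Finset.mem_univ _)
    rw [if_pos he₀] at this
    omega
  · have := h5 e (Finset.mem_univ _)
    rw [if_neg fun h => he (htight _ _ h he₀)] at this
    omega

/-- Base points at a node force the vanishing indices to jump. -/
theorem mul_lt_sum_sub_of_leftOrd {A : ℤ} {N : ℕ} (hS : Function.Injective S) (hN : 1 ≤ N)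
    (h : ∀ e, leftOrd A w (S e) + N ≤ leftOrd A w (T e)) :
    (N : ℤ) * r < ∑ e, ((T e : ℤ) - S e) := by
  -- The orders skip one value between the indices `w - 1` and `w`. An index change can save one
  -- unit by crossing this gap, but only from the `N - 1` values just below `w`.
  have h1 : ∀ e, (N : ℤ) - (if w + 1 - N ≤ S e ∧ S e < w then 1 else 0) ≤ T e - S e := by
    intro e
    have := h e
    unfold leftOrd at this
    split_ifs at * <;> omega
  have h2 := Finset.sum_le_sum fun e (_ : e ∈ Finset.univ) => h1 e
  rw [Finset.sum_sub_distrib] at h2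
  have h4 := sum_ite_mem_Ico_le hS (w + 1 - N) w
  have h5 : ((w - (w + 1 - N) : ℕ) : ℤ) ≤ N - 1 := by omega
  simp only [Finset.sum_const, Finset.card_univ, Fintype.card_fin, nsmul_eq_mul] at h2
  push_cast at h2
  linarith

end Aspect

/-- The index sequence of a series with `n` base points to the left. -/
def indexState (n e : ℕ) : ℕ := e + n - if e < n then 1 else 0


/-- The data of the vanishing indices of a limit linear series included in another one, together
with the positions of the base points: `k j` on the `j`-th component away from the marked points,
`nP j` up to the left marked point, and `nQ j` from the right marked point on. -/
structure IndexChain (t g : ℕ) (S T : ℕ → Fin (t + 1) → ℕ) (k nP nQ : ℕ → ℕ) : Prop where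
  strictMono_right : ∀ j < g, StrictMono (T j)
  count : ∀ j < g, nP j + k j + nQ j = t + 1
  node : ∀ j, j + 1 < g → t + 1 ≤ nP (j + 1) + nQ j
  first : ∀ e : Fin (t + 1), (e : ℕ) + nP 0 ≤ S 0 e
  last : ∀ e : Fin (t + 1), T (g - 1) e + nQ (g - 1) ≤ t + e
  one : ∀ j < g, k j = 1 → (t : ℤ) ≤ ∑ e, ((T j e : ℤ) - S j e) ∧
    (∑ e, ((T j e : ℤ) - S j e) = t →
      ∃ e₀, T j e₀ = S j e₀ ∧ ∀ e, e ≠ e₀ → T j e = S j e + 1)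
  two_le : ∀ j < g, 2 ≤ k j → (k j : ℤ) * t < ∑ e, ((T j e : ℤ) - S j e)
  le : ∀ j < g, ∀ e, S j e ≤ T j e
  node_le : ∀ j, j + 1 < g → ∀ e, T j e ≤ S (j + 1) e
  node_lt : ∀ j, j + 1 < g → ∀ N : ℕ, 1 ≤ N → N + (t + 1) = nP (j + 1) + nQ j →
    (N : ℤ) * t < ∑ e, ((S (j + 1) e : ℤ) - T j e)

/-! ### Equality everywhere in the index budget -/

namespace IndexChain

variable {t g : ℕ} {S T : ℕ → Fin (t + 1) → ℕ} {k nP nQ : ℕ → ℕ}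

theorem mul_le_sum (h : IndexChain t g S T k nP nQ) {j : ℕ} (hj : j < g) :
    (k j : ℤ) * t ≤ ∑ e, (T j e : ℤ) - ∑ e, (S j e : ℤ) := by
  rw [← Finset.sum_sub_distrib]
  rcases (show k j = 0 ∨ k j = 1 ∨ 2 ≤ k j by omega) with h0 | h1 | h2
  · rw [h0]
    simp only [Nat.cast_zero, zero_mul]
    exact Finset.sum_nonneg fun e _ => by have := h.le j hj e; omega
  · have := (h.one j hj h1).1
    rw [h1]; push_cast; linarith
  · exact (h.two_le j hj h2).le

/-- The difference `nP (j + 1) - nP j - k j` is the number of base points at the node, as they are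
counted both in `nP (j + 1)` and in `nQ j`. -/
theorem node_mul_le_sum (h : IndexChain t g S T k nP nQ) {j : ℕ} (hj : j + 1 < g) :
    ((nP (j + 1) : ℤ) - nP j - k j) * t ≤ ∑ e, (S (j + 1) e : ℤ) - ∑ e, (T j e : ℤ) ∧
    (nP (j + 1) ≠ nP j + k j →
      ((nP (j + 1) : ℤ) - nP j - k j) * t < ∑ e, (S (j + 1) e : ℤ) - ∑ e, (T j e : ℤ)) := by
  rw [← Finset.sum_sub_distrib]
  have h1 := h.node j hj
  have h2 := h.count j (by omega)
  have h3 : nP (j + 1) ≠ nP j + k j →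
      ((nP (j + 1) : ℤ) - nP j - k j) * t < ∑ e, ((S (j + 1) e : ℤ) - T j e) := by
    intro hne
    have := h.node_lt j hj (nP (j + 1) - (nP j + k j)) (by omega) (by omega)
    rw [Nat.cast_sub (by omega)] at this
    push_cast at this
    linarith
  refine ⟨?_, h3⟩
  by_cases hne : nP (j + 1) = nP j + k j
  · rw [hne]
    push_cast
    have : 0 ≤ ∑ e, ((S (j + 1) e : ℤ) - T j e) :=
      Finset.sum_nonneg fun e _ => by have := h.node_le j hj e; omega
    linarith
  · exact (h3 hne).le

/-- Accumulates the cost `t` of each base point met so far. Those at the left end shift all `t + 1`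
indices, whence the additional `nP 0`. -/
theorem sum_left_ge (h : IndexChain t g S T k nP nQ) {j : ℕ} (hj : j < g) :
    ∑ e : Fin (t + 1), (e : ℤ) + nP 0 + nP j * t ≤ ∑ e, (S j e : ℤ) := by
  induction j with
  | zero =>
    have := Finset.sum_le_sum fun (e : Fin (t + 1)) (_ : e ∈ Finset.univ) =>
      (by exact_mod_cast h.first e : ((e : ℕ) : ℤ) + nP 0 ≤ S 0 e)
    rw [Finset.sum_add_distrib] at this
    simp only [Finset.sum_const, Finset.card_univ, Fintype.card_fin, nsmul_eq_mul] at this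
    push_cast at this
    linarith
  | succ j ih =>
    have h1 := ih (by omega)
    have h2 := h.mul_le_sum (j := j) (by omega)
    have h3 := (h.node_mul_le_sum hj).1
    linarith

theorem sum_right_le (h : IndexChain t g S T k nP nQ) {i : ℕ} (hi : i < g) :
    ∑ e, (T (g - 1 - i) e : ℤ) ≤
      ∑ e : Fin (t + 1), (e : ℤ) - nQ (g - 1) + (nP (g - 1 - i) + k (g - 1 - i)) * t := by
  induction i with
  | zero =>
    have := Finset.sum_le_sum fun (e : Fin (t + 1)) (_ : e ∈ Finset.univ) =>
      (by exact_mod_cast h.last e : (T (g - 1) e : ℤ) + nQ (g - 1) ≤ t + (e : ℕ))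
    rw [Finset.sum_add_distrib, Finset.sum_add_distrib] at this
    simp only [Finset.sum_const, Finset.card_univ, Fintype.card_fin, nsmul_eq_mul] at this
    have h1 := h.count (g - 1) (by omega)
    have h2 : (nP (g - 1) : ℤ) + k (g - 1) = t + 1 - nQ (g - 1) := by omega
    rw [Nat.sub_zero, h2]
    push_cast at this
    linarith
  | succ i ih =>
    have h1 := ih (by omega)
    have h4 : g - 1 - i = g - 1 - (i + 1) + 1 := by omega
    generalize g - 1 - (i + 1) = j at *
    rw [h4] at h1
    have h2 := h.mul_le_sum (j := j + 1) (by omega)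
    have h3 := (h.node_mul_le_sum (j := j) (by omega)).1
    linarith

/-- The bounds accumulated from the two ends of the chain meet with slack `-(nP 0 + nQ (g - 1))`, so
this number is zero and both bounds are attained on every component. -/
theorem equalities (h : IndexChain t g S T k nP nQ) {j : ℕ} (hj : j < g) :
    nP 0 = 0 ∧ nQ (g - 1) = 0 ∧
    ∑ e, (S j e : ℤ) = ∑ e : Fin (t + 1), (e : ℤ) + nP j * t ∧
    ∑ e, (T j e : ℤ) = ∑ e : Fin (t + 1), (e : ℤ) + (nP j + k j) * t := by
  have h1 := h.sum_left_ge hj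
  have h2 := h.sum_right_le (i := g - 1 - j) (by omega)
  rw [show g - 1 - (g - 1 - j) = j by omega] at h2
  have h3 := h.mul_le_sum hj
  have h4 : (nP 0 : ℤ) + nQ (g - 1) ≤ 0 := by linarith
  have h5 : nP 0 = 0 := by omega
  have h6 : nQ (g - 1) = 0 := by omega
  rw [h5] at h1
  rw [h6] at h2
  push_cast at h1 h2
  exact ⟨h5, h6, by linarith, by linarith⟩

theorem le_one (h : IndexChain t g S T k nP nQ) {j : ℕ} (hj : j < g) : k j ≤ 1 := by
  by_contra hlt
  have h1 := h.two_le j hj (by omega)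
  obtain ⟨-, -, h2, h3⟩ := h.equalities hj
  rw [Finset.sum_sub_distrib] at h1
  linarith

theorem nP_succ (h : IndexChain t g S T k nP nQ) {j : ℕ} (hj : j + 1 < g) :
    nP (j + 1) = nP j + k j := by
  by_contra hne
  have h1 := (h.node_mul_le_sum hj).2 hne
  obtain ⟨-, -, -, h3⟩ := h.equalities (j := j) (by omega)
  obtain ⟨-, -, h2, -⟩ := h.equalities hj
  linarith

theorem eq_of_sum_eq {ι : Type*} [Fintype ι] {a b : ι → ℕ} (hab : ∀ e, a e ≤ b e)
    (hs : ∑ e, (a e : ℤ) = ∑ e, (b e : ℤ)) (e : ι) : a e = b e := by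
  rw [Finset.sum_eq_sum_iff_of_le fun e _ => by exact_mod_cast hab e] at hs
  exact_mod_cast hs e (Finset.mem_univ _)

theorem left_succ_eq (h : IndexChain t g S T k nP nQ) {j : ℕ} (hj : j + 1 < g)
    (e : Fin (t + 1)) : S (j + 1) e = T j e := by
  obtain ⟨-, -, -, h3⟩ := h.equalities (j := j) (by omega)
  obtain ⟨-, -, h2, -⟩ := h.equalities hj
  refine (eq_of_sum_eq (h.node_le j hj) ?_ e).symm
  rw [h2, h3, h.nP_succ hj]
  push_cast
  ring

theorem right_eq_left (h : IndexChain t g S T k nP nQ) {j : ℕ} (hj : j < g) (hk : k j = 0)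
    (e : Fin (t + 1)) : T j e = S j e := by
  obtain ⟨-, -, h2, h3⟩ := h.equalities hj
  refine (eq_of_sum_eq (h.le j hj) ?_ e).symm
  rw [h2, h3, hk]
  push_cast
  ring

theorem exists_fixed (h : IndexChain t g S T k nP nQ) {j : ℕ} (hj : j < g) (hk : k j = 1) :
    ∃ e₀, T j e₀ = S j e₀ ∧ ∀ e, e ≠ e₀ → T j e = S j e + 1 := by
  obtain ⟨-, -, h2, h3⟩ := h.equalities hj
  refine (h.one j hj hk).2 ?_
  rw [Finset.sum_sub_distrib, h2, h3, hk]
  push_cast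
  ring

theorem right_le (h : IndexChain t g S T k nP nQ) {j : ℕ} (hj : j < g)
    (e : Fin (t + 1)) : T j e ≤ S j e + k j := by
  rcases (show k j = 0 ∨ k j = 1 by have := h.le_one hj; omega) with hk | hk
  · exact (h.right_eq_left hj hk e).le.trans (by omega)
  · obtain ⟨e₀, h0, h1⟩ := h.exists_fixed hj hk
    by_cases he : e = e₀
    · subst he; omega
    · rw [h1 e he, hk]

/-- No index pauses more than once: the `e`-th one must end at `t + e` after `t + 1` base points,
and each of them raises it by at most one. The induction runs backwards from the last component. -/
theorem right_ge (h : IndexChain t g S T k nP nQ) {i : ℕ} (hi : i < g) (e : Fin (t + 1)) :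
    e + nP (g - 1 - i) + k (g - 1 - i) ≤ T (g - 1 - i) e + 1 := by
  induction i with
  | zero =>
    obtain ⟨-, h1, -, h3⟩ := h.equalities (j := g - 1) (by omega)
    have h2 := h.count (g - 1) (by omega)
    have h4 : T (g - 1) e = t + e := by
      refine eq_of_sum_eq (a := T (g - 1)) (b := fun e : Fin (t + 1) => t + (e : ℕ))
        (fun e => (Nat.le_add_right _ _).trans (h.last e)) ?_ e
      rw [h3, show (nP (g - 1) : ℤ) + k (g - 1) = t + 1 by omega]
      push_cast
      rw [Finset.sum_add_distrib]
      simp only [Finset.sum_const, Finset.card_univ, Fintype.card_fin, nsmul_eq_mul]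
      push_cast
      ring
    rw [Nat.sub_zero]
    omega
  | succ i ih =>
    have h1 := ih (by omega)
    have h4 : g - 1 - i = g - 1 - (i + 1) + 1 := by omega
    generalize g - 1 - (i + 1) = j at *
    rw [h4] at h1
    have h2 := h.right_le (j := j + 1) (by omega) e
    have h3 := h.left_succ_eq (j := j) (by omega) e
    have h5 := h.nP_succ (j := j) (by omega)
    omega

/-- The index that pauses has to be number `nP j`. A smaller one has paused already, and a larger
one would be caught by its predecessor, which sits directly below it and moves up. -/
theorem right_eq_of_left_eq (h : IndexChain t g S T k nP nQ) {j : ℕ} (hj : j < g)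
    (hS : ∀ e : Fin (t + 1), S j e = indexState (nP j) e) (e : Fin (t + 1)) :
    T j e = indexState (nP j + k j) e := by
  rcases (show k j = 0 ∨ k j = 1 by have := h.le_one hj; omega) with hk | hk
  · rw [h.right_eq_left hj hk, hS, hk, add_zero]
  · obtain ⟨e₀, h0, h1⟩ := h.exists_fixed hj hk
    have h2 := h.right_ge (i := g - 1 - j) (by omega) e₀
    rw [show g - 1 - (g - 1 - j) = j by omega] at h2
    have h3 : (e₀ : ℕ) = nP j := by
      rcases lt_trichotomy (e₀ : ℕ) (nP j) with hlt | heq | hgt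
      · rw [h0, hS, indexState, if_pos hlt] at h2
        omega
      · exact heq
      · have h4 : (⟨e₀ - 1, by omega⟩ : Fin (t + 1)) < e₀ := by
          rw [Fin.lt_def]; simp only; omega
        have h5 := h.strictMono_right j hj h4
        rw [h1 _ h4.ne, h0, hS, hS, indexState, indexState, if_neg (by simp only; omega),
          if_neg (by omega)] at h5
        simp only at h5
        omega
    by_cases he : e = e₀
    · subst he
      rw [h0, hS, hk, indexState, indexState, if_neg (by omega), if_pos (by omega)]
      omega
    · have he' : (e : ℕ) ≠ nP j := fun heq => he (Fin.ext (heq.trans h3.symm))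
      rw [h1 e he, hS, hk, indexState, indexState]
      split_ifs <;> omega

theorem left_eq (h : IndexChain t g S T k nP nQ) {j : ℕ} (hj : j < g) (e : Fin (t + 1)) :
    S j e = indexState (nP j) e := by
  induction j generalizing e with
  | zero =>
    obtain ⟨h0, -, h2, -⟩ := h.equalities hj
    rw [h0, indexState, if_neg (by omega), add_zero, Nat.sub_zero]
    refine (eq_of_sum_eq (a := fun e : Fin (t + 1) => (e : ℕ)) (b := S 0)
      (fun e => (Nat.le_add_right _ _).trans (h.first e)) ?_ e).symm
    rw [h2, h0]
    simp
  | succ j ih =>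
    rw [h.left_succ_eq hj, h.nP_succ hj]
    exact h.right_eq_of_left_eq (by omega) (ih (by omega)) e

theorem right_eq (h : IndexChain t g S T k nP nQ) {j : ℕ} (hj : j < g) (e : Fin (t + 1)) :
    T j e = indexState (nP j + k j) e :=
  h.right_eq_of_left_eq hj (h.left_eq hj) e

end IndexChain

/-! ### Vanishing sequences -/

namespace WeierstrassCurve.Affine

variable {K : Type*} [Field K] {W : WeierstrassCurve.Affine K} [IsAlgClosed K] [W.IsElliptic]

/-- `Nat.nth` has the default value 0 beyond the end of a finite set, so it matters that exactly `r
+ 1` orders occur. -/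
theorem vanishingSeq_strictMono_and_range {D : W.Point →₀ ℤ} {V : Submodule K W.FunctionField}
    {r : ℕ} (hr : Module.finrank K V = r + 1) (hsec : ∀ f ∈ V, IsSectionOf D f) (P : W.Point) :
    StrictMono (fun i : Fin (r + 1) => (vanishingSeq D V P i : ℤ)) ∧
      Set.range (fun i : Fin (r + 1) => (vanishingSeq D V P i : ℤ)) =
        orderSet (sectionOrd D P) V := by
  have hfd : FiniteDimensional K V := FiniteDimensional.of_finrank_pos (by omega)
  set p : ℕ → Prop := fun n => ∃ f ∈ V, f ≠ 0 ∧ pointOrd W P f + D P = (n : ℤ) with hp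
  have himage : (Nat.cast : ℕ → ℤ) '' Set.ofPred p = orderSet (sectionOrd D P) V := by
    ext n
    constructor
    · rintro ⟨n, ⟨f, hf, hf0, hfn⟩, rfl⟩
      exact ⟨f, hf, hf0, hfn⟩
    · rintro ⟨f, hf, hf0, rfl⟩
      obtain ⟨n, hn⟩ := Int.eq_ofNat_of_zero_le ((hsec f hf).resolve_left hf0 P)
      exact ⟨n, ⟨f, hf, hf0, hn⟩, hn.symm⟩
  have hfinO := (isOrderFunction_sectionOrd D P).finite_orderSet V
  have hcardO := (isOrderFunction_sectionOrd D P).ncard_orderSet V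
  have hfin : (Set.ofPred p).Finite :=
    Set.Finite.of_finite_image (himage ▸ hfinO) Nat.cast_injective.injOn
  have hcard : hfin.toFinset.card = r + 1 := by
    rw [← Set.ncard_eq_toFinset_card _ hfin, ← hr, ← hcardO, ← himage,
      Set.ncard_image_of_injective _ Nat.cast_injective]
  have hmono := Nat.nth_strictMonoOn hfin
  have hrange := Nat.image_nth_Iio_card hfin
  rw [hcard] at hmono hrange
  constructor
  · intro i j hij
    exact Nat.cast_lt.2 (hmono i.2 j.2 hij)
  · rw [← himage, ← hrange]
    ext n
    constructor
    · rintro ⟨i, rfl⟩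
      exact ⟨_, ⟨i, i.2, rfl⟩, rfl⟩
    · rintro ⟨_, ⟨i, hi, rfl⟩, rfl⟩
      exact ⟨⟨i, hi⟩, rfl⟩

theorem vanishingSeq_eq {D : W.Point →₀ ℤ} {V : Submodule K W.FunctionField}
    {r : ℕ} (hr : Module.finrank K V = r + 1) (hsec : ∀ f ∈ V, IsSectionOf D f) (P : W.Point)
    {b : Fin (r + 1) → ℤ} (hb : StrictMono b) (hrange : Set.range b = orderSet (sectionOrd D P) V)
    (i : Fin (r + 1)) : (vanishingSeq D V P i : ℤ) = b i := by
  obtain ⟨h1, h2⟩ := vanishingSeq_strictMono_and_range hr hsec P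
  exact congrFun ((h1.range_inj hb).1 (h2.trans hrange.symm)) i

theorem le_vanishingSeq {D : W.Point →₀ ℤ} {V : Submodule K W.FunctionField}
    {r : ℕ} (hr : Module.finrank K V = r + 1) (hsec : ∀ f ∈ V, IsSectionOf D f) (P : W.Point)
    {i : ℕ} (hi : i ≤ r) : i ≤ vanishingSeq D V P i := by
  obtain ⟨h1, -⟩ := vanishingSeq_strictMono_and_range hr hsec P
  induction i with
  | zero => omega
  | succ i ih =>
    have h2 := ih (by omega)
    have h3 := h1 (show (⟨i, by omega⟩ : Fin (r + 1)) < ⟨i + 1, by omega⟩ by simp)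
    simp only [Nat.cast_lt] at h3
    omega

variable [DecidableEq K]

theorem IsAspect.of_vanishingSeq {D : W.Point →₀ ℤ} {V : Submodule K W.FunctionField}
    {p q : W.Point} {s w : ℕ} {m A : ℤ} (hpq : ¬ IsOfFinAddOrder (p - q))
    (hD : divisorDegree D = m) (hr : Module.finrank K V = s + 1)
    (hsec : ∀ f ∈ V, IsSectionOf D f) (hw : w ≤ s)
    (hp : ∀ i ≤ s, (vanishingSeq D V p i : ℤ) = leftOrd A w i)
    (hq : ∀ i ≤ s, (vanishingSeq D V q (s - i) : ℤ) = rightOrd m A w i) :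
    IsAspect D V p q s m A w where
  nontorsion := hpq
  degree_eq := hD
  finrank_eq := hr
  isSection := hsec
  le := hw
  orderSet_left := by
    rw [← (vanishingSeq_strictMono_and_range hr hsec p).2]
    ext n
    constructor
    · rintro ⟨i, rfl⟩
      exact ⟨i, Nat.lt_succ_iff.1 i.2, (hp i (Nat.lt_succ_iff.1 i.2)).symm⟩
    · rintro ⟨i, hi, rfl⟩
      exact ⟨⟨i, Nat.lt_succ_iff.2 hi⟩, hp i hi⟩
  orderSet_right := by
    rw [← (vanishingSeq_strictMono_and_range hr hsec q).2]
    ext n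
    constructor
    · rintro ⟨i, rfl⟩
      refine ⟨s - i, Nat.sub_le _ _, ?_⟩
      rw [← hq _ (Nat.sub_le _ _), Nat.sub_sub_self (Nat.lt_succ_iff.1 i.2)]
    · rintro ⟨i, hi, rfl⟩
      exact ⟨⟨s - i, by omega⟩, hq i hi⟩

omit [IsAlgClosed K] [W.IsElliptic] [DecidableEq K] in
theorem sectionOrd_sub (D E : W.Point →₀ ℤ) (P : W.Point) (f : W.FunctionField) :
    sectionOrd (D - E) P f = sectionOrd D P f - E P := by
  simp only [sectionOrd, Finsupp.sub_apply]; ring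

namespace IsAspect

variable {D : W.Point →₀ ℤ} {V : Submodule K W.FunctionField} {p q : W.Point} {s w : ℕ} {m A : ℤ}

omit [IsAlgClosed K] [W.IsElliptic] in
open scoped Classical in
theorem multisetDivisor_filter {M : Multiset W.Point} {P : W.Point} (hp : P ≠ p) (hq : P ≠ q) :
    multisetDivisor (M.filter fun P => P ≠ p ∧ P ≠ q) P = multisetDivisor M P := by
  rw [multisetDivisor_apply, multisetDivisor_apply, Multiset.count_filter_of_pos ⟨hp, hq⟩]

open scoped Classical in
/-- The vanishing sequences of a linear series included in an aspect after twisting down by `M`. -/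
theorem exists_indices (h : IsAspect D V p q s m A w) {U : Submodule K W.FunctionField}
    (hU : U ≤ V) {r : ℕ} (hr : Module.finrank K U = r + 1) {M : Multiset W.Point}
    (hsec : ∀ f ∈ U, IsSectionOf (D - multisetDivisor M) f) :
    ∃ S T : Fin (r + 1) → ℕ, StrictMono S ∧ StrictMono T ∧ (∀ e, S e ≤ s) ∧ (∀ e, T e ≤ s) ∧
      (∀ e : Fin (r + 1), leftOrd A w (S e) =
        vanishingSeq (D - multisetDivisor M) U p e + multisetDivisor M p) ∧
      (∀ e : Fin (r + 1), rightOrd m A w (T e) =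
        vanishingSeq (D - multisetDivisor M) U q (r - e) + multisetDivisor M q) ∧
      ∀ e, ∃ f ∈ U, f ≠ 0 ∧ f ∈ vanishingSpace D V p q (leftOrd A w (S e)) (rightOrd m A w (T e))
        (multisetDivisor (M.filter fun P => P ≠ p ∧ P ≠ q)) := by
  obtain ⟨hp1, hp2⟩ := vanishingSeq_strictMono_and_range hr hsec p
  obtain ⟨hq1, hq2⟩ := vanishingSeq_strictMono_and_range hr hsec q
  have hfd : FiniteDimensional K U := FiniteDimensional.of_finrank_pos (by omega)
  have hS : ∀ e : Fin (r + 1), ∃ i ≤ s, leftOrd A w i =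
      vanishingSeq (D - multisetDivisor M) U p e + multisetDivisor M p := by
    intro e
    have hmem : (vanishingSeq (D - multisetDivisor M) U p e : ℤ) ∈
      orderSet (sectionOrd (D - multisetDivisor M) p) U := hp2 ▸ ⟨e, rfl⟩
    obtain ⟨f, hf, hf0, hfe⟩ := hmem
    obtain ⟨i, hi, hi'⟩ := h.exists_leftOrd_eq hf0 (hU hf)
    exact ⟨i, hi, by rw [hi', ← hfe, sectionOrd_sub]; ring⟩
  have hT : ∀ e : Fin (r + 1), ∃ i ≤ s, rightOrd m A w i =
      vanishingSeq (D - multisetDivisor M) U q (r - e) + multisetDivisor M q := by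
    intro e
    have hmem : (vanishingSeq (D - multisetDivisor M) U q (r - e) : ℤ) ∈
      orderSet (sectionOrd (D - multisetDivisor M) q) U := hq2 ▸ ⟨⟨r - e, by omega⟩, rfl⟩
    obtain ⟨f, hf, hf0, hfe⟩ := hmem
    obtain ⟨i, hi, hi'⟩ := h.exists_rightOrd_eq hf0 (hU hf)
    exact ⟨i, hi, by rw [hi', ← hfe, sectionOrd_sub]; ring⟩
  choose S hSs hS using hS
  choose T hTs hT using hT
  refine ⟨S, T, fun e e' he => ?_, fun e e' he => ?_, hSs, hTs, hS, hT, fun e => ?_⟩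
  · rw [← (leftOrd_strictMono A w).lt_iff_lt, hS, hS]
    have := hp1 he
    simp only at this
    omega
  · rw [← (rightOrd_strictAnti m A w).lt_iff_gt, hT, hT]
    have := hq1 (show (⟨r - e', by omega⟩ : Fin (r + 1)) < ⟨r - e, by omega⟩ by
      rw [Fin.lt_def] at he ⊢; simp only; omega)
    simp only at this
    omega
  · obtain ⟨f, hf, hf0, h1, h2⟩ := IsOrderFunction.exists_mem_of_two
      (isOrderFunction_sectionOrd _ p) (isOrderFunction_sectionOrd _ q) U hp1 hq1 hp2 hq2 e
    rw [sectionOrd_sub] at h1 h2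
    have h3 : ((e.rev : ℕ)) = r - e := by rw [Fin.val_rev]; omega
    rw [h3] at h2
    refine ⟨f, hf, hf0, (mem_vanishingSpace hf0).2 ⟨hU hf, ?_, ?_, fun P hPp hPq => ?_⟩⟩
    · rw [hS]; omega
    · rw [hT]; omega
    · rw [multisetDivisor_filter hPp hPq]
      have h4 := (hsec f hf).resolve_left hf0 P
      have h5 := sectionOrd_sub D (multisetDivisor M) P f
      unfold sectionOrd at h5 ⊢
      omega

omit [DecidableEq K] in
theorem isSectionOf_of_mem_span {E : W.Point →₀ ℤ} {ι : Type*} {f : ι → W.FunctionField}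
    (hf : ∀ i, IsSectionOf E (f i)) {g : W.FunctionField}
    (hg : g ∈ Submodule.span K (Set.range f)) : IsSectionOf E g := by
  have hle : Submodule.span K (Set.range f) ≤
      ⨅ P : W.Point, (isOrderFunction_sectionOrd E P).geSubmodule 0 := by
    rw [Submodule.span_le]
    rintro _ ⟨i, rfl⟩
    simp only [Submodule.coe_iInf, Set.mem_iInter, SetLike.mem_coe,
      IsOrderFunction.mem_geSubmodule]
    intro P
    exact (hf i).imp_right fun h => h P
  have hg' := hle hg
  simp only [Submodule.mem_iInf, IsOrderFunction.mem_geSubmodule] at hg'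
  exact or_iff_not_imp_left.2 fun h0 P => (hg' P).resolve_left h0

open scoped Classical in
/-- Sections with increasing indices at both marked points span a linear series with these
vanishing indices. -/
theorem exists_space (h : IsAspect D V p q s m A w) {r : ℕ} {M : Multiset W.Point}
    {S T : Fin (r + 1) → ℕ} (hS : StrictMono S) (hT : StrictMono T)
    (hSM : ∀ e, multisetDivisor M p ≤ leftOrd A w (S e))
    (hTM : ∀ e, multisetDivisor M q ≤ rightOrd m A w (T e))
    (hf : ∀ e, ∃ f ∈ vanishingSpace D V p q (leftOrd A w (S e)) (rightOrd m A w (T e))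
        (multisetDivisor (M.filter fun P => P ≠ p ∧ P ≠ q)), f ≠ 0 ∧
        sectionOrd D p f = leftOrd A w (S e) ∧ sectionOrd D q f = rightOrd m A w (T e)) :
    ∃ U : Submodule K W.FunctionField, U ≤ V ∧ Module.finrank K U = r + 1 ∧
      (∀ f ∈ U, IsSectionOf (D - multisetDivisor M) f) ∧
      (∀ e : Fin (r + 1), leftOrd A w (S e) =
        vanishingSeq (D - multisetDivisor M) U p e + multisetDivisor M p) ∧
      ∀ e : Fin (r + 1), rightOrd m A w (T e) =
        vanishingSeq (D - multisetDivisor M) U q (r - e) + multisetDivisor M q := by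
  choose f hfS hf0 hfp hfq using hf
  have hmem := fun e => (mem_vanishingSpace (hf0 e)).1 (hfS e)
  have hsec : ∀ g ∈ Submodule.span K (Set.range f), IsSectionOf (D - multisetDivisor M) g := by
    refine fun g hg => isSectionOf_of_mem_span (fun e => Or.inr fun P => ?_) hg
    change 0 ≤ sectionOrd (D - multisetDivisor M) P (f e)
    rw [sectionOrd_sub, sub_nonneg]
    by_cases hPp : P = p
    · subst hPp; rw [hfp]; exact hSM e
    by_cases hPq : P = q
    · subst hPq; rw [hfq]; exact hTM e
    · rw [← multisetDivisor_filter hPp hPq]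
      exact (hmem e).2.2.2 P hPp hPq
  have hinjp : StrictMono fun e => sectionOrd (D - multisetDivisor M) p (f e) := by
    intro e e' hee
    have := leftOrd_strictMono A w (hS hee)
    simp only [sectionOrd_sub, hfp]
    omega
  have hinjq : StrictMono fun e : Fin (r + 1) =>
      sectionOrd (D - multisetDivisor M) q (f e.rev) := by
    intro e e' hee
    have := rightOrd_strictAnti m A w (hT (Fin.rev_lt_rev.2 hee))
    simp only [sectionOrd_sub, hfq]
    omega
  obtain ⟨hr, hp⟩ := (isOrderFunction_sectionOrd (D - multisetDivisor M)
    p).finrank_span_and_orderSet hf0 hinjp.injective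
  obtain ⟨-, hq⟩ := (isOrderFunction_sectionOrd (D - multisetDivisor M)
    q).finrank_span_and_orderSet hf0 (hinjq.injective.of_comp_right Fin.rev_surjective)
  refine ⟨Submodule.span K (Set.range f),
    Submodule.span_le.2 (by rintro _ ⟨e, rfl⟩; exact (hmem e).1), hr, hsec, fun e => ?_,
    fun e => ?_⟩
  · rw [vanishingSeq_eq hr hsec p hinjp hp.symm e, sectionOrd_sub, hfp]
    ring
  · have h1 := vanishingSeq_eq hr hsec q hinjq (by
      rw [hq]
      exact Fin.rev_surjective.range_comp fun e => sectionOrd (D - multisetDivisor M) q (f e))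
      e.rev
    rw [Fin.val_rev, Fin.rev_rev, sectionOrd_sub, hfq, Nat.add_sub_add_right] at h1
    rw [h1]
    ring

end IsAspect

end WeierstrassCurve.Affine

/-! ### Vanishing orders along the chain -/

/-- The `i`-th vanishing order at the left marked point of the `j`-th component of a series with
periodic word type. -/
def chainLeft (s j i : ℕ) : ℤ := leftOrd ((j : ℤ) - (j / (s + 1) : ℕ)) (j % (s + 1)) i

/-- The complementary vanishing order at the right marked point of the `j`-th component. -/
def chainRight (s : ℕ) (m : ℤ) (j i : ℕ) : ℤ :=
  rightOrd m ((j : ℤ) - (j / (s + 1) : ℕ)) (j % (s + 1)) i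

theorem chainLeft_zero (s i : ℕ) : chainLeft s 0 i = i := by
  simp [chainLeft, leftOrd]

theorem succ_div_mod_cases (s j : ℕ) :
    (j % (s + 1) < s ∧ (j + 1) / (s + 1) = j / (s + 1) ∧
      (j + 1) % (s + 1) = j % (s + 1) + 1) ∨
    (j % (s + 1) = s ∧ (j + 1) / (s + 1) = j / (s + 1) + 1 ∧ (j + 1) % (s + 1) = 0) := by
  have hs : 0 < s + 1 := by omega
  have h1 := Nat.mod_lt j hs
  have h2 := Nat.div_add_mod j (s + 1)
  rcases (show j % (s + 1) < s ∨ j % (s + 1) = s by omega) with h | h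
  · exact Or.inl ⟨h, (Nat.div_mod_unique hs).2 ⟨by omega, by omega⟩⟩
  · refine Or.inr ⟨h, (Nat.div_mod_unique hs).2 ⟨?_, by omega⟩⟩
    rw [Nat.mul_add]
    omega

theorem chainLeft_succ {s i : ℕ} (j : ℕ) (hi : i ≤ s) :
    chainLeft s (j + 1) i = chainLeft s j i + if i = j % (s + 1) then 0 else 1 := by
  unfold chainLeft leftOrd
  rcases succ_div_mod_cases s j with ⟨h1, h2, h3⟩ | ⟨h1, h2, h3⟩ <;> rw [h2, h3] <;>
    push_cast <;> split_ifs <;> omega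

theorem chainRight_eq {s i : ℕ} (m : ℤ) (j : ℕ) (hi : i ≤ s) :
    chainRight s m j i = m - chainLeft s (j + 1) i := by
  rw [chainLeft_succ j hi]
  unfold chainRight chainLeft rightOrd leftOrd
  split_ifs <;> omega

theorem chainLeft_mul (s u i : ℕ) : chainLeft s ((s + 1) * u) i = i + s * u := by
  unfold chainLeft leftOrd
  rw [Nat.mul_div_cancel_left _ (Nat.succ_pos s), Nat.mul_mod_right]
  push_cast
  simp only [not_lt_zero, if_false]
  ring

/-- If nothing is lost between the two ends of a telescoping chain of inequalities, then nothing is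
lost anywhere. -/
theorem eq_of_telescoping {g : ℕ} {α β F : ℕ → ℤ} {c : ℕ → ℤ} (h1 : ∀ j < g, β j = α j + c j)
    (h2 : ∀ j, j + 1 < g → β j ≤ α (j + 1)) (h3 : F 0 ≤ α 0) (h4 : β (g - 1) ≤ F g)
    (h5 : ∀ j < g, F (j + 1) = F j + c j) {j : ℕ} (hj : j < g) : α j = F j := by
  have hlow : ∀ j < g, F j ≤ α j := by
    intro j
    induction j with
    | zero => exact fun _ => h3
    | succ j ih =>
      intro hj
      have := ih (by omega)
      have := h1 j (by omega)
      have := h2 j hj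
      have := h5 j (by omega)
      omega
  have hup : ∀ i < g, α (g - 1 - i) ≤ F (g - 1 - i) := by
    intro i
    induction i with
    | zero =>
      intro hg
      have := h1 (g - 1) (by omega)
      have := h5 (g - 1) (by omega)
      rw [Nat.sub_add_cancel hg] at this
      rw [Nat.sub_zero]
      omega
    | succ i ih =>
      intro hi
      have h6 := ih (by omega)
      obtain ⟨k, hk⟩ : ∃ k, k = g - 1 - (i + 1) := ⟨_, rfl⟩
      rw [show g - 1 - i = k + 1 by omega] at h6
      rw [← hk]
      have := h1 k (by omega)
      have := h2 k (by omega)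
      have := h5 k (by omega)
      omega
  have := hup (g - 1 - j) (by omega)
  rw [show g - 1 - (g - 1 - j) = j by omega] at this
  exact le_antisymm this (hlow j hj)

section Chain

variable {K : Type*} [Field K] [DecidableEq K] {g : ℕ} {X : EllipticChain K g}

instance (X : EllipticChain K g) (j : Fin g) : (X.curve j).IsElliptic := X.elliptic j

/-- The `j`-th component of a limit linear series on a chain has the vanishing orders of a series
with periodic word type. -/
def HasChainAspects {s : ℕ} {m : ℤ} (V : LimitLinearSeries X s m) : Prop :=
  ∀ j : Fin g, IsAspect (V.div j) (V.space j) (X.p j) (X.q j) s m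
    ((j : ℤ) - ((j : ℕ) / (s + 1) : ℕ)) (j % (s + 1))

variable [IsAlgClosed K]

/-- The `i`-th order starts at `i` or higher and increases `s * u` times along the chain. Since the
complementary order at the far end is at least `s - i`, it must end at `m - (s - i) = i + s * u` or
lower, so no order can be lost at a node. -/
theorem hasChainAspects {s u : ℕ} {m : ℤ} (V : LimitLinearSeries X s m)
    (hV : V.HasWordType fun j => Fin.ofNat (s + 1) (j : ℕ)) (hg : g = (s + 1) * u)
    (hm : m = s * (u + 1)) : HasChainAspects V := by
  have key : ∀ i ≤ s, ∀ j : Fin g,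
      (vanishingSeq (V.div j) (V.space j) (X.p j) i : ℤ) = chainLeft s j i := by
    intro i hi j
    have hpos : 0 < g := j.pos
    have : NeZero g := ⟨hpos.ne'⟩
    have hidx : ∀ (j : ℕ) (hj : j < g), Fin.ofNat g j = ⟨j, hj⟩ := fun j hj =>
      Fin.ext (Nat.mod_eq_of_lt hj)
    have h := eq_of_telescoping (g := g)
      (α := fun j => vanishingSeq (V.div (Fin.ofNat g j)) (V.space (Fin.ofNat g j))
        (X.p (Fin.ofNat g j)) i)
      (β := fun j => m - vanishingSeq (V.div (Fin.ofNat g j)) (V.space (Fin.ofNat g j))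
        (X.q (Fin.ofNat g j)) (s - i))
      (F := fun j => chainLeft s j i) (c := fun j => if i = j % (s + 1) then 0 else 1)
      (fun j hj => ?_) (fun j hj => ?_) ?_ ?_ (fun j _ => chainLeft_succ j hi) j.2
    · rw [hidx _ j.2] at h
      exact h
    · have h1 := hV (Fin.ofNat g j) ⟨i, Nat.lt_succ_iff.2 hi⟩
      simp only [Fin.ext_iff, Fin.ofNat, Nat.mod_eq_of_lt hj] at h1 ⊢
      exact h1
    · have h1 := V.compatible (Fin.ofNat g j) (Fin.ofNat g (j + 1))
        (by rw [hidx _ hj, hidx j (by omega)]) i hi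
      omega
    · rw [chainLeft_zero]
      exact_mod_cast le_vanishingSeq (V.finrank_eq _) (V.isSection _) _ hi
    · have h1 := le_vanishingSeq (V.finrank_eq (Fin.ofNat g (g - 1)))
        (V.isSection (Fin.ofNat g (g - 1))) (X.q (Fin.ofNat g (g - 1))) (Nat.sub_le s i)
      have h2 : chainLeft s g i = i + s * u := by rw [hg, chainLeft_mul]
      have h3 : m = s * u + s := by rw [hm]; ring
      omega
  intro j
  refine IsAspect.of_vanishingSeq (X.nontorsion j) (V.degree_eq j) (V.finrank_eq j)
    (V.isSection j) (Nat.lt_succ_iff.1 (Nat.mod_lt _ (Nat.succ_pos s))) (fun i hi => key i hi j)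
    fun i hi => ?_
  have h1 := hV j ⟨i, Nat.lt_succ_iff.2 hi⟩
  have h2 := chainRight_eq m j hi
  rw [chainLeft_succ _ hi, ← key i hi j] at h2
  simp only [Fin.ext_iff, Fin.ofNat] at h1
  change _ = chainRight s m j i
  omega

end Chain

/-! ### Base points on the components -/

section Chain

variable {K : Type*} [Field K] [DecidableEq K] {g : ℕ} {X : EllipticChain K g}

namespace EllipticChain

/-- The points of the `j`-th component at which the aspects on this component have to vanish. -/
def inducedPoints (X : EllipticChain K g) {n : ℕ} (x : Sym X.Pt n) (j : Fin g) :
    Multiset (X.curve j).Point :=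
  (x : Multiset X.Pt).map (X.retract j)

theorem inducedDivisor_eq {n : ℕ} (x : Sym X.Pt n) (j : Fin g) :
    X.inducedDivisor x j = multisetDivisor (X.inducedPoints x j) := by
  rw [inducedDivisor, multisetDivisor, inducedPoints, Multiset.map_map]
  rfl

theorem p_ne_q (X : EllipticChain K g) (j : Fin g) : X.p j ≠ X.q j := by
  intro h
  refine X.nontorsion j ?_
  rw [h, sub_self]
  exact IsOfFinAddOrder.zero

theorem retract_mk_self (X : EllipticChain K g) (j : Fin g) (x : (X.curve j).Point) :
    X.retract j (Quot.mk _ ⟨j, x⟩) = x := by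
  simp [retract, retractAux]

theorem retract_mk_of_lt (X : EllipticChain K g) {i j : Fin g} (x : (X.curve i).Point)
    (h : i < j) : X.retract j (Quot.mk _ ⟨i, x⟩) = X.p j := by
  simp [retract, retractAux, h, h.ne]

theorem retract_mk_of_gt (X : EllipticChain K g) {i j : Fin g} (x : (X.curve i).Point)
    (h : j < i) : X.retract j (Quot.mk _ ⟨i, x⟩) = X.q j := by
  simp [retract, retractAux, h.ne', h.not_gt]

theorem retract_eq_p_or_eq_q (X : EllipticChain K g) {i j : Fin g} (h : i < j) (y : X.Pt) :
    X.retract j y = X.p j ∨ X.retract i y = X.q i := by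
  induction y using Quot.ind with
  | mk a =>
    obtain ⟨k, x⟩ := a
    rcases lt_or_ge k j with hk | hk
    · exact Or.inl (X.retract_mk_of_lt x hk)
    · exact Or.inr (X.retract_mk_of_gt x (h.trans_le hk))

theorem eq_mk_of_retract_eq (X : EllipticChain K g) {j : Fin g} {y : X.Pt}
    {x : (X.curve j).Point} (h : X.retract j y = x) (hp : x ≠ X.p j) (hq : x ≠ X.q j) :
    y = Quot.mk _ ⟨j, x⟩ := by
  induction y using Quot.ind with
  | mk a =>
    obtain ⟨k, z⟩ := a
    rcases lt_trichotomy k j with hk | rfl | hk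
    · exact absurd (h.symm.trans (X.retract_mk_of_lt z hk)) hp
    · rw [X.retract_mk_self] at h
      rw [h]
    · exact absurd (h.symm.trans (X.retract_mk_of_gt z hk)) hq

open scoped Classical in
/-- The points at which the aspects have to vanish, away from the marked points. -/
def freePoints (X : EllipticChain K g) {n : ℕ} (x : Sym X.Pt n) (j : Fin g) :
    Multiset (X.curve j).Point :=
  (X.inducedPoints x j).filter fun P => P ≠ X.p j ∧ P ≠ X.q j

open scoped Classical in
/-- The number of base points up to the left marked point. -/
def leftCount (X : EllipticChain K g) {n : ℕ} (x : Sym X.Pt n) (j : Fin g) : ℕ :=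
  (X.inducedPoints x j).count (X.p j)

open scoped Classical in
/-- The number of base points from the right marked point on. -/
def rightCount (X : EllipticChain K g) {n : ℕ} (x : Sym X.Pt n) (j : Fin g) : ℕ :=
  (X.inducedPoints x j).count (X.q j)

theorem leftCount_add (X : EllipticChain K g) {n : ℕ} (x : Sym X.Pt n) (j : Fin g) :
    X.leftCount x j + (X.freePoints x j).card + X.rightCount x j = n := by
  classical
  have h1 : (X.inducedPoints x j).card = n := by simp [inducedPoints]
  have h2 : ∀ M : Multiset (X.curve j).Point, M.count (X.p j) +
      (M.filter fun P => P ≠ X.p j ∧ P ≠ X.q j).card + M.count (X.q j) = M.card := by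
    intro M
    induction M using Multiset.induction with
    | empty => simp
    | cons P M ih =>
      rw [Multiset.count_cons, Multiset.count_cons, Multiset.filter_cons, Multiset.card_cons,
        Multiset.card_add]
      simp only [ne_eq] at ih ⊢
      by_cases hp : P = X.p j
      · subst hp
        simp [X.p_ne_q j, (X.p_ne_q j).symm]
        omega
      · by_cases hq : P = X.q j
        · subst hq
          simp [X.p_ne_q j]
          omega
        · simp [hp, hq, Ne.symm hp, Ne.symm hq]
          omega
  refine Eq.trans ?_ ((h2 (X.inducedPoints x j)).trans h1)
  unfold leftCount rightCount freePoints
  congr!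

/-- Every point of the chain lies before the `j`-th component or after the `i`-th one. -/
theorem le_leftCount_add_rightCount (X : EllipticChain K g) {n : ℕ} (x : Sym X.Pt n)
    {i j : Fin g} (h : i < j) : n ≤ X.leftCount x j + X.rightCount x i := by
  classical
  have h1 : Multiset.card (x : Multiset X.Pt) = n := x.2
  unfold leftCount rightCount inducedPoints
  rw [Multiset.count_map, Multiset.count_map, ← Multiset.card_add, Multiset.filter_add_filter,
    Multiset.card_add]
  have h2 : (x : Multiset X.Pt).filter
      (fun y => X.p j = X.retract j y ∨ X.q i = X.retract i y) = x := by
    refine Multiset.filter_eq_self.2 fun y _ => ?_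
    exact (X.retract_eq_p_or_eq_q h y).imp Eq.symm Eq.symm
  rw [h2, h1]
  omega

theorem p_notMem_freePoints (X : EllipticChain K g) {n : ℕ} (x : Sym X.Pt n) (j : Fin g) :
    X.p j ∉ X.freePoints x j := by
  simp [freePoints]

theorem q_notMem_freePoints (X : EllipticChain K g) {n : ℕ} (x : Sym X.Pt n) (j : Fin g) :
    X.q j ∉ X.freePoints x j := by
  simp [freePoints]

theorem multisetDivisor_p {n : ℕ} (x : Sym X.Pt n) (j : Fin g) :
    multisetDivisor (X.inducedPoints x j) (X.p j) = X.leftCount x j := by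
  classical
  rw [multisetDivisor_apply, leftCount]

theorem multisetDivisor_q {n : ℕ} (x : Sym X.Pt n) (j : Fin g) :
    multisetDivisor (X.inducedPoints x j) (X.q j) = X.rightCount x j := by
  classical
  rw [multisetDivisor_apply, rightCount]

end EllipticChain

/-! ### The combinatorial type of an inclusion -/

variable [IsAlgClosed K]

/-- The subspace of sections on the `j`-th component with given vanishing indices and base
points. -/
def boxSpace {s : ℕ} {m : ℤ} (V : LimitLinearSeries X s m) {n : ℕ} (x : Sym X.Pt n) (j : Fin g)
    (l k : ℕ) : Submodule K (X.curve j).FunctionField :=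
  vanishingSpace (V.div j) (V.space j) (X.p j) (X.q j) (chainLeft s j l) (chainRight s m j k)
    (multisetDivisor (X.freePoints x j))

/-- The vanishing indices of the aspects of an inclusion. -/
theorem Inclusion.exists_indices {s : ℕ} {m : ℤ} {V : LimitLinearSeries X s m}
    (hV : HasChainAspects V) {r n : ℕ} (I : Inclusion V r n) :
    ∃ S T : Fin g → Fin (r + 1) → ℕ, (∀ j, StrictMono (S j)) ∧ (∀ j, StrictMono (T j)) ∧
      (∀ j e, S j e ≤ s) ∧ (∀ j e, T j e ≤ s) ∧
      (∀ (j : Fin g) (e : Fin (r + 1)), chainLeft s j (S j e) =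
        vanishingSeq (I.series.div j) (I.series.space j) (X.p j) e + X.leftCount I.base j) ∧
      (∀ (j : Fin g) (e : Fin (r + 1)), chainRight s m j (T j e) =
        vanishingSeq (I.series.div j) (I.series.space j) (X.q j) (r - e) +
          X.rightCount I.base j) ∧
      ∀ j e, ∃ f ∈ I.series.space j, f ≠ 0 ∧ f ∈ boxSpace V I.base j (S j e) (T j e) := by
  have h : ∀ j, _ := fun j => (hV j).exists_indices (I.space_le j) (I.series.finrank_eq j)
    (M := X.inducedPoints I.base j)
    (by rw [← X.inducedDivisor_eq, ← I.div_eq]; exact I.series.isSection j)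
  choose S T hS hT hSs hTs h1 h2 h3 using h
  refine ⟨S, T, hS, hT, hSs, hTs, fun j e => ?_, fun j e => ?_, fun j e => ?_⟩
  · have := h1 j e
    rw [← X.inducedDivisor_eq, ← I.div_eq, X.inducedDivisor_eq, X.multisetDivisor_p] at this
    exact this
  · have := h2 j e
    rw [← X.inducedDivisor_eq, ← I.div_eq, X.inducedDivisor_eq, X.multisetDivisor_q] at this
    exact this
  · exact h3 j e

theorem HasChainAspects.card_freePoints_le {s : ℕ} {m : ℤ} {V : LimitLinearSeries X s m}
    (hV : HasChainAspects V) {n : ℕ} {x : Sym X.Pt n} {j : Fin g} {l k : ℕ}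
    {f : (X.curve j).FunctionField} (hf : f ≠ 0) (hfx : f ∈ boxSpace V x j l k) :
    ((X.freePoints x j).card : ℤ) ≤ k - l + (if l < j % (s + 1) then 1 else 0) +
      (if j % (s + 1) < k then 1 else 0) :=
  (hV j).card_le hf (X.p_notMem_freePoints x j) (X.q_notMem_freePoints x j) hfx

theorem HasChainAspects.eq_of_card_eq {s : ℕ} {m : ℤ} {V : LimitLinearSeries X s m}
    (hV : HasChainAspects V) {n : ℕ} {x : Sym X.Pt n} {j : Fin g} {l k l' k' : ℕ}
    {f f' : (X.curve j).FunctionField} (hf : f ≠ 0) (hfx : f ∈ boxSpace V x j l k)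
    (hf' : f' ≠ 0) (hfx' : f' ∈ boxSpace V x j l' k')
    (hc : ((X.freePoints x j).card : ℤ) = k - l + (if l < j % (s + 1) then 1 else 0) +
      (if j % (s + 1) < k then 1 else 0))
    (hc' : ((X.freePoints x j).card : ℤ) = k' - l' + (if l' < j % (s + 1) then 1 else 0) +
      (if j % (s + 1) < k' then 1 else 0)) : l = l' :=
  (hV j).eq_of_card_eq hf hf' (X.p_notMem_freePoints x j) (X.q_notMem_freePoints x j) hfx hfx'
    hc hc'

/-- The vanishing indices of an inclusion form a tight chain. -/
theorem Inclusion.exists_indexChain [NeZero g] {t u : ℕ} {m : ℤ}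
    {V : LimitLinearSeries X (2 * t) m}
    (hV : HasChainAspects V) (hg : g = (2 * t + 1) * u) (hm : m = (2 * t : ℕ) * (u + 1))
    (I : Inclusion V t (t + 1)) :
    ∃ S T : Fin g → Fin (t + 1) → ℕ,
      IndexChain t g (fun j => S (Fin.ofNat g j)) (fun j => T (Fin.ofNat g j))
        (fun j => (X.freePoints I.base (Fin.ofNat g j)).card)
        (fun j => X.leftCount I.base (Fin.ofNat g j))
        (fun j => X.rightCount I.base (Fin.ofNat g j)) ∧
      ∀ j e, ∃ f ∈ I.series.space j, f ≠ 0 ∧ f ∈ boxSpace V I.base j (S j e) (T j e) := by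
  obtain ⟨S, T, hS, hT, hSs, hTs, hSv, hTv, hf⟩ := I.exists_indices hV
  have hidx : ∀ j : ℕ, j < g → ((Fin.ofNat g j : Fin g) : ℕ) = j := fun j hj =>
    Nat.mod_eq_of_lt hj
  have hg0 : 0 < g := Nat.pos_of_ne_zero (NeZero.ne g)
  have hle : ∀ j e, S j e ≤ T j e := by
    intro j e
    obtain ⟨f, -, hf0, hfx⟩ := hf j e
    exact (hV j).le_of_mem hf0 hfx
  -- The included series has degree `m - (t + 1)`. In terms of the orders of `V`, the excess of the
  -- two counts over `t + 1`, which is the number of base points at the node, is a jump that the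
  -- indices must make there.
  have hnode : ∀ j, j + 1 < g → ∀ e,
      chainLeft (2 * t) (j + 1) (T (Fin.ofNat g j) e) + X.leftCount I.base (Fin.ofNat g (j + 1)) +
        X.rightCount I.base (Fin.ofNat g j) ≤
      chainLeft (2 * t) (j + 1) (S (Fin.ofNat g (j + 1)) e) + (t + 1) := by
    intro j hj e
    have h1 := I.series.compatible (Fin.ofNat g j) (Fin.ofNat g (j + 1))
      (by rw [hidx _ hj, hidx j (by omega)]) e (Nat.lt_succ_iff.1 e.2)
    have h2 := hTv (Fin.ofNat g j) e
    have h3 := hSv (Fin.ofNat g (j + 1)) e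
    rw [hidx _ hj] at h3
    rw [hidx j (by omega), chainRight_eq m j (hTs _ _)] at h2
    push_cast at h1
    omega
  refine ⟨S, T, ⟨fun j _ => hT _, fun j _ => X.leftCount_add _ _, fun j hj => ?_, fun e => ?_,
    fun e => ?_, fun j hj h1 => ?_, fun j hj h2 => ?_, fun j _ => hle _, fun j hj e => ?_,
    fun j hj N hN1 hN => ?_⟩, hf⟩
  · refine X.le_leftCount_add_rightCount _ ?_
    rw [Fin.lt_def, hidx _ hj, hidx j (by omega)]
    omega
  · have h1 := hSv (Fin.ofNat g 0) e
    rw [hidx 0 hg0, chainLeft_zero] at h1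
    have h2 := le_vanishingSeq (I.series.finrank_eq (Fin.ofNat g 0))
      (I.series.isSection (Fin.ofNat g 0)) (X.p (Fin.ofNat g 0)) (Nat.lt_succ_iff.1 e.2)
    omega
  · have h1 := hTv (Fin.ofNat g (g - 1)) e
    have h3 : chainLeft (2 * t) g (T (Fin.ofNat g (g - 1)) e) =
        T (Fin.ofNat g (g - 1)) e + (2 * t : ℕ) * u := by
      generalize T (Fin.ofNat g (g - 1)) e = i
      rw [hg, chainLeft_mul]
    rw [hidx _ (by omega), chainRight_eq m _ (hTs _ _), Nat.sub_add_cancel hg0, h3] at h1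
    have h2 := le_vanishingSeq (I.series.finrank_eq (Fin.ofNat g (g - 1)))
      (I.series.isSection (Fin.ofNat g (g - 1))) (X.q (Fin.ofNat g (g - 1))) (Nat.sub_le t e)
    have h4 := Nat.lt_succ_iff.1 e.2
    rw [mul_add, mul_one] at hm
    generalize ((2 * t : ℕ) : ℤ) * u = z at hm h1
    omega
  · refine le_sum_sub_of_one (w := Fin.ofNat g j % (2 * t + 1)) (fun e => ?_) (fun e e' => ?_)
      (hle _)
    · obtain ⟨f, -, hf0, hfx⟩ := hf (Fin.ofNat g j) e
      have := hV.card_freePoints_le hf0 hfx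
      rwa [h1] at this
    · obtain ⟨f, -, hf0, hfx⟩ := hf (Fin.ofNat g j) e
      obtain ⟨f', -, hf0', hfx'⟩ := hf (Fin.ofNat g j) e'
      intro he he'
      exact (hS _).injective (hV.eq_of_card_eq hf0 hfx hf0' hfx' (by rw [h1]; exact he)
        (by rw [h1]; exact he'))
  · refine mul_lt_sum_sub_of_two_le (w := Fin.ofNat g j % (2 * t + 1)) (hS _).injective
      (fun e => ?_) (fun e e' => ?_) (hle _) h2
    · obtain ⟨f, -, hf0, hfx⟩ := hf (Fin.ofNat g j) e
      exact hV.card_freePoints_le hf0 hfx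
    · obtain ⟨f, -, hf0, hfx⟩ := hf (Fin.ofNat g j) e
      obtain ⟨f', -, hf0', hfx'⟩ := hf (Fin.ofNat g j) e'
      intro he he'
      exact (hS _).injective (hV.eq_of_card_eq hf0 hfx hf0' hfx' he he')
  · have h1 := hnode j hj e
    have h2 : t + 1 ≤ X.leftCount I.base (Fin.ofNat g (j + 1)) +
        X.rightCount I.base (Fin.ofNat g j) := X.le_leftCount_add_rightCount _ (by
      rw [Fin.lt_def, hidx _ hj, hidx j (by omega)]; omega)
    exact (leftOrd_strictMono _ _).le_iff_le.1
      (show chainLeft (2 * t) (j + 1) _ ≤ chainLeft (2 * t) (j + 1) _ by omega)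
  · refine mul_lt_sum_sub_of_leftOrd (w := (j + 1) % (2 * t + 1))
      (A := ((j + 1 : ℕ) : ℤ) - ((j + 1) / (2 * t + 1) : ℕ)) (hT _).injective hN1 fun e => ?_
    have h1 := hnode j hj e
    change chainLeft (2 * t) (j + 1) _ + _ ≤ chainLeft (2 * t) (j + 1) _
    omega

end Chain

/-! ### One base point on an aspect -/

theorem indexState_strictMono (n : ℕ) : StrictMono (indexState n) := by
  intro e e' h
  unfold indexState
  split_ifs <;> omega

theorem indexState_self (n : ℕ) : indexState n n = 2 * n := by
  rw [indexState, if_neg (lt_irrefl _)]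
  omega

theorem indexState_succ_self (n : ℕ) : indexState (n + 1) n = 2 * n := by
  rw [indexState, if_pos (Nat.lt_succ_self _)]
  omega

theorem indexState_succ_of_ne {n e : ℕ} (h : e ≠ n) :
    indexState (n + 1) e = indexState n e + 1 ∧ indexState n e ≠ 2 * n ∧
      indexState n e + 1 ≠ 2 * n := by
  unfold indexState
  split_ifs <;> omega

theorem indexState_le {t n e : ℕ} (hn : n ≤ t + 1) (he : e ≤ t) : indexState n e ≤ 2 * t := by
  unfold indexState
  split_ifs <;> omega

namespace WeierstrassCurve.Affine.IsAspect

variable {K : Type*} [Field K] {W : WeierstrassCurve.Affine K}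
  [DecidableEq K] [IsAlgClosed K] [W.IsElliptic] {D : W.Point →₀ ℤ}
  {V : Submodule K W.FunctionField} {p q : W.Point} {s : ℕ} {m A : ℤ} {w : ℕ}

theorem exists_exact_section (h : IsAspect D V p q s m A w) {i : ℕ} (hi : i ≤ s) :
    ∃ f ∈ vanishingSpace D V p q (leftOrd A w i) (rightOrd m A w i) (multisetDivisor 0), f ≠ 0 ∧
      sectionOrd D p f = leftOrd A w i ∧ sectionOrd D q f = rightOrd m A w i := by
  obtain ⟨f, hf, hf0⟩ := h.exists_mem_vanishingSpace hi
  obtain ⟨l, k, h1, h2, h3, h4, h5⟩ := h.exists_orders hf0 hf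
  obtain rfl : l = i := by omega
  obtain rfl : k = l := by omega
  exact ⟨f, hf, hf0, h4, h5⟩

theorem eq_zero_of_lt (h : IsAspect D V p q s m A w) {l k : ℕ} (hlk : k < l) {E : W.Point →₀ ℤ}
    {f : W.FunctionField}
    (hf : f ∈ vanishingSpace D V p q (leftOrd A w l) (rightOrd m A w k) E) : f = 0 := by
  by_contra hf0
  exact hlk.not_ge (h.le_of_mem hf0 hf)

theorem eq_zero_of_extraZero (h : IsAspect D V p q s m A w) {i l : ℕ} (hi : i ≤ s) (hiw : i ≠ w)
    (hil : l ≠ i) {f : W.FunctionField}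
    (hf : f ∈ vanishingSpace D V p q (leftOrd A w l) (rightOrd m A w l)
      (multisetDivisor {extraZero D p q m A w i})) : f = 0 := by
  by_contra hf0
  obtain ⟨hp, hq, -⟩ := h.extraZero_spec hi hiw
  obtain ⟨h1, h2⟩ := h.eq_extraZero hf0 hp hq hf
  exact hil (h.extraZero_injective h1 hiw h2.symm)

/-- For the stationary index the raised left index exceeds the right one. For any other index both
agree, at a value different from `2 n`, and the section of that index does not vanish at the extra
zero belonging to `2 n`. -/
theorem eq_zero_of_step (h : IsAspect D V p q s m A w) {n : ℕ} (hn : 2 * n ≤ s)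
    (hnw : 2 * n ≠ w) (e : ℕ) {f : W.FunctionField}
    (hf : f ∈ vanishingSpace D V p q (leftOrd A w (indexState n e + 1))
      (rightOrd m A w (indexState (n + 1) e)) (multisetDivisor {extraZero D p q m A w (2 * n)})) :
    f = 0 := by
  by_cases he : e = n
  · subst he
    rw [indexState_self, indexState_succ_self] at hf
    exact h.eq_zero_of_lt (Nat.lt_succ_self _) hf
  · obtain ⟨h1, -, h2⟩ := indexState_succ_of_ne he
    rw [h1] at hf
    exact h.eq_zero_of_extraZero hn hnw h2 hf

/-- The stationary index takes the section of index `2 n`, which vanishes at its extra zero. Every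
other index takes a member of the pencil on two consecutive sections, neither of index `2 n`. The
orders are exact, since no single section of another index vanishes at that point. -/
theorem exists_step_section (h : IsAspect D V p q s m A w) {t n e : ℕ} (hs : s = 2 * t)
    (hn : n ≤ t) (hnw : 2 * n ≠ w) (he : e ≤ t) :
    ∃ f ∈ vanishingSpace D V p q (leftOrd A w (indexState n e))
      (rightOrd m A w (indexState (n + 1) e)) (multisetDivisor {extraZero D p q m A w (2 * n)}),
      f ≠ 0 ∧ sectionOrd D p f = leftOrd A w (indexState n e) ∧
      sectionOrd D q f = rightOrd m A w (indexState (n + 1) e) := by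
  have hn' : 2 * n ≤ s := by omega
  obtain ⟨hp, hq, hz⟩ := h.extraZero_spec hn' hnw
  by_cases hen : e = n
  · subst hen
    rw [indexState_self, indexState_succ_self]
    obtain ⟨f, hf, hf0⟩ := hz
    obtain ⟨l, k, h1, h2, h3, h4, h5⟩ := h.exists_orders hf0 hf
    obtain rfl : l = 2 * e := by omega
    obtain rfl : k = 2 * e := by omega
    exact ⟨f, hf, hf0, h4, h5⟩
  · obtain ⟨h1, h2, h3⟩ := indexState_succ_of_ne hen
    have hle := indexState_le (Nat.succ_le_succ hn) he
    rw [h1] at hle ⊢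
    obtain ⟨f, hf, hf0⟩ := h.exists_pencil_section (l := indexState n e) (by omega) hp hq
      (by
        rintro i (rfl | rfl) hiw hz
        · exact h2 (h.extraZero_injective hnw hiw hz).symm
        · exact h3 (h.extraZero_injective hnw hiw hz).symm)
    obtain ⟨l, k, hl, hlk, hk, hlp, hkq⟩ := h.exists_orders hf0 hf
    have hmem := (mem_vanishingSpace hf0).1 hf
    have hf' := (mem_vanishingSpace hf0).2 ⟨hmem.1, hlp.ge, hkq.ge, hmem.2.2.2⟩
    have hne : ∀ i, i ≠ 2 * n → ¬ (l = i ∧ k = i) := by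
      rintro i hi ⟨rfl, rfl⟩
      exact hf0 (h.eq_zero_of_extraZero hn' hnw hi hf')
    have h4 := hne _ h2
    have h5 := hne _ h3
    obtain rfl : l = indexState n e := by omega
    obtain rfl : k = indexState n e + 1 := by omega
    exact ⟨f, hf, hf0, hlp, hkq⟩

end WeierstrassCurve.Affine.IsAspect

/-! ### An inclusion is determined by its base points -/

section Chain

variable {K : Type*} [Field K] [DecidableEq K] {g : ℕ} {X : EllipticChain K g}

/-- The extra zero of the section of the `j`-th aspect with the `i`-th vanishing orders. -/
def chainZero {s : ℕ} {m : ℤ} (V : LimitLinearSeries X s m) (j : Fin g) (i : ℕ) :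
    (X.curve j).Point :=
  IsAspect.extraZero (V.div j) (X.p j) (X.q j) m ((j : ℤ) - ((j : ℕ) / (s + 1) : ℕ))
    (j % (s + 1)) i

variable [IsAlgClosed K]

/-- The shape of the base points of an inclusion, and the vanishing indices of its aspects. -/
structure Inclusion.Shape {t : ℕ} {m : ℤ} {V : LimitLinearSeries X (2 * t) m}
    (I : Inclusion V t (t + 1)) : Prop where
  exists_section : ∀ (j : Fin g) (e : Fin (t + 1)), ∃ f ∈ I.series.space j, f ≠ 0 ∧
    f ∈ boxSpace V I.base j (indexState (X.leftCount I.base j) e)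
      (indexState (X.leftCount I.base j + (X.freePoints I.base j).card) e)
  card_le : ∀ j, (X.freePoints I.base j).card ≤ 1
  first : ∀ j : Fin g, (j : ℕ) = 0 → X.leftCount I.base j = 0
  succ : ∀ i j : Fin g, (i : ℕ) + 1 = j →
    X.leftCount I.base j = X.leftCount I.base i + (X.freePoints I.base i).card
  last : ∀ j : Fin g, (j : ℕ) + 1 = g →
    X.leftCount I.base j + (X.freePoints I.base j).card = t + 1

theorem Inclusion.shape {t u : ℕ} {m : ℤ} {V : LimitLinearSeries X (2 * t) m}
    (hV : HasChainAspects V) (hg : g = (2 * t + 1) * u) (hm : m = (2 * t : ℕ) * (u + 1))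
    (I : Inclusion V t (t + 1)) : I.Shape := by
  rcases Nat.eq_zero_or_pos g with h0 | h0
  · exact ⟨fun j => by have := j.2; omega, fun j => by have := j.2; omega,
      fun j => by have := j.2; omega, fun j => by have := j.2; omega,
      fun j => by have := j.2; omega⟩
  have : NeZero g := ⟨h0.ne'⟩
  obtain ⟨S, T, hc, hf⟩ := I.exists_indexChain hV hg hm
  have hidx : ∀ j : Fin g, Fin.ofNat g (j : ℕ) = j := fun j => Fin.ext (Nat.mod_eq_of_lt j.2)
  have hleft : ∀ j : Fin g, X.leftCount I.base (Fin.ofNat g (j : ℕ)) = X.leftCount I.base j :=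
    fun j => by rw [hidx j]
  have hfree : ∀ j : Fin g,
      (X.freePoints I.base (Fin.ofNat g (j : ℕ))).card = (X.freePoints I.base j).card :=
    fun j => by rw [hidx j]
  refine ⟨fun j e => ?_, fun j => ?_, fun j hj => ?_, fun i j hij => ?_, fun j hj => ?_⟩
  · have h1 := hc.left_eq j.2 e
    have h2 := hc.right_eq j.2 e
    simp only [hfree, hidx] at h1 h2
    rw [← h1, ← h2]
    exact hf j e
  · have h1 := hc.le_one j.2
    simp only [hfree] at h1
    exact h1
  · have h1 := (hc.equalities j.2).1
    rwa [show Fin.ofNat g 0 = j by rw [← hidx j, hj]] at h1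
  · have h1 := hc.nP_succ (j := i) (by omega)
    simp only [hij, hleft, hfree] at h1
    exact h1
  · have h1 := (hc.equalities j.2).2.1
    rw [show Fin.ofNat g (g - 1) = j by rw [← hidx j]; congr 1; omega] at h1
    have h2 := X.leftCount_add I.base j
    omega

/-- The stationary section has index `2 * leftCount` at both marked points. Only one zero is left
for it, and none if this index is the letter. -/
theorem Inclusion.Shape.freePoints_eq {t : ℕ} {m : ℤ} {V : LimitLinearSeries X (2 * t) m}
    (hV : HasChainAspects V) {I : Inclusion V t (t + 1)} (hI : I.Shape) {j : Fin g}
    (hj : (X.freePoints I.base j).card = 1) :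
    X.leftCount I.base j ≤ t ∧ 2 * X.leftCount I.base j ≠ j % (2 * t + 1) ∧
      X.freePoints I.base j = {chainZero V j (2 * X.leftCount I.base j)} := by
  have h1 := X.leftCount_add I.base j
  have hle : X.leftCount I.base j ≤ t := by omega
  obtain ⟨f, -, hf0, hf⟩ := hI.exists_section j ⟨X.leftCount I.base j, by omega⟩
  rw [hj, indexState_self, indexState_succ_self, boxSpace] at hf
  obtain ⟨x, hx⟩ := Multiset.card_eq_one.1 hj
  have hp := X.p_notMem_freePoints I.base j
  have hq := X.q_notMem_freePoints I.base j
  rw [hx] at hf hp hq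
  obtain ⟨h2, h3⟩ := (hV j).eq_extraZero hf0 (by rintro rfl; simp at hp)
    (by rintro rfl; simp at hq) hf
  exact ⟨hle, h2, hx.trans (by rw [h3]; rfl)⟩

theorem Inclusion.Shape.eq_zero {t : ℕ} {m : ℤ} {V : LimitLinearSeries X (2 * t) m}
    (hV : HasChainAspects V) {I : Inclusion V t (t + 1)} (hI : I.Shape) (j : Fin g) (e : ℕ)
    {f : (X.curve j).FunctionField}
    (hf : f ∈ boxSpace V I.base j (indexState (X.leftCount I.base j) e + 1)
      (indexState (X.leftCount I.base j + (X.freePoints I.base j).card) e)) : f = 0 := by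
  rcases (show (X.freePoints I.base j).card = 0 ∨ (X.freePoints I.base j).card = 1 by
    have := hI.card_le j; omega) with h0 | h1
  · rw [h0, add_zero] at hf
    exact (hV j).eq_zero_of_lt (Nat.lt_succ_self _) hf
  · obtain ⟨h2, h3, h4⟩ := hI.freePoints_eq hV h1
    rw [h1, boxSpace, h4] at hf
    exact (hV j).eq_zero_of_step (by omega) h3 e hf

/-- The base points determine all vanishing indices, and the sections with given indices and base
points form at most a line. -/
theorem Inclusion.eq_of_base_eq {t u : ℕ} {m : ℤ} {V : LimitLinearSeries X (2 * t) m}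
    (hV : HasChainAspects V) (hg : g = (2 * t + 1) * u) (hm : m = (2 * t : ℕ) * (u + 1))
    {I I' : Inclusion V t (t + 1)} (h : I.base = I'.base) : I = I' := by
  have key : ∀ I I' : Inclusion V t (t + 1), I.base = I'.base →
      ∀ j, I'.series.space j ≤ I.series.space j := by
    intro I I' h j
    have hI := I.shape hV hg hm
    have hI' := I'.shape hV hg hm
    refine (hV j).space_le_of_families (I'.series.finrank_eq j)
      (S := fun e : Fin (t + 1) => indexState (X.leftCount I.base j) e)
      (T := fun e : Fin (t + 1) =>
        indexState (X.leftCount I.base j + (X.freePoints I.base j).card) e)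
      ((indexState_strictMono _).injective.comp Fin.val_injective)
      (fun e f hf => hI.eq_zero hV j e hf) (hI.exists_section j) fun e => ?_
    have := hI'.exists_section j e
    rw [← h] at this
    exact this
  have h1 : I.series = I'.series := by
    refine LimitLinearSeries.ext (funext fun j => ?_) (funext fun j => ?_)
    · rw [I.div_eq, I'.div_eq, h]
    · exact le_antisymm (key I' I h.symm j) (key I I' h j)
  cases I
  cases I'
  simp only at h h1
  subst h h1
  rfl

end Chain

/-! ### Placements of base points -/

/-- Admissible positions `P 0 < P 1 < ⋯` of base points on the chain: the `i`-th base point does not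
lie on a component with letter `2 i`. -/
def IsPlacement (s : ℕ) {n g : ℕ} (P : Fin n → Fin g) : Prop :=
  StrictMono P ∧ ∀ i, (P i : ℕ) % (s + 1) ≠ 2 * (i : ℕ)

/-- The number of base points on the components before the `j`-th one. -/
def placedCount {n g : ℕ} (P : Fin n → Fin g) (j : ℕ) : ℕ :=
  (Finset.univ.filter fun i => (P i : ℕ) < j).card

theorem placedCount_le {n g : ℕ} (P : Fin n → Fin g) (j : ℕ) : placedCount P j ≤ n :=
  (Finset.card_le_univ _).trans (Fintype.card_fin n).le

theorem placedCount_apply {n g : ℕ} {P : Fin n → Fin g} (hP : StrictMono P) (i : Fin n) :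
    placedCount P (P i) = i := by
  have : (Finset.univ.filter fun k => (P k : ℕ) < P i) = Finset.Iio i := by
    ext k
    simp [hP.lt_iff_lt]
  rw [placedCount, this, Fin.card_Iio]

theorem placedCount_succ {n g : ℕ} (P : Fin n → Fin g) (j : ℕ) :
    placedCount P (j + 1) =
      placedCount P j + (Finset.univ.filter fun i => (P i : ℕ) = j).card := by
  rw [placedCount, placedCount, ← Finset.card_union_of_disjoint]
  · congr 1
    ext k
    simp only [Finset.mem_filter, Finset.mem_univ, true_and, Finset.mem_union]
    omega
  · rw [Finset.disjoint_filter]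
    intro k _ h1 h2
    omega

theorem card_filter_eq_one {n g : ℕ} {P : Fin n → Fin g} (hP : StrictMono P) (i : Fin n) :
    (Finset.univ.filter fun k => (P k : ℕ) = P i).card = 1 := by
  rw [Finset.card_eq_one]
  refine ⟨i, ?_⟩
  ext k
  simp [← Fin.ext_iff, hP.injective.eq_iff]

theorem exists_le_of_placedCount_pos {n g : ℕ} {P : Fin (n + 1) → Fin g} (hP : StrictMono P) {j : ℕ}
    (h : 0 < placedCount P j) : (P 0 : ℕ) < j := by
  obtain ⟨i, hi⟩ := Finset.card_pos.1 h
  rw [Finset.mem_filter] at hi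
  exact lt_of_le_of_lt (hP.monotone (Fin.zero_le i)) hi.2

theorem le_last_of_placedCount_lt {n g : ℕ} {P : Fin (n + 1) → Fin g} (hP : StrictMono P) {j : ℕ}
    (h : placedCount P j ≤ n) : j ≤ P (Fin.last n) := by
  by_contra! hj
  have : (Finset.univ.filter fun i => (P i : ℕ) < j) = Finset.univ := by
    refine Finset.filter_true_of_mem fun i _ => ?_
    exact lt_of_le_of_lt (hP.monotone (Fin.le_last i)) hj
  rw [placedCount, this, Finset.card_univ, Fintype.card_fin] at h
  omega

/-- The base points at the left marked point fit into the vanishing orders. -/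
theorem placedCount_le_chainLeft {t n g : ℕ} {P : Fin (n + 1) → Fin g} (ht : 1 ≤ t)
    (hP : IsPlacement (2 * t) P) (j e : ℕ) :
    (placedCount P j : ℤ) ≤ chainLeft (2 * t) j (indexState (placedCount P j) e) := by
  rcases Nat.eq_zero_or_pos (placedCount P j) with h | h
  · rw [h]
    unfold chainLeft leftOrd indexState
    have := Nat.div_le_self j (2 * t + 1)
    have h1 := Nat.div_add_mod j (2 * t + 1)
    have h2 : j / (2 * t + 1) ≤ 2 * t * (j / (2 * t + 1)) := Nat.le_mul_of_pos_left _ (by omega)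
    rw [add_mul, one_mul] at h1
    generalize j / (2 * t + 1) = c at *
    generalize j % (2 * t + 1) = w at *
    split_ifs <;> omega
  · have h0 := exists_le_of_placedCount_pos hP.1 h
    have h3 := hP.2 0
    rw [Fin.val_zero, mul_zero] at h3
    have h1 := Nat.div_add_mod j (2 * t + 1)
    have h2 := Nat.div_add_mod (P 0 : ℕ) (2 * t + 1)
    have h4 : 2 * (j / (2 * t + 1)) ≤ 2 * t * (j / (2 * t + 1)) := by gcongr; omega
    -- The first base point avoids letter 0, in particular the first component, and it lies before
    -- the `j`-th component.
    have h5 : 2 ≤ j := by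
      by_contra! h6
      exact h3 (by rw [show (P 0 : ℕ) = 0 by omega, Nat.zero_mod])
    rw [add_mul, one_mul] at h1
    have h6 : placedCount P j ≤ indexState (placedCount P j) e + 1 := by
      unfold indexState
      split_ifs <;> omega
    unfold chainLeft leftOrd
    generalize j / (2 * t + 1) = c at *
    generalize j % (2 * t + 1) = w at *
    rcases Nat.eq_zero_or_pos c with rfl | h7
    · split_ifs <;> omega
    · split_ifs <;> omega

/-- The base points at the right marked point fit into the vanishing orders. -/
theorem chainLeft_add_le {t u g : ℕ} {P : Fin (t + 1) → Fin g} (ht : 1 ≤ t)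
    (hg : g = (2 * t + 1) * u) (hP : IsPlacement (2 * t) P) {j e : ℕ} (hj : j ≤ g) (he : e ≤ t) :
    chainLeft (2 * t) j (indexState (placedCount P j) e) + (t + 1 : ℕ) ≤
      (2 * t : ℕ) * (u + 1) + placedCount P j := by
  have hle := indexState_le (placedCount_le P j) he
  have hle' : indexState (placedCount P j) e ≤ e + placedCount P j := by
    unfold indexState
    split_ifs <;> omega
  have h1 := Nat.div_add_mod j (2 * t + 1)
  have h2 := Nat.mod_lt j (Nat.succ_pos (2 * t))
  obtain ⟨c, hc⟩ : ∃ c, c = j / (2 * t + 1) := ⟨_, rfl⟩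
  obtain ⟨w, hw⟩ : ∃ w, w = j % (2 * t + 1) := ⟨_, rfl⟩
  unfold chainLeft leftOrd
  rw [← hc, ← hw] at h1 ⊢
  rw [← hw] at h2
  have h3 : (2 * t + 1) * c = 2 * t * c + c := by ring
  have hcu : c ≤ u := by
    by_contra! h
    have : (2 * t + 1) * (u + 1) ≤ (2 * t + 1) * c := Nat.mul_le_mul_left _ h
    rw [mul_add] at this
    omega
  have h4 : ((2 * t : ℕ) : ℤ) * (u + 1) = ((2 * t * u : ℕ) : ℤ) + 2 * t := by push_cast; ring
  rw [h4]
  -- Here `v` is the number of blocks of the word not completed before the `j`-th component.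
  obtain ⟨v, rfl⟩ := Nat.exists_eq_add_of_le hcu
  have h5 : 2 * t * (c + v) = 2 * t * c + 2 * t * v := by ring
  have h6 : (2 * t + 1) * (c + v) = 2 * t * c + c + 2 * t * v + v := by ring
  rw [h5]
  rw [h6] at hg
  rw [h3] at h1
  rcases Nat.lt_or_ge (placedCount P j) (t + 1) with hlt | hge
  · have h7 := le_last_of_placedCount_lt hP.1 (Nat.lt_succ_iff.1 hlt)
    have h8 := (P (Fin.last t)).2
    have h9 := hP.2 (Fin.last t)
    rw [Fin.val_last] at h9
    rcases v with _ | _ | v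
    · omega
    -- In the last block, the final base point still to come avoids letter `2 t`, hence the last
    -- component of the chain. This excludes `w = 2 t`.
    · have h10 : (P (Fin.last t) : ℕ) = (2 * t + 1) * c + (P (Fin.last t) - (2 * t * c + c)) := by
        omega
      rw [h10, Nat.mul_add_mod, Nat.mod_eq_of_lt (by omega)] at h9
      split_ifs <;> omega
    · have h11 : 2 * t * (v + 1 + 1) = 2 * t * v + 2 * (2 * t) := by ring
      rw [h11]
      split_ifs <;> omega
  · rcases v with _ | v
    · split_ifs <;> omega
    · have h11 : 2 * t * (v + 1) = 2 * t * v + 2 * t := by ring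
      rw [h11]
      split_ifs <;> omega

/-! ### From placements to inclusions -/

section Chain

variable {K : Type*} [Field K] [DecidableEq K] {g : ℕ} {X : EllipticChain K g}

/-- The `i`-th base point of a placement. -/
def placedPoint {s : ℕ} {m : ℤ} (V : LimitLinearSeries X s m) {n : ℕ} (P : Fin n → Fin g)
    (i : Fin n) : X.Pt :=
  Quot.mk _ ⟨P i, chainZero V (P i) (2 * i)⟩

/-- The base points of a placement. -/
def placedBase {s : ℕ} {m : ℤ} (V : LimitLinearSeries X s m) {n : ℕ} (P : Fin n → Fin g) :
    Sym X.Pt n :=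
  ⟨Finset.univ.val.map (placedPoint V P), by simp⟩

variable [IsAlgClosed K] {t : ℕ} {m : ℤ} {V : LimitLinearSeries X (2 * t) m}
  {P : Fin (t + 1) → Fin g}

theorem HasChainAspects.chainZero_ne (hV : HasChainAspects V) {j : Fin g} {i : ℕ}
    (hi : i ≤ 2 * t) (hij : i ≠ j % (2 * t + 1)) :
    chainZero V j i ≠ X.p j ∧ chainZero V j i ≠ X.q j :=
  ⟨((hV j).extraZero_spec hi hij).1, ((hV j).extraZero_spec hi hij).2.1⟩

theorem HasChainAspects.chainZero_placement_ne (hV : HasChainAspects V)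
    (hP : IsPlacement (2 * t) P) (i : Fin (t + 1)) :
    chainZero V (P i) (2 * i) ≠ X.p (P i) ∧ chainZero V (P i) (2 * i) ≠ X.q (P i) :=
  hV.chainZero_ne (by omega) (hP.2 i).symm

theorem retract_placedPoint_eq_p (hV : HasChainAspects V) (hP : IsPlacement (2 * t) P)
    (i : Fin (t + 1)) (j : Fin g) : X.retract j (placedPoint V P i) = X.p j ↔ P i < j := by
  unfold placedPoint
  refine ⟨fun h => ?_, fun h => X.retract_mk_of_lt _ h⟩
  by_contra! hj
  rcases hj.eq_or_lt with rfl | hj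
  · rw [X.retract_mk_self] at h
    exact (hV.chainZero_placement_ne hP i).1 h
  · rw [X.retract_mk_of_gt _ hj] at h
    exact X.p_ne_q j h.symm

theorem retract_placedPoint_eq_q (hV : HasChainAspects V) (hP : IsPlacement (2 * t) P)
    (i : Fin (t + 1)) (j : Fin g) : X.retract j (placedPoint V P i) = X.q j ↔ j < P i := by
  unfold placedPoint
  refine ⟨fun h => ?_, fun h => X.retract_mk_of_gt _ h⟩
  by_contra! hj
  rcases hj.eq_or_lt with rfl | hj
  · rw [X.retract_mk_self] at h
    exact (hV.chainZero_placement_ne hP i).2 h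
  · rw [X.retract_mk_of_lt _ hj] at h
    exact X.p_ne_q j h

theorem leftCount_placedBase (hV : HasChainAspects V) (hP : IsPlacement (2 * t) P) (j : Fin g) :
    X.leftCount (placedBase V P) j = placedCount P j := by
  unfold EllipticChain.leftCount EllipticChain.inducedPoints placedBase
  rw [Multiset.count_map, Sym.coe_mk, Multiset.filter_map, Multiset.card_map, placedCount,
    Finset.card, Finset.filter_val]
  congr 1
  refine Multiset.filter_congr fun i _ => ?_
  exact eq_comm.trans (retract_placedPoint_eq_p hV hP i j)

theorem card_freePoints_placedBase (hV : HasChainAspects V) (hP : IsPlacement (2 * t) P)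
    (j : Fin g) : (X.freePoints (placedBase V P) j).card =
      (Finset.univ.filter fun i => (P i : ℕ) = j).card := by
  unfold EllipticChain.freePoints EllipticChain.inducedPoints placedBase
  rw [Sym.coe_mk, Multiset.filter_map, Multiset.card_map, Multiset.filter_map, Multiset.card_map,
    Finset.card, Finset.filter_val]
  congr 1
  refine Multiset.filter_congr fun i _ => ?_
  have h1 := retract_placedPoint_eq_p hV hP i j
  have h2 := retract_placedPoint_eq_q hV hP i j
  simp only [Function.comp, ne_eq, h1, h2, Fin.lt_def]
  omega

theorem leftCount_placedBase_succ (hV : HasChainAspects V) (hP : IsPlacement (2 * t) P)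
    (j : Fin g) : placedCount P (j + 1) =
      X.leftCount (placedBase V P) j + (X.freePoints (placedBase V P) j).card := by
  rw [placedCount_succ, leftCount_placedBase hV hP, card_freePoints_placedBase hV hP]

theorem rightCount_placedBase (hV : HasChainAspects V) (hP : IsPlacement (2 * t) P)
    (j : Fin g) : X.rightCount (placedBase V P) j + placedCount P (j + 1) = t + 1 := by
  have h1 := X.leftCount_add (placedBase V P) j
  have h2 := leftCount_placedBase_succ hV hP j
  omega

theorem freePoints_placedBase_apply (hV : HasChainAspects V) (hP : IsPlacement (2 * t) P)
    (i : Fin (t + 1)) :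
    X.freePoints (placedBase V P) (P i) = {chainZero V (P i) (2 * i)} := by
  have h1 := card_freePoints_placedBase hV hP (P i)
  rw [card_filter_eq_one hP.1] at h1
  obtain ⟨x, hx⟩ := Multiset.card_eq_one.1 h1
  have h2 : chainZero V (P i) (2 * i) ∈ X.freePoints (placedBase V P) (P i) := by
    unfold EllipticChain.freePoints EllipticChain.inducedPoints placedBase
    rw [Sym.coe_mk, Multiset.mem_filter, Multiset.mem_map]
    refine ⟨⟨placedPoint V P i, Multiset.mem_map_of_mem _ (Finset.mem_univ i), ?_⟩,
      hV.chainZero_placement_ne hP i⟩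
    exact X.retract_mk_self _ _
  rw [hx, Multiset.mem_singleton] at h2
  rw [hx, h2]

theorem freePoints_placedBase_of_notMem (hV : HasChainAspects V) (hP : IsPlacement (2 * t) P)
    {j : Fin g} (hj : j ∉ Set.range P) : X.freePoints (placedBase V P) j = 0 := by
  rw [← Multiset.card_eq_zero, card_freePoints_placedBase hV hP, Finset.card_eq_zero,
    Finset.filter_eq_empty_iff]
  intro i _ h
  exact hj ⟨i, Fin.ext h⟩

theorem mem_range_iff_freePoints_ne_zero (hV : HasChainAspects V) (hP : IsPlacement (2 * t) P)
    (j : Fin g) : j ∈ Set.range P ↔ X.freePoints (placedBase V P) j ≠ 0 := by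
  refine ⟨?_, fun h => by_contra fun hj => h (freePoints_placedBase_of_notMem hV hP hj)⟩
  rintro ⟨i, rfl⟩
  rw [freePoints_placedBase_apply hV hP]
  exact Multiset.singleton_ne_zero _

theorem placedBase_injective (hV : HasChainAspects V) {P' : Fin (t + 1) → Fin g}
    (hP : IsPlacement (2 * t) P) (hP' : IsPlacement (2 * t) P')
    (h : placedBase V P = placedBase V P') : P = P' := by
  refine (StrictMono.range_inj hP.1 hP'.1).1 (Set.ext fun j => ?_)
  rw [mem_range_iff_freePoints_ne_zero hV hP, mem_range_iff_freePoints_ne_zero hV hP', h]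

/-- The sections on the components of a placement. -/
theorem exists_placed_section (hV : HasChainAspects V) (hP : IsPlacement (2 * t) P) (j : Fin g)
    {e : ℕ} (he : e ≤ t) :
    ∃ f ∈ boxSpace V (placedBase V P) j (indexState (placedCount P j) e)
        (indexState (placedCount P (j + 1)) e), f ≠ 0 ∧
      sectionOrd (V.div j) (X.p j) f = chainLeft (2 * t) j (indexState (placedCount P j) e) ∧
      sectionOrd (V.div j) (X.q j) f =
        chainRight (2 * t) m j (indexState (placedCount P (j + 1)) e) := by
  rw [leftCount_placedBase_succ hV hP, leftCount_placedBase hV hP]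
  unfold boxSpace
  by_cases hj : j ∈ Set.range P
  · obtain ⟨i, rfl⟩ := hj
    rw [freePoints_placedBase_apply hV hP, placedCount_apply hP.1, Multiset.card_singleton]
    exact (hV (P i)).exists_step_section rfl (by omega) (hP.2 i).symm he
  · rw [freePoints_placedBase_of_notMem hV hP hj, Multiset.card_zero, add_zero]
    exact (hV j).exists_exact_section (indexState_le (placedCount_le P j) he)

/-- Every placement comes from an inclusion. -/
theorem exists_inclusion_of_placement (hV : HasChainAspects V) {u : ℕ} (ht : 1 ≤ t)
    (hg : g = (2 * t + 1) * u) (hm : m = (2 * t : ℕ) * (u + 1)) (hP : IsPlacement (2 * t) P) :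
    ∃ I : Inclusion V t (t + 1), I.base = placedBase V P := by
  have key : ∀ j : Fin g, _ := fun j => (hV j).exists_space (r := t)
    (M := X.inducedPoints (placedBase V P) j)
    (S := fun e => indexState (placedCount P j) e)
    (T := fun e => indexState (placedCount P (j + 1)) e)
    ((indexState_strictMono _).comp Fin.val_strictMono)
    ((indexState_strictMono _).comp Fin.val_strictMono)
    (fun e => by
      rw [X.multisetDivisor_p, leftCount_placedBase hV hP]
      exact placedCount_le_chainLeft ht hP j e)
    (fun e => by
      rw [X.multisetDivisor_q]
      have h1 := chainRight_eq m j (indexState_le (placedCount_le P (j + 1)) (Fin.is_le e))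
      have h2 := chainLeft_add_le ht hg hP (j := j + 1) j.2 (Fin.is_le e)
      have h3 := rightCount_placedBase hV hP j
      change _ ≤ chainRight (2 * t) m j _
      rw [← hm] at h2
      rw [h1]
      omega)
    (fun e => exists_placed_section hV hP j (Fin.is_le e))
  choose U hU hrank hsec hp hq using key
  refine ⟨⟨placedBase V P, ⟨fun j => V.div j - X.inducedDivisor (placedBase V P) j, U,
    fun j => ?_, hrank, fun j => ?_, fun j k hjk i hi => ?_⟩, fun j => rfl, hU⟩, rfl⟩
  · rw [← divisorDegree_apply, map_sub, (hV j).degree_eq, X.inducedDivisor_eq,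
      divisorDegree_multisetDivisor]
    simp [EllipticChain.inducedPoints]
  · rw [X.inducedDivisor_eq]
    exact hsec j
  · have h1 := hp k ⟨i, Nat.lt_succ_iff.2 hi⟩
    have h2 := hq j ⟨i, Nat.lt_succ_iff.2 hi⟩
    have h3 := chainRight_eq m j (indexState_le (placedCount_le P (j + 1)) hi)
    have h4 := rightCount_placedBase hV hP j
    rw [X.multisetDivisor_p, leftCount_placedBase hV hP] at h1
    rw [X.multisetDivisor_q] at h2
    change chainLeft (2 * t) k _ = _ at h1
    change chainRight (2 * t) m j _ = _ at h2
    rw [X.inducedDivisor_eq, X.inducedDivisor_eq]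
    rw [← hjk] at h1
    simp only at h1 h2
    push_cast at *
    omega

end Chain

/-! ### Every inclusion comes from a placement -/

section Chain

variable {K : Type*} [Field K] [DecidableEq K] {g : ℕ} {X : EllipticChain K g} [IsAlgClosed K]
  {t : ℕ} {m : ℤ} {V : LimitLinearSeries X (2 * t) m} {P : Fin (t + 1) → Fin g}

theorem placedPoint_injective (hV : HasChainAspects V) (hP : IsPlacement (2 * t) P) :
    Function.Injective (placedPoint V P) := by
  have key : ∀ i k : Fin (t + 1), i < k → placedPoint V P i ≠ placedPoint V P k := by
    intro i k hik h
    have h1 := (retract_placedPoint_eq_p hV hP i (P k)).2 (hP.1 hik)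
    rw [h] at h1
    exact lt_irrefl _ ((retract_placedPoint_eq_p hV hP k (P k)).1 h1)
  intro i k h
  rcases lt_trichotomy i k with hik | hik | hik
  · exact absurd h (key _ _ hik)
  · exact hik
  · exact absurd h.symm (key _ _ hik)

/-- The number of base points passed grows from 0 to `t + 1` in steps of at most one, so each value
in between is left on some component. -/
theorem Inclusion.Shape.exists_leftCount_eq {I : Inclusion V t (t + 1)} (hI : I.Shape) (hg : 0 < g)
    (i : Fin (t + 1)) :
    ∃ j : Fin g, X.leftCount I.base j = i ∧ (X.freePoints I.base j).card = 1 := by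
  have key : ∀ (n : ℕ) (j : Fin g), (j : ℕ) = n → ∀ i,
      i < X.leftCount I.base j + (X.freePoints I.base j).card →
      ∃ j : Fin g, X.leftCount I.base j = i ∧ (X.freePoints I.base j).card = 1 := by
    intro n
    induction n with
    | zero =>
      intro j hj i hi
      have h1 := hI.first j hj
      have h2 := hI.card_le j
      exact ⟨j, by omega, by omega⟩
    | succ n ih =>
      intro j hj i hi
      have h1 := hI.succ ⟨n, by omega⟩ j hj.symm
      have h2 := hI.card_le j
      by_cases h3 : i < X.leftCount I.base j
      · exact ih ⟨n, by omega⟩ rfl i (by omega)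
      · exact ⟨j, by omega, by omega⟩
  refine key (g - 1) ⟨g - 1, by omega⟩ rfl i ?_
  rw [hI.last ⟨g - 1, by omega⟩ (Nat.sub_add_cancel hg)]
  exact i.2

theorem Inclusion.Shape.leftCount_add_le {I : Inclusion V t (t + 1)} (hI : I.Shape) {i j : Fin g}
    (hij : i < j) :
    X.leftCount I.base i + (X.freePoints I.base i).card ≤ X.leftCount I.base j := by
  have key : ∀ (n : ℕ) (j : Fin g), (j : ℕ) = i + 1 + n →
      X.leftCount I.base i + (X.freePoints I.base i).card ≤ X.leftCount I.base j := by
    intro n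
    induction n with
    | zero => exact fun j hj => (hI.succ i j hj.symm).ge
    | succ n ih =>
      intro j hj
      have h1 := hI.succ ⟨i + 1 + n, by omega⟩ j hj.symm
      have h2 := ih ⟨i + 1 + n, by omega⟩ rfl
      omega
  refine key (j - (i + 1)) j ?_
  rw [Fin.lt_def] at hij
  omega

/-- The placed points are `t + 1` distinct points among the `t + 1` base points, so there are no
others. -/
theorem Inclusion.Shape.exists_placement (hV : HasChainAspects V) {I : Inclusion V t (t + 1)}
    (hI : I.Shape) (hg : 0 < g) :
    ∃ P : Fin (t + 1) → Fin g, IsPlacement (2 * t) P ∧ I.base = placedBase V P := by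
  choose P hPl hPc using hI.exists_leftCount_eq hg
  have hP : IsPlacement (2 * t) P := by
    refine ⟨fun i k hik => ?_, fun i => ?_⟩
    · by_contra! h
      rw [Fin.lt_def] at hik
      rcases h.eq_or_lt with h | h
      · have h1 := hPl i
        rw [← h, hPl] at h1
        omega
      · have h1 := hI.leftCount_add_le h
        rw [hPl, hPl] at h1
        omega
    · have h1 := (hI.freePoints_eq hV (hPc i)).2.1
      rw [hPl] at h1
      exact h1.symm
  refine ⟨P, hP, Subtype.ext (Multiset.eq_of_le_of_card_le ?_ ?_).symm⟩
  · refine (Multiset.le_iff_subset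
      (Multiset.Nodup.map (placedPoint_injective hV hP) Finset.univ.nodup)).2 fun y hy => ?_
    obtain ⟨i, -, rfl⟩ := Multiset.mem_map.1 hy
    have h1 := (hI.freePoints_eq hV (hPc i)).2.2
    rw [hPl] at h1
    have h2 : chainZero V (P i) (2 * i) ∈ X.freePoints I.base (P i) := by
      rw [h1]
      exact Multiset.mem_singleton_self _
    obtain ⟨z, hz, hzi⟩ := Multiset.mem_map.1 (Multiset.mem_of_mem_filter h2)
    have h3 := hV.chainZero_placement_ne hP i
    rw [X.eq_mk_of_retract_eq hzi h3.1 h3.2] at hz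
    exact hz
  · rw [(placedBase V P).2, I.base.2]

/-- Inclusions correspond to placements of the base points. -/
theorem nonempty_inclusion_equiv (hV : HasChainAspects V) {u : ℕ} (ht : 1 ≤ t) (hu : 1 ≤ u)
    (hg : g = (2 * t + 1) * u) (hm : m = (2 * t : ℕ) * (u + 1)) :
    Nonempty ({P : Fin (t + 1) → Fin g // IsPlacement (2 * t) P} ≃ Inclusion V t (t + 1)) := by
  have hg0 : 0 < g := by
    rw [hg]
    positivity
  have key := fun P : {P : Fin (t + 1) → Fin g // IsPlacement (2 * t) P} =>
    exists_inclusion_of_placement hV ht hg hm P.2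
  choose F hF using key
  refine ⟨Equiv.ofBijective F ⟨fun P P' h => ?_, fun I => ?_⟩⟩
  · refine Subtype.ext (placedBase_injective hV P.2 P'.2 ?_)
    rw [← hF, ← hF, h]
  · obtain ⟨P, hP, h⟩ := (I.shape hV hg hm).exists_placement hV hg0
    exact ⟨⟨P, hP⟩, Inclusion.eq_of_base_eq hV hg hm ((hF _).trans h.symm)⟩

end Chain

/-! ### Counting placements -/

theorem GammaPath.ext_col {s d : ℕ} {c c' : GammaPath s d}
    (h : ∀ i, (c.vertex i).col = (c'.vertex i).col) : c = c' := by
  have key : ∀ v w : GammaVertex s d, v.row = w.row → v.col = w.col → v = w := by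
    rintro ⟨⟩ ⟨⟩ h1 h2
    simp only at h1 h2
    subst h1 h2
    rfl
  have h1 : c.vertex = c'.vertex := funext fun i => key _ _ ((c.row_eq i).trans (c'.row_eq i).symm)
    (h i)
  cases c
  cases c'
  simp only at h1
  subst h1
  rfl

theorem GammaPath.col_mem {s d : ℕ} (c : GammaPath s d) (i : Fin d) :
    (i : ℕ) + 1 ≤ (c.vertex i).col ∧ (c.vertex i).col ≤ s + i := by
  have h1 := (c.vertex i).row_le_col
  have h2 := (c.vertex i).col_lt
  rw [c.row_eq] at h1 h2
  omega

instance (s d : ℕ) : Finite (GammaPath s d) := by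
  refine Finite.of_injective
    (fun c : GammaPath s d => fun i => (⟨(c.vertex i).col, ?_⟩ : Fin (s + d + 1)))
    fun c c' h => GammaPath.ext_col fun i => ?_
  · have := (c.col_mem i).2
    omega
  · simpa using congrFun h i

/-- The path with given columns. -/
def GammaPath.ofCol {s d : ℕ} (col : Fin d → ℕ)
    (h : ∀ i : Fin d, (i : ℕ) + 1 ≤ col i ∧ col i ≤ s + i) : GammaPath s d where
  vertex i := ⟨i + 1, col i, by omega, i.2, (h i).1, by have := (h i).2; omega⟩
  row_eq _ := rfl
  adj i j hij := by
    change (j : ℕ) + 1 = i + 1 + 1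
    omega

/-- The number of backwards edges of a path above a given row. -/
def GammaPath.backwardsBefore {s d : ℕ} (c : GammaPath s d) (i : ℕ) : ℕ :=
  (Finset.univ.filter fun e : Fin d × Fin d =>
    ((e.1 : ℕ) + 1 = e.2 ∧ (c.vertex e.2).col < (c.vertex e.1).col) ∧ (e.2 : ℕ) ≤ i).card

theorem GammaPath.backwardsBefore_zero {s d : ℕ} (c : GammaPath s d) :
    c.backwardsBefore 0 = 0 := by
  rw [backwardsBefore, Finset.card_eq_zero, Finset.filter_eq_empty_iff]
  intro e _ h
  omega

theorem GammaPath.backwardsBefore_succ {s d : ℕ} (c : GammaPath s d) {i k : Fin d}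
    (h : (i : ℕ) + 1 = k) : c.backwardsBefore k =
      c.backwardsBefore i + if (c.vertex k).col < (c.vertex i).col then 1 else 0 := by
  have h1 : (if (c.vertex k).col < (c.vertex i).col then 1 else 0) =
      (Finset.univ.filter fun e : Fin d × Fin d => e = (i, k) ∧
        (c.vertex k).col < (c.vertex i).col).card := by
    split_ifs with h2
    · simp only [h2, and_true]
      rw [Finset.filter_eq' Finset.univ (i, k), if_pos (Finset.mem_univ _), Finset.card_singleton]
    · simp [h2]
  rw [h1, backwardsBefore, backwardsBefore, ← Finset.card_union_of_disjoint]
  · congr 1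
    ext ⟨a, b⟩
    simp only [Finset.mem_filter, Finset.mem_univ, true_and, Finset.mem_union, Prod.mk.injEq]
    constructor
    · rintro ⟨⟨h2, h3⟩, h4⟩
      rcases (show (b : ℕ) ≤ i ∨ (b : ℕ) = k by omega) with h5 | h5
      · exact Or.inl ⟨⟨h2, h3⟩, h5⟩
      · obtain rfl := Fin.ext h5
        obtain rfl : a = i := Fin.ext (by omega)
        exact Or.inr ⟨⟨rfl, rfl⟩, h3⟩
    · rintro (⟨h2, h3⟩ | ⟨⟨rfl, rfl⟩, h3⟩)
      · exact ⟨h2, by omega⟩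
      · exact ⟨⟨h, h3⟩, le_rfl⟩
  · rw [Finset.disjoint_filter]
    rintro e - h2 ⟨rfl, -⟩
    simp only at h2
    omega

theorem GammaPath.backwardsBefore_last {s t : ℕ} (c : GammaPath s (t + 1)) :
    c.backwardsBefore t = c.backwardsEdges := by
  rw [backwardsBefore, backwardsEdges]
  congr 1
  refine Finset.filter_congr fun e _ => ?_
  have := e.2.2
  exact and_iff_left (by omega)

theorem GammaPath.backwardsBefore_le {s t : ℕ} (c : GammaPath s (t + 1)) (i : Fin (t + 1)) :
    c.backwardsBefore i ≤ i := by
  induction i using Fin.induction with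
  | zero => rw [Fin.val_zero, c.backwardsBefore_zero]
  | succ i ih =>
    have h := c.backwardsBefore_succ (i := i.castSucc) (k := i.succ) (by simp)
    rw [Fin.val_castSucc] at ih h
    rw [h, Fin.val_succ]
    split_ifs <;> omega

/-- If all `t` edges went backwards, the column would fall by at least `t`, from at most `2 t` in
the first row to at least `t + 1` in the last. This also keeps the subtraction `t + 1 + u - 2 - k`
from being truncated. -/
theorem GammaPath.backwardsEdges_lt {t : ℕ} (c : GammaPath (2 * t) (t + 1)) :
    c.backwardsEdges < t := by
  have key : ∀ i : Fin (t + 1), c.backwardsBefore i = i →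
      (c.vertex i).col + i ≤ (c.vertex 0).col := by
    intro i
    induction i using Fin.induction with
    | zero => simp
    | succ i ih =>
      have h := c.backwardsBefore_succ (i := i.castSucc) (k := i.succ) (by simp)
      have h1 := c.backwardsBefore_le i.castSucc
      rw [Fin.val_castSucc] at ih h h1
      rw [h, Fin.val_succ]
      split_ifs
      · intro h2
        have := ih (by omega)
        omega
      · omega
  rw [← c.backwardsBefore_last]
  have h1 := c.backwardsBefore_le (Fin.last t)
  have h2 := key (Fin.last t)
  have h3 := (c.col_mem (Fin.last t)).1
  have h4 := (c.col_mem 0).2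
  rw [Fin.val_last] at h1 h2 h3
  rw [Fin.val_zero] at h4
  omega

/-- There are `N.choose d` strictly increasing sequences of length `d` of numbers below `N`. -/
theorem card_strictMono_lt (d N : ℕ) :
    Nat.card {C : Fin d → ℕ // StrictMono C ∧ ∀ i, C i < N} = N.choose d := by
  have e : {C : Fin d → ℕ // StrictMono C ∧ ∀ i, C i < N} ≃ (Fin d ↪o Fin N) :=
    { toFun C := OrderEmbedding.ofStrictMono (fun i => ⟨C.1 i, C.2.2 i⟩) fun _ _ h => C.2.1 h
      invFun f := ⟨fun i => f i, fun _ _ h => f.strictMono h, fun i => (f i).2⟩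
      left_inv _ := rfl
      right_inv _ := rfl }
  rw [Nat.card_congr (e.trans Set.powersetCard.ofFinEmbEquiv), Set.powersetCard.card,
    Nat.card_fin]

/-- For `a` and `b` in `[1, S - 1]`, the shift by 2 can never make up for a smaller quotient, and a
larger quotient always suffices. For equal quotients the condition is `a ≤ b + 1`. Excluding the
residue 0 is essential here. -/
theorem lt_iff_of_residues {S a b C C' : ℤ} (ha : 1 ≤ a) (ha' : a < S) (hb : 1 ≤ b) (hb' : b < S) :
    a + S * C < 2 + b + S * C' ↔ C + (if b + 1 < a then 1 else 0) ≤ C' := by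
  rcases lt_trichotomy C' C with h | rfl | h
  · have : S * (C' + 1) ≤ S * C := mul_le_mul_of_nonneg_left h (by omega)
    rw [mul_add, mul_one] at this
    split_ifs <;> omega
  · split_ifs <;> omega
  · have : S * (C + 1) ≤ S * C' := mul_le_mul_of_nonneg_left h (by omega)
    rw [mul_add, mul_one] at this
    split_ifs <;> omega

theorem eq_of_add_mul_eq {S a b C C' : ℤ} (ha : 0 ≤ a) (ha' : a < S) (hb : 0 ≤ b) (hb' : b < S)
    (h : a + S * C = b + S * C') : a = b ∧ C = C' := by
  rcases lt_trichotomy C' C with h1 | rfl | h1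
  · have : S * (C' + 1) ≤ S * C := mul_le_mul_of_nonneg_left h1 (by omega)
    rw [mul_add, mul_one] at this
    omega
  · exact ⟨by omega, rfl⟩
  · have : S * (C + 1) ≤ S * C' := mul_le_mul_of_nonneg_left h1 (by omega)
    rw [mul_add, mul_one] at this
    omega

/-- The positions on the chain given by a path and a strictly increasing sequence. -/
def pathPosition {s t : ℕ} (c : GammaPath s (t + 1)) (C : Fin (t + 1) → ℕ) (i : Fin (t + 1)) : ℤ :=
  i + (c.vertex i).col + (s + 1) * (C i + c.backwardsBefore i - i)

/-- With residues `col - i`, an edge is backwards precisely if the quotient has to grow; the term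
`backwardsBefore` supplies that growth, and the summand `-i` makes the remaining inequality on `C`
strict. -/
theorem pathPosition_succ_lt {s t : ℕ} (c : GammaPath s (t + 1)) (C : Fin (t + 1) → ℕ)
    (i : Fin t) : pathPosition c C i.castSucc < pathPosition c C i.succ ↔
      C i.castSucc < C i.succ := by
  have h := c.backwardsBefore_succ (i := i.castSucc) (k := i.succ) (by simp)
  have h1 := c.col_mem i.castSucc
  have h2 := c.col_mem i.succ
  have h3 := lt_iff_of_residues (S := s + 1) (a := (c.vertex i.castSucc).col - i)
    (b := (c.vertex i.succ).col - (i + 1))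
    (C := C i.castSucc + c.backwardsBefore i.castSucc - i)
    (C' := C i.succ + c.backwardsBefore i.succ - (i + 1))
    (by simp at h1 h2; omega) (by simp at h1 h2; omega) (by simp at h1 h2; omega)
    (by simp at h1 h2; omega)
  unfold pathPosition
  rw [h] at h3 ⊢
  simp only [Fin.val_castSucc, Fin.val_succ] at h3 ⊢
  push_cast at h3 ⊢
  generalize ((s : ℤ) + 1) * _ = x at h3 ⊢
  generalize ((s : ℤ) + 1) * _ = y at h3 ⊢
  split_ifs at h3 ⊢ <;> omega

theorem strictMono_pathPosition_iff {s t : ℕ} (c : GammaPath s (t + 1)) (C : Fin (t + 1) → ℕ) :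
    StrictMono (pathPosition c C) ↔ StrictMono C := by
  rw [Fin.strictMono_iff_lt_succ, Fin.strictMono_iff_lt_succ]
  exact forall_congr' fun i => pathPosition_succ_lt c C i

/-- In the last row `t + col` lies in `[2t + 1, 4t]`, so the position is in block `C + b - t + 1`,
with `b` the number of backwards edges, and this has to be less than `u`. -/
theorem pathPosition_last_lt {t u : ℕ} (hu : 1 ≤ u) (c : GammaPath (2 * t) (t + 1))
    (C : Fin (t + 1) → ℕ) : pathPosition c C (Fin.last t) < ((2 * t + 1) * u : ℕ) ↔
      C (Fin.last t) < t + 1 + u - 2 - c.backwardsEdges := by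
  have h1 := c.col_mem (Fin.last t)
  have h2 := c.backwardsEdges_lt
  rw [Fin.val_last] at h1
  unfold pathPosition
  rw [Fin.val_last, c.backwardsBefore_last]
  generalize c.backwardsEdges = b at h2 ⊢
  generalize (c.vertex (Fin.last t)).col = l at h1 ⊢
  generalize C (Fin.last t) = x
  push_cast
  have h3 : (x : ℤ) + b - t + 2 ≤ u ∨ (u : ℤ) ≤ x + b - t + 1 := by omega
  rcases h3 with h3 | h3
  · have h4 := mul_le_mul_of_nonneg_left h3 (show (0 : ℤ) ≤ 2 * t + 1 by omega)
    rw [mul_add _ _ (2 : ℤ)] at h4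
    omega
  · have h4 := mul_le_mul_of_nonneg_left h3 (show (0 : ℤ) ≤ 2 * t + 1 by omega)
    rw [mul_add _ _ (1 : ℤ)] at h4
    omega

theorem pathPosition_injective {s t : ℕ} {c c' : GammaPath s (t + 1)} {C C' : Fin (t + 1) → ℕ}
    (h : pathPosition c C = pathPosition c' C') : c = c' ∧ C = C' := by
  have key : ∀ i, _ := fun i => eq_of_add_mul_eq (S := s + 1) (a := (c.vertex i).col - i)
    (b := (c'.vertex i).col - i) (C := C i + c.backwardsBefore i - i)
    (C' := C' i + c'.backwardsBefore i - i)
    (by have := c.col_mem i; omega) (by have := c.col_mem i; omega)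
    (by have := c'.col_mem i; omega) (by have := c'.col_mem i; omega)
    (by have := congrFun h i; unfold pathPosition at this; omega)
  obtain rfl : c = c' := GammaPath.ext_col fun i => by have := (key i).1; omega
  exact ⟨rfl, funext fun i => by have := (key i).2; omega⟩

theorem pathPosition_mod_ne {t : ℕ} (c : GammaPath (2 * t) (t + 1)) (C : Fin (t + 1) → ℕ)
    {i : Fin (t + 1)} {j : ℕ} (h : pathPosition c C i = j) : j % (2 * t + 1) ≠ 2 * (i : ℕ) := by
  intro hj
  have h1 := Nat.div_add_mod j (2 * t + 1)
  rw [hj] at h1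
  have h2 := c.col_mem i
  have h3 : ((2 * t + 1 : ℕ) : ℤ) * (j / (2 * t + 1) : ℕ) + 2 * (i : ℕ) = j := by exact_mod_cast h1
  have h4 := eq_of_add_mul_eq (S := (2 * t : ℕ) + 1) (a := (c.vertex i).col - i) (b := 0)
    (C := C i + c.backwardsBefore i - i) (C' := (j / (2 * t + 1) : ℕ)) (by omega) (by omega)
    le_rfl (by omega) (by
      unfold pathPosition at h
      push_cast at h h3 ⊢
      linarith)
  omega

theorem exists_placement_of_path {t u : ℕ} (hu : 1 ≤ u) (c : GammaPath (2 * t) (t + 1))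
    {C : Fin (t + 1) → ℕ} (hC : StrictMono C) (hCN : ∀ i, C i < t + 1 + u - 2 - c.backwardsEdges) :
    ∃ P : Fin (t + 1) → Fin ((2 * t + 1) * u), IsPlacement (2 * t) P ∧
      ∀ i, pathPosition c C i = (P i : ℕ) := by
  have hmono := (strictMono_pathPosition_iff c C).2 hC
  have h0 : ∀ i, 0 ≤ pathPosition c C i := by
    intro i
    refine le_trans ?_ (hmono.monotone (Fin.zero_le i))
    unfold pathPosition
    rw [Fin.val_zero, c.backwardsBefore_zero]
    simp only [Nat.cast_zero, add_zero, sub_zero]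
    positivity
  have h1 : ∀ i, pathPosition c C i < ((2 * t + 1) * u : ℕ) := fun i =>
    (hmono.monotone (Fin.le_last i)).trans_lt ((pathPosition_last_lt hu c C).2 (hCN _))
  have h2 : ∀ i, pathPosition c C i = ((pathPosition c C i).toNat : ℕ) := fun i =>
    (Int.toNat_of_nonneg (h0 i)).symm
  refine ⟨fun i => ⟨(pathPosition c C i).toNat, by have := h1 i; have := h2 i; omega⟩,
    ⟨fun i k hik => ?_, fun i => pathPosition_mod_ne c C (h2 i)⟩, h2⟩
  have h3 := hmono hik
  rw [h2 i, h2 k] at h3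
  exact_mod_cast h3

theorem exists_path_of_placement {t u : ℕ} (hu : 1 ≤ u)
    {P : Fin (t + 1) → Fin ((2 * t + 1) * u)} (hP : IsPlacement (2 * t) P) :
    ∃ (c : GammaPath (2 * t) (t + 1)) (C : Fin (t + 1) → ℕ), (StrictMono C ∧
      ∀ i, C i < t + 1 + u - 2 - c.backwardsEdges) ∧ ∀ i, pathPosition c C i = (P i : ℕ) := by
  -- Division of `P i - 2 i` by `2 t + 1`; remainder 0 is the forbidden residue. The dividend may a
  -- priori be negative, hence the integer quotient.
  have hres : ∀ i : Fin (t + 1), ∃ (a : ℕ) (x : ℤ), 1 ≤ a ∧ a ≤ 2 * t ∧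
      ((P i : ℕ) : ℤ) = 2 * i + a + (2 * t + 1) * x := by
    intro i
    have h1 := Int.emod_nonneg ((P i : ℕ) - 2 * (i : ℤ)) (b := 2 * t + 1) (by omega)
    have h2 := Int.emod_lt_of_pos ((P i : ℕ) - 2 * (i : ℤ)) (b := 2 * t + 1) (by omega)
    have h3 := Int.emod_add_mul_ediv ((P i : ℕ) - 2 * (i : ℤ)) (2 * t + 1)
    generalize ((P i : ℕ) - 2 * (i : ℤ)) % (2 * t + 1) = a at h1 h2 h3
    generalize ((P i : ℕ) - 2 * (i : ℤ)) / (2 * t + 1) = x at h3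
    refine ⟨a.toNat, x, ?_, by omega, by omega⟩
    by_contra h4
    obtain rfl : a = 0 := by omega
    refine hP.2 i ?_
    have h5 : (P i : ℕ) = 2 * (i : ℕ) + (2 * t + 1) * x.toNat := by
      have : 0 ≤ x := by
        by_contra! h6
        have h7 := mul_le_mul_of_nonneg_left (show x ≤ -1 by omega)
          (show (0 : ℤ) ≤ 2 * t + 1 by omega)
        omega
      zify
      rw [Int.toNat_of_nonneg this]
      omega
    rw [h5, Nat.add_mul_mod_self_left, Nat.mod_eq_of_lt (by omega)]
  choose a x ha ha' hx using hres
  have hcol : ∀ i : Fin (t + 1), (i : ℕ) + 1 ≤ a i + i ∧ a i + i ≤ 2 * t + i := fun i => by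
    have := ha i
    have := ha' i
    omega
  obtain ⟨c, hc⟩ : ∃ c : GammaPath (2 * t) (t + 1), ∀ i, (c.vertex i).col = a i + i :=
    ⟨GammaPath.ofCol (fun i => a i + i) hcol, fun _ => rfl⟩
  -- The quotient is nonnegative in the first row and grows along every backwards edge, so `x i + i
  -- - backwardsBefore i` is a natural number and `toNat` below loses nothing.
  have hback : ∀ i : Fin (t + 1), (c.backwardsBefore i : ℤ) ≤ x i := by
    intro i
    induction i using Fin.induction with
    | zero =>
      rw [Fin.val_zero, c.backwardsBefore_zero]
      by_contra! h6
      have h7 := mul_le_mul_of_nonneg_left (show x 0 ≤ -1 by push_cast at h6; omega)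
        (show (0 : ℤ) ≤ 2 * t + 1 by omega)
      have h8 := hx 0
      have h9 := ha' 0
      rw [Fin.val_zero] at h8
      push_cast at h8
      omega
    | succ i ih =>
      have h := c.backwardsBefore_succ (i := i.castSucc) (k := i.succ) (by simp)
      have h1 := lt_iff_of_residues (S := 2 * t + 1) (a := a i.castSucc) (b := a i.succ)
        (C := x i.castSucc) (C' := x i.succ) (by have := ha i.castSucc; omega)
        (by have := ha' i.castSucc; omega) (by have := ha i.succ; omega)
        (by have := ha' i.succ; omega)
      have h2 : (P i.castSucc : ℕ) < P i.succ := hP.1 i.castSucc_lt_succ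
      have h3 := hx i.castSucc
      have h4 := hx i.succ
      have h5 := h1.1 (by rw [Fin.val_castSucc] at h3; rw [Fin.val_succ] at h4; omega)
      rw [h, hc, hc, Fin.val_succ, Fin.val_castSucc]
      rw [Fin.val_castSucc] at ih
      split_ifs at h5 ⊢ <;> omega
  have hpos : ∀ i, pathPosition c (fun i => (x i + i - c.backwardsBefore i).toNat) i =
      (P i : ℕ) := by
    intro i
    unfold pathPosition
    have h1 := hback i
    rw [Int.toNat_of_nonneg (by omega), hc, hx]
    push_cast
    ring
  generalize (fun i => (x i + i - c.backwardsBefore i).toNat) = C at hpos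
  have hC : StrictMono C := by
    rw [← strictMono_pathPosition_iff c]
    intro i k hik
    rw [hpos, hpos]
    exact_mod_cast hP.1 hik
  refine ⟨c, C, ⟨hC, fun i => ?_⟩, hpos⟩
  refine (hC.monotone (Fin.le_last i)).trans_lt ((pathPosition_last_lt hu c C).1 ?_)
  rw [hpos]
  exact_mod_cast (P (Fin.last t)).2

theorem nonempty_path_equiv {t u : ℕ} (hu : 1 ≤ u) :
    Nonempty ((Σ c : GammaPath (2 * t) (t + 1), {C : Fin (t + 1) → ℕ // StrictMono C ∧
      ∀ i, C i < t + 1 + u - 2 - c.backwardsEdges}) ≃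
      {P : Fin (t + 1) → Fin ((2 * t + 1) * u) // IsPlacement (2 * t) P}) := by
  have key := fun x : (Σ c : GammaPath (2 * t) (t + 1), {C : Fin (t + 1) → ℕ // StrictMono C ∧
      ∀ i, C i < t + 1 + u - 2 - c.backwardsEdges}) =>
    exists_placement_of_path hu x.1 x.2.2.1 x.2.2.2
  choose F hF hpos using key
  refine ⟨Equiv.ofBijective (fun x => ⟨F x, hF x⟩) ⟨?_, ?_⟩⟩
  · rintro ⟨c, C⟩ ⟨c', C'⟩ h
    have h1 : pathPosition c C.1 = pathPosition c' C'.1 := funext fun i => by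
      have h2 := hpos ⟨c, C⟩ i
      have h3 := hpos ⟨c', C'⟩ i
      rw [show F ⟨c, C⟩ = F ⟨c', C'⟩ from congrArg Subtype.val h] at h2
      exact h2.trans h3.symm
    obtain ⟨rfl, h2⟩ := pathPosition_injective h1
    rw [Subtype.ext h2]
  · rintro ⟨P, hP⟩
    obtain ⟨c, C, hC, h⟩ := exists_path_of_placement hu hP
    refine ⟨⟨c, C, hC⟩, Subtype.ext (funext fun i => Fin.ext ?_)⟩
    have h1 := hpos ⟨c, C, hC⟩ i
    rw [h] at h1
    exact_mod_cast h1.symm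

/-- The number of placements, as a sum over paths. -/
theorem card_placements {t u : ℕ} (hu : 1 ≤ u) :
    Nat.card {P : Fin (t + 1) → Fin ((2 * t + 1) * u) // IsPlacement (2 * t) P} =
      ∑ k ∈ Finset.range t, gammaPathCount (2 * t) (t + 1) k *
        (t + 1 + u - 2 - k).choose (t + 1) := by
  classical
  obtain ⟨e⟩ := nonempty_path_equiv (t := t) hu
  have : Fintype (GammaPath (2 * t) (t + 1)) := Fintype.ofFinite _
  have hfin : ∀ N, Finite {C : Fin (t + 1) → ℕ // StrictMono C ∧ ∀ i, C i < N} := fun N =>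
    Finite.of_injective (fun C => fun i => (⟨C.1 i, C.2.2 i⟩ : Fin N)) fun C C' h =>
      Subtype.ext (funext fun i => by simpa using congrFun h i)
  rw [← Nat.card_congr e, Nat.card_sigma]
  simp_rw [card_strictMono_lt]
  rw [← Finset.sum_fiberwise_of_maps_to (s := Finset.univ) (t := Finset.range t)
    (g := GammaPath.backwardsEdges) fun c _ => Finset.mem_range.2 c.backwardsEdges_lt]
  refine Finset.sum_congr rfl fun k _ => ?_
  rw [Finset.sum_congr rfl fun c hc => by rw [(Finset.mem_filter.1 hc).2], Finset.sum_const,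
    smul_eq_mul, gammaPathCount, Nat.card_eq_fintype_card, Fintype.card_subtype]

end

/-! ### The theorem -/

theorem mainTheorem9 {K : Type*} [Field K] [IsAlgClosed K] [DecidableEq K]
    (g s d t u : ℕ) (m : ℤ) (ht : 1 ≤ t) (hu : 1 ≤ u)
    (hr : (d : ℤ) - s + t = 1) (hg : g = (s + 1) * u)
    (hρ : brillNoetherRho g s m = 0) (hμ : secantMu d t s = 0)
    (X : EllipticChain K g) (V : LimitLinearSeries X s m)
    (hV : V.HasWordType fun j => Fin.ofNat (s + 1) (j : ℕ)) :
    d = t + 1 ∧ s = 2 * t ∧ m = 2 * t * (u + 1) ∧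
      Finite (Inclusion V t d) ∧
      Nat.card (Inclusion V t d) =
        ∑ k ∈ Finset.range (d - 1), gammaPathCount s d k * (d + u - 2 - k).choose d := by
  obtain rfl : d = t + 1 := by
    have h : (d : ℤ) - (d - s + t) * (t + 1) = 0 := hμ
    rw [hr] at h
    omega
  obtain rfl : s = 2 * t := by omega
  -- With `g = (s + 1) u` the number `ρ` is `(s + 1)(u - (s + g - m))`, so `m = s + g - u`.
  have hm : m = (2 * t : ℕ) * (u + 1) := by
    have h1 : ((2 * t : ℕ) + 1 : ℤ) * (u - ((2 * t : ℕ) + g - m)) = 0 := by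
      rw [mul_sub]
      have h2 : (g : ℤ) = ((2 * t : ℕ) + 1) * u := by rw [hg]; push_cast; ring
      rw [← h2]
      exact hρ
    rcases mul_eq_zero.1 h1 with h2 | h2
    · omega
    · rw [hg] at h2
      push_cast at h2 ⊢
      linarith
  have hVA := hasChainAspects V hV hg hm
  obtain ⟨e⟩ := nonempty_inclusion_equiv hVA ht hu hg hm
  refine ⟨rfl, rfl, by rw [hm]; push_cast; ring, Finite.of_equiv _ e, ?_⟩
  rw [← Nat.card_congr e, Nat.add_sub_cancel]
  subst hg
  exact card_placements hu
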